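/- **Conventions.** Let $X$ be a complex Banach space and $S_\varphi=\{z\in\mathbb C: z\ne0,\ |\arg z|<\varphi\}$. A linear, not necessarily densely defined operator $A$ on $X$ is *sectorial of angle* $\varphi\in(0,\pi)$ if $\sigma(A)\subseteq\overline{S_\varphi}$ and, for every $\varphi'\in(\varphi,\pi)$, $\sup\{|\lambda R(\lambda,A)|_{\mathcal L(X)}:\lambda\in\mathbb C\setminus S_{\varphi'},\ \lambda\neq 0\}<\infty$, where $R(\lambda,A)=(\lambda-A)^{-1}$; it is *sectorial* if it is sectorial of some angle, and then $\varphi_A$ denotes the infimum of these angles. $H_0^\infty(S_\varphi)$ is the set of bounded holomorphic $f$ on $S_\varphi$ with $|f(z)|\le C\min(|z|^s,|z|^{-s})$ for some $C,s>0$, and $\mathcal E(S_\varphi)=H^\infty_0(S_\varphi)\oplus\langle(1+z)^{-1}\rangle\oplus\langle1\rangle$. For $\varphi\in(\varphi_A,\pi)$ and $f=f_0+\frac{\lambda}{1+z}+\mu\in\mathcal E(S_\varphi)$ with $f_0\in H_0^\infty(S_\varphi)$, put $f(A)=\frac1{2\pi i}\int_{\partial S_\omega}f_0(z)R(z,A)\,dz+\lambda(I+A)^{-1}+\mu$,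 where $\omega\in(\varphi_A,\varphi)$ is arbitrary and $\partial S_\omega$ is positively oriented. A *Banach function space* $\Phi$ is an order ideal of the space of (classes of) complex measurable functions on $[0,\infty)$ with Lebesgue measure, equipped with a complete norm such that $|f|\le|g|$ a.e. implies $\|f\|_\Phi\le\|g\|_\Phi$. $\Phi\in\mathfrak L_P$ means that the Hardy operator $Pf(t)=\frac1t\int_0^tf(s)\,ds$ is bounded on $\Phi$; in particular every $f\in\Phi$ is integrable on $(0,t)$ for all $t>0$. With the graph norm $|b|_{D(A)}=|b|+|Ab|$ and $K(t,x)=\inf\{|a|+t|b|_{D(A)}: a\in X,\ b\in D(A),\ a+b=x\}$, set $(X,D(A))_\Phi=\{x\in X:[t\mapsto t^{-1}K(t,x)]\in\Phi\}$ and $|x|_{(X,D(A))_\Phi}=\|t^{-1}K(t,x)\|_\Phi$. **Theorem 3.1.** Let $A$ be a sectorial operator on a complex Banach space $X$ and $\varphi\in(\varphi_A,\pi)$. Let $\psi$ be a holomorphic function on $S_\varphi$ such that (i) $\psi\in\mathcal E(S_\varphi)$ and $z^{-1}\psi\in\mathcal E(S_\varphi)$; (ii) $\lim_{z\to0}z^{-1}\psi(z)\ne0$,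 $\psi(z)\ne0$ for all $z\in S_\varphi$, and $\displaystyle\sup_{z\in S_\varphi,\ s\ge1}\left|\frac{\psi(sz)}{s\,\psi(z)}\right|<\infty$. Then, for every $\Phi\in\mathfrak L_P$ with $\min(1,\tfrac1t)\in\Phi$, $$(X,D(A))_\Phi=\bigl\{x\in X:\ [(0,\infty)\ni t\mapsto t^{-1}|\psi(tA)x|]\in\Phi\bigr\},$$ and there are constants $c,C>0$ with $$c\bigl(|x|+\|t^{-1}|\psi(tA)x|\|_\Phi\bigr)\le|x|_{(X,D(A))_\Phi}\le C\bigl(|x|+\|t^{-1}|\psi(tA)x|\|_\Phi\bigr)\qquad(x\in(X,D(A))_\Phi).$$ If, in addition, $A$ is invertible (that is, $0\notin\sigma(A)$), then there are constants $c,C>0$ with $$c\,\|t^{-1}|\psi(tA)x|\|_\Phi\le|x|_{(X,D(A))_\Phi}\le C\,\|t^{-1}|\psi(tA)x|\|_\Phi\qquad(x\in(X,D(A))_\Phi).$$ -/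

import Mathlib

open MeasureTheory Filter Topology

noncomputable section

namespace GenInterp

section Operators

variable {X : Type*} [NormedAddCommGroup X] [NormedSpace ℂ X]

/-- `R` is the bounded, everywhere defined, two-sided inverse of `z - A : D(A) → X`. -/
def IsResolventAt (A : X →ₗ.[ℂ] X) (z : ℂ) (R : X →L[ℂ] X) : Prop :=
  (∀ x : X, ∃ h : R x ∈ A.domain, z • R x - A ⟨R x, h⟩ = x) ∧
    ∀ y : A.domain, R (z • (y : X) - A y) = y

/-- The resolvent set `ρ(A)` of a (possibly unbounded) operator. -/
def resolventSetOf (A : X →ₗ.[ℂ] X) : Set ℂ :=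
  {z | ∃ R : X →L[ℂ] X, IsResolventAt A z R}

/-- The spectrum `σ(A)` of a (possibly unbounded) operator. -/
def spectrumOf (A : X →ₗ.[ℂ] X) : Set ℂ :=
  (resolventSetOf A)ᶜ

theorem IsResolventAt.unique {A : X →ₗ.[ℂ] X} {z : ℂ} {R R' : X →L[ℂ] X}
    (hR : IsResolventAt A z R) (hR' : IsResolventAt A z R') : R = R' := by
  ext x
  obtain ⟨h, hx⟩ := hR'.1 x
  have h2 := hR.2 ⟨R' x, h⟩
  rw [hx] at h2
  exact h2

open Classical in
/-- The resolvent `R(z, A) = (z - A)⁻¹` for `z ∈ ρ(A)` (and `0` by convention otherwise). -/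
def resolventOf (A : X →ₗ.[ℂ] X) (z : ℂ) : X →L[ℂ] X :=
  if h : ∃ R : X →L[ℂ] X, IsResolventAt A z R then h.choose else 0

/-- The open sector `S_φ = {z ≠ 0 : |arg z| < φ}`. -/
def sector (φ : ℝ) : Set ℂ :=
  {z | z ≠ 0 ∧ |z.arg| < φ}

/-- `A` is sectorial of angle `φ ∈ (0, π)`: the spectrum lies in the closed sector and
`z R(z, A)` is bounded outside every larger sector `S_φ'` (the vertex `z = 0`, which may
belong to the spectrum, is left out). -/
def IsSectorialOfAngle (A : X →ₗ.[ℂ] X) (φ : ℝ) : Prop :=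
  (0 < φ ∧ φ < Real.pi) ∧ spectrumOf A ⊆ closure (sector φ) ∧
    ∀ φ' : ℝ, φ < φ' → φ' < Real.pi →
      ∃ C : ℝ, ∀ z : ℂ, z ≠ 0 → z ∉ sector φ' → ‖z • resolventOf A z‖ ≤ C

/-- `A` is sectorial if it is sectorial of some angle. -/
def IsSectorial (A : X →ₗ.[ℂ] X) : Prop :=
  ∃ φ : ℝ, IsSectorialOfAngle A φ

/-- The angle of sectoriality `φ_A`. -/
def sectorialityAngle (A : X →ₗ.[ℂ] X) : ℝ :=
  sInf {φ : ℝ | IsSectorialOfAngle A φ}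

/-- `A` is invertible: `A : D(A) → X` is bijective with bounded inverse. -/
def IsInvertible (A : X →ₗ.[ℂ] X) : Prop :=
  (0 : ℂ) ∈ resolventSetOf A

end Operators

section FunctionalCalculus

/-- `f ∈ H^∞_0(S_φ)`: bounded and holomorphic on `S_φ`, with
`|f(z)| ≤ C min(|z|^s, |z|^(-s))` for some `C, s > 0`. -/
def MemHInftyZero (φ : ℝ) (f : ℂ → ℂ) : Prop :=
  DifferentiableOn ℂ f (sector φ) ∧ (∃ M : ℝ, ∀ z ∈ sector φ, ‖f z‖ ≤ M) ∧
    ∃ C s : ℝ, 0 < C ∧ 0 < s ∧ ∀ z ∈ sector φ, ‖f z‖ ≤ C * min (‖z‖ ^ s) (‖z‖ ^ (-s))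

/-- `f = f₀ + l (1 + z)⁻¹ + m` on `S_φ` with `f₀ ∈ H^∞_0(S_φ)`, where `d = (f₀, l, m)`. -/
def IsDecomposition (φ : ℝ) (f : ℂ → ℂ) (d : (ℂ → ℂ) × ℂ × ℂ) : Prop :=
  MemHInftyZero φ d.1 ∧ ∀ z ∈ sector φ, f z = d.1 z + d.2.1 * (1 + z)⁻¹ + d.2.2

/-- `f ∈ 𝓔(S_φ)`, the extended Dunford-Riesz class
`H^∞_0(S_φ) ⊕ ⟨(1 + z)⁻¹⟩ ⊕ ⟨1⟩`. -/
def MemE (φ : ℝ) (f : ℂ → ℂ) : Prop :=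
  ∃ d : (ℂ → ℂ) × ℂ × ℂ, IsDecomposition φ f d

variable {X : Type*} [NormedAddCommGroup X] [NormedSpace ℂ X]

/-- `(2πi)⁻¹ ∫_{∂S_ω} f(z) R(z, A) dz`, with `∂S_ω` positively oriented (from `∞ e^{iω}` to `0`
and then to `∞ e^{-iω}`). -/
def contourIntegral (A : X →ₗ.[ℂ] X) (ω : ℝ) (f : ℂ → ℂ) : X →L[ℂ] X :=
  (2 * (Real.pi : ℂ) * Complex.I)⁻¹ •
    ((∫ r in Set.Ioi (0 : ℝ),
        (Complex.exp (-(ω : ℂ) * Complex.I) * f (r * Complex.exp (-(ω : ℂ) * Complex.I))) •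
          resolventOf A (r * Complex.exp (-(ω : ℂ) * Complex.I))) -
      ∫ r in Set.Ioi (0 : ℝ),
        (Complex.exp ((ω : ℂ) * Complex.I) * f (r * Complex.exp ((ω : ℂ) * Complex.I))) •
          resolventOf A (r * Complex.exp ((ω : ℂ) * Complex.I)))

/-- `f(A)` for `f ∈ H^∞_0(S_φ)` and `φ ∈ (φ_A, π)`. The contour is the boundary of a sector
`S_ω` with `φ_A < ω < φ`, on whose choice the integral does not depend; `ω` is the midpoint. -/
def hInftyZeroCalculus (A : X →ₗ.[ℂ] X) (φ : ℝ) (f : ℂ → ℂ) : X →L[ℂ] X :=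
  contourIntegral A ((sectorialityAngle A + φ) / 2) f

open Classical in
/-- The primary functional calculus: `f(A) = f₀(A) + l (1 + A)⁻¹ + m` for
`f = f₀ + l (1 + z)⁻¹ + m ∈ 𝓔(S_φ)`, where `(1 + A)⁻¹ = -R(-1, A)`. The decomposition is
unique on `S_φ` (`IsDecomposition.unique`). Convention: `0` for `f ∉ 𝓔(S_φ)`. -/
def primaryCalculus (A : X →ₗ.[ℂ] X) (φ : ℝ) (f : ℂ → ℂ) : X →L[ℂ] X :=
  if h : MemE φ f then
    hInftyZeroCalculus A φ h.choose.1 + h.choose.2.1 • (-resolventOf A (-1)) +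
      h.choose.2.2 • ContinuousLinearMap.id ℂ X
  else 0

theorem ofReal_mem_sector {φ r : ℝ} (hφ : 0 < φ) (hr : 0 < r) : (r : ℂ) ∈ sector φ := by
  refine ⟨by exact_mod_cast hr.ne', ?_⟩
  rw [Complex.arg_ofReal_of_nonneg hr.le]
  simpa using hφ

theorem MemHInftyZero.tendsto_atTop {φ : ℝ} (hφ : 0 < φ) {f : ℂ → ℂ} (hf : MemHInftyZero φ f) :
    Tendsto (fun r : ℝ => f r) atTop (𝓝 0) := by
  obtain ⟨-, -, C, s, hC, hs, h⟩ := hf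
  have h1 : Tendsto (fun r : ℝ => C * r ^ (-s)) atTop (𝓝 0) := by
    simpa using (tendsto_rpow_neg_atTop hs).const_mul C
  refine squeeze_zero_norm' ?_ h1
  filter_upwards [eventually_gt_atTop 0] with r hr
  refine (h r (ofReal_mem_sector hφ hr)).trans ?_
  rw [Complex.norm_real, Real.norm_of_nonneg hr.le]
  gcongr
  exact min_le_right _ _

theorem MemHInftyZero.tendsto_zero {φ : ℝ} (hφ : 0 < φ) {f : ℂ → ℂ} (hf : MemHInftyZero φ f) :
    Tendsto (fun r : ℝ => f r) (𝓝[>] 0) (𝓝 0) := by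
  obtain ⟨-, -, C, s, hC, hs, h⟩ := hf
  have h1 : Tendsto (fun r : ℝ => C * r ^ s) (𝓝[>] 0) (𝓝 0) := by
    have h2 : Tendsto (fun r : ℝ => r ^ s) (𝓝 0) (𝓝 0) := by
      have := (Real.continuousAt_rpow_const 0 s (Or.inr hs.le)).tendsto
      rwa [Real.zero_rpow hs.ne'] at this
    simpa using (h2.mono_left nhdsWithin_le_nhds).const_mul C
  refine squeeze_zero_norm' ?_ h1
  filter_upwards [self_mem_nhdsWithin] with r hr
  have hr : 0 < r := hr
  refine (h r (ofReal_mem_sector hφ hr)).trans ?_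
  rw [Complex.norm_real, Real.norm_of_nonneg hr.le]
  gcongr
  exact min_le_left _ _

/-- The sum defining `𝓔(S_φ)` is direct. -/
theorem IsDecomposition.unique {φ : ℝ} (hφ : 0 < φ) {f : ℂ → ℂ} {d e : (ℂ → ℂ) × ℂ × ℂ}
    (hd : IsDecomposition φ f d) (he : IsDecomposition φ f e) :
    d.2 = e.2 ∧ ∀ z ∈ sector φ, d.1 z = e.1 z := by
  have key : ∀ d, IsDecomposition φ f d → Tendsto (fun r : ℝ => f r) atTop (𝓝 d.2.2) ∧
      Tendsto (fun r : ℝ => f r) (𝓝[>] 0) (𝓝 (d.2.1 + d.2.2)) := by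
    intro d hd
    constructor
    · have h1 : Tendsto (fun r : ℝ => (1 + (r : ℂ))⁻¹) atTop (𝓝 0) := by
        have : Tendsto (fun r : ℝ => (1 + r)⁻¹) atTop (𝓝 0) :=
          tendsto_inv_atTop_zero.comp (tendsto_atTop_add_const_left _ _ tendsto_id)
        have := (Complex.continuous_ofReal.tendsto 0).comp this
        simpa [Function.comp_def] using this
      have h2 := ((hd.1.tendsto_atTop hφ).add (h1.const_mul d.2.1)).add_const d.2.2
      simp only [mul_zero, add_zero, zero_add] at h2
      refine h2.congr' ?_
      filter_upwards [eventually_gt_atTop 0] with r hr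
      exact (hd.2 r (ofReal_mem_sector hφ hr)).symm
    · have h1 : Tendsto (fun r : ℝ => (1 + (r : ℂ))⁻¹) (𝓝[>] 0) (𝓝 1) := by
        have : Tendsto (fun r : ℝ => (1 + (r : ℂ))⁻¹) (𝓝 0) (𝓝 (1 + ((0 : ℝ) : ℂ))⁻¹) := by
          apply Tendsto.inv₀
          · exact ((Complex.continuous_ofReal.tendsto 0)).const_add 1
          · simp
        simpa using this.mono_left nhdsWithin_le_nhds
      have h2 := ((hd.1.tendsto_zero hφ).add (h1.const_mul d.2.1)).add_const d.2.2
      simp only [mul_one, zero_add] at h2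
      refine h2.congr' ?_
      filter_upwards [self_mem_nhdsWithin] with r hr
      exact (hd.2 r (ofReal_mem_sector hφ hr)).symm
  have hm := tendsto_nhds_unique (key d hd).1 (key e he).1
  have hl := tendsto_nhds_unique (key d hd).2 (key e he).2
  rw [hm] at hl
  have hl' := add_right_cancel hl
  refine ⟨Prod.ext hl' hm, fun z hz => ?_⟩
  have := (hd.2 z hz).symm.trans (he.2 z hz)
  rw [hl', hm] at this
  exact add_right_cancel (add_right_cancel this)

end FunctionalCalculus

section FunctionSpaces

/-- Lebesgue measure on the half-line. -/
abbrev halfLine : Measure ℝ :=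
  volume.restrict (Set.Ioi 0)

/-- A Banach function space over the half-line: an order ideal `carrier` of the space of (classes
of) complex measurable functions, with a complete lattice norm `normF`. -/
structure BanachFunctionSpace where
  /-- the elements of the space -/
  carrier : Submodule ℂ (ℝ →ₘ[halfLine] ℂ)
  /-- the norm of the space -/
  normF : Seminorm ℂ carrier
  eq_zero_of_normF : ∀ f : carrier, normF f = 0 → f = 0
  ideal : ∀ f g : ℝ →ₘ[halfLine] ℂ, (∀ᵐ t ∂halfLine, ‖f t‖ ≤ ‖g t‖) → g ∈ carrier → f ∈ carrier
  normF_mono : ∀ f g : carrier,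
    (∀ᵐ t ∂halfLine, ‖(f : ℝ →ₘ[halfLine] ℂ) t‖ ≤ ‖(g : ℝ →ₘ[halfLine] ℂ) t‖) →
      normF f ≤ normF g
  complete : ∀ u : ℕ → carrier,
    (∀ ε > 0, ∃ N, ∀ m ≥ N, ∀ n ≥ N, normF (u m - u n) < ε) →
      ∃ f : carrier, Tendsto (fun n => normF (u n - f)) atTop (𝓝 0)

namespace BanachFunctionSpace

/-- The function `u` on the half-line is measurable and (its class) belongs to `Φ`. -/
def Mem (Φ : BanachFunctionSpace) (u : ℝ → ℂ) : Prop :=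
  ∃ h : AEStronglyMeasurable u halfLine, AEEqFun.mk u h ∈ Φ.carrier

open Classical in
/-- The norm `‖u‖_Φ` of a function `u` that belongs to `Φ` (and `0` by convention otherwise). -/
def nrm (Φ : BanachFunctionSpace) (u : ℝ → ℂ) : ℝ :=
  if h : Φ.Mem u then Φ.normF ⟨AEEqFun.mk u h.choose, h.choose_spec⟩ else 0

end BanachFunctionSpace

/-- The Hardy operator `(Pf)(t) = t⁻¹ ∫_0^t f(s) ds`. -/
def hardy (f : ℝ → ℂ) (t : ℝ) : ℂ :=
  (t : ℂ)⁻¹ * ∫ s in Set.Ioc 0 t, f s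

/-- `Φ ∈ 𝔏_P`: the Hardy operator is (everywhere defined and) bounded on `Φ`. Its maximal domain
consists of the functions that are integrable on `(0, t]` for every `t > 0`. -/
def HardyBounded (Φ : BanachFunctionSpace) : Prop :=
  ∃ C : ℝ, ∀ f : ℝ → ℂ, Φ.Mem f →
    (∀ t > 0, IntegrableOn f (Set.Ioc 0 t)) ∧ Φ.Mem (hardy f) ∧ Φ.nrm (hardy f) ≤ C * Φ.nrm f

end FunctionSpaces

section Interpolation

variable {X : Type*} [NormedAddCommGroup X] [NormedSpace ℂ X]

/-- The `K`-functional of the couple `(X, Y)`, for a subspace `Y` of `X` with its own norm `nY`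
(so that `X + Y = X`). -/
def kFunctional (Y : Submodule ℂ X) (nY : Y → ℝ) (t : ℝ) (x : X) : ℝ :=
  sInf {r : ℝ | ∃ (a : X) (b : Y), a + b = x ∧ r = ‖a‖ + t * nY b}

/-- The graph norm `|b|_{D(A)} = |b| + |A b|`. -/
def graphNorm (A : X →ₗ.[ℂ] X) (b : A.domain) : ℝ :=
  ‖(b : X)‖ + ‖A b‖

/-- The function `t ↦ t⁻¹ K(t, x)` for the couple `(X, D(A))`. -/
def kFunction (A : X →ₗ.[ℂ] X) (x : X) (t : ℝ) : ℂ :=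
  ((t⁻¹ * kFunctional A.domain (graphNorm A) t x : ℝ) : ℂ)

/-- The real interpolation space `(X, D(A))_Φ` given by the `K`-method. -/
def interpolationSpace (A : X →ₗ.[ℂ] X) (Φ : BanachFunctionSpace) : Set X :=
  {x | Φ.Mem (kFunction A x)}

/-- The norm of `(X, D(A))_Φ`. -/
def interpolationNorm (A : X →ₗ.[ℂ] X) (Φ : BanachFunctionSpace) (x : X) : ℝ :=
  Φ.nrm (kFunction A x)

/-- The function `t ↦ t⁻¹ |ψ(tA) x|`. -/
def calculusFunction (A : X →ₗ.[ℂ] X) (φ : ℝ) (ψ : ℂ → ℂ) (x : X) (t : ℝ) : ℂ :=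
  ((t⁻¹ * ‖primaryCalculus ((t : ℂ) • A) φ ψ x‖ : ℝ) : ℂ)

end Interpolation

end GenInterp

end

open GenInterp

/-! Two pointwise estimates compare `K(t, x)` with `ψ(tA)x`; boundedness of the Hardy operator turns
them into an equivalence of norms.

Upper estimate for `ψ(tA)x`: the operators `ψ(tA)` are bounded uniformly in `t`, and on the domain
`ψ(tA)b = t η(tA)Ab` with `η(z) = z⁻¹ψ(z)`. Splitting `x = (x - b) + b` gives `|ψ(tA)x| ≤ C K(t, x)`
(`exists_norm_calculus_le_kFunctional`).

Upper estimate for `K`: a Calderón formula. Choose `g` with `∫_0^∞ g(s)ψ(s) ds/s = 1` and put `e(z)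
= ∫_1^∞ g(sz)ψ(sz) ds/s`. Then `b = e(tA)x` lies in the domain, `x - b = ∫_0^t g(sA)ψ(sA)x ds/s`,
and `tAb = k(tA)ψ(tA)x` with `k(z) = z e(z)/ψ(z)`. The conditions on `ψ` put `k` into the class `𝓔`:
the growth condition controls it at infinity, the nonzero limit of `z⁻¹ψ(z)` at the vertex
(`exists_auxiliary_functions`). Hence `K(t, x)` is at most a multiple of `∫_0^t |ψ(sA)x| ds/s +
|ψ(tA)x| + t|x|` (`exists_approximation`). After division by `t` the first term is a Hardy average
of the second; the third is needed only for `t ≤ 1`, since `K(t, x) ≤ |x|`, and so becomes `|x|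
min(1, 1/t)`. For invertible `A` one has `|b| ≤ D|Ab|`, and the third term disappears.

As `A` need not be densely defined, `e(sA)x → x` for `s → 0` is not available for all `x`. The
Calderón formula is proved for `R(-1, A)x`, which lies in the domain, and the injectivity of the
resolvent removes `R(-1, A)` (`calculus_sub_eq_integral`).

The calculus is developed for abstract resolvent families with constants `θ, M`, because all `tA`
share the same constants; this is the source of uniformity in `t`. In the coordinate `z = exp v` the
contour becomes two horizontal lines and dilations become translations, so the contour arguments
reduce to Cauchy's theorem on strips. -/

noncomputable section

namespace GenInterp

set_option linter.unusedSectionVars false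

/-! ### Residues and Cauchy's theorem on horizontal strips -/

section StripCauchy

theorem integrable_exp_neg_mul_abs {s : ℝ} (hs : 0 < s) :
    Integrable fun x : ℝ => Real.exp (-s * |x|) := by
  rw [← integrableOn_univ, ← Set.Iic_union_Ioi (a := (0 : ℝ))]
  refine IntegrableOn.union ?_ ?_
  · refine (integrableOn_exp_mul_Iic hs 0).congr_fun (fun x hx => ?_) measurableSet_Iic
    simp [abs_of_nonpos (Set.mem_Iic.1 hx)]
  · refine (exp_neg_integrableOn_Ioi 0 hs).congr_fun (fun x hx => ?_) measurableSet_Ioi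
    simp [abs_of_pos (Set.mem_Ioi.1 hx)]

variable {E : Type*} [NormedAddCommGroup E] [NormedSpace ℂ E]

/-- Compactness takes care of the window around `c`, so decay is only required away from it; near
`c` a pole may lie close to the line. -/
theorem integrable_of_continuous_of_exp_decay {g : ℝ → E} (hg : Continuous g) {C s c : ℝ}
    (hs : 0 < s) (h : ∀ x, 1 ≤ |x - c| → ‖g x‖ ≤ C * Real.exp (-s * |x - c|)) :
    Integrable g := by
  obtain ⟨B, hB⟩ := (isCompact_Icc (a := c - 1) (b := c + 1)).exists_bound_of_continuousOn
    (f := fun x => Real.exp (s * |x - c|) • g x) (by fun_prop)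
  have hi := ((integrable_exp_neg_mul_abs hs).comp_sub_right c).const_mul (max B C)
  refine hi.mono' hg.aestronglyMeasurable (ae_of_all _ fun x => ?_)
  rcases le_total 1 |x - c| with hx | hx
  · refine (h x hx).trans ?_
    gcongr
    exact le_max_right _ _
  · have h1 := hB x (by rw [abs_le] at hx; constructor <;> linarith)
    rw [norm_smul, Real.norm_of_nonneg (Real.exp_pos _).le] at h1
    have h2 : ‖g x‖ = Real.exp (-s * |x - c|) * (Real.exp (s * |x - c|) * ‖g x‖) := by
      rw [← mul_assoc, ← Real.exp_add]; simp
    rw [h2, mul_comm]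
    gcongr
    exact h1.trans (le_max_left _ _)

/-- Averaging with `x ↦ -x` kills the odd part and leaves an arctangent density. The sign of `d`
survives, so lines on opposite sides of a pole give different limits. -/
theorem integral_inv_add_mul_I (N : ℝ) {d : ℝ} (hd : d ≠ 0) :
    ∫ x in -N..N, ((x : ℂ) + d * Complex.I)⁻¹ = -(2 * Real.arctan (N / d) : ℝ) * Complex.I := by
  have hne : ∀ x : ℝ, (x : ℂ) + d * Complex.I ≠ 0 := fun x h => hd (by
    simpa using congrArg Complex.im h)
  have hc : Continuous fun x : ℝ => ((x : ℂ) + d * Complex.I)⁻¹ :=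
    Continuous.inv₀ (by fun_prop) hne
  have h1 : ∫ x in -N..N, ((x : ℂ) + d * Complex.I)⁻¹ =
      ∫ x in -N..N, (-(x : ℂ) + d * Complex.I)⁻¹ := by
    have := intervalIntegral.integral_comp_neg (a := -N) (b := N)
      (fun x : ℝ => ((x : ℂ) + d * Complex.I)⁻¹)
    simpa using this.symm
  have h2 : (∫ x in -N..N, ((x : ℂ) + d * Complex.I)⁻¹) +
      ∫ x in -N..N, (-(x : ℂ) + d * Complex.I)⁻¹ =
      ∫ x in -N..N, ((-(2 * d) * (d ^ 2 + x ^ 2)⁻¹ : ℝ) : ℂ) * Complex.I := by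
    rw [← intervalIntegral.integral_add (hc.intervalIntegrable _ _)]
    · refine intervalIntegral.integral_congr fun x _ => ?_
      have e1 := hne x
      have e2 := hne (-x)
      have e3 : (d : ℂ) ^ 2 + x ^ 2 ≠ 0 := by
        have : (0 : ℝ) < d ^ 2 + x ^ 2 := by positivity
        exact_mod_cast this.ne'
      rw [Complex.ofReal_neg] at e2
      push_cast
      field_simp
      ring_nf
      rw [Complex.I_pow_three]
      ring
    · have := (hc.comp continuous_neg).intervalIntegrable (μ := volume) (-N) N
      simpa [Function.comp_def] using this
  rw [← h1, intervalIntegral.integral_mul_const, intervalIntegral.integral_ofReal,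
    intervalIntegral.integral_const_mul, integral_inv_sq_add_sq hd, neg_div, Real.arctan_neg] at h2
  have h3 := congrArg (fun z : ℂ => z / 2) h2
  simp only [add_self_div_two] at h3
  rw [h3]
  have : (d : ℂ) ≠ 0 := by exact_mod_cast hd
  push_cast
  field_simp
  ring

/-- Residue theorem on a horizontal strip for a function with one simple pole. -/
theorem strip_residue [CompleteSpace E] {F D : ℂ → E} {a b : ℝ} {u : ℂ} {h : E}
    (ha : a < u.im) (hb : u.im < b)
    (hD : ∀ v : ℂ, a ≤ v.im → v.im ≤ b → DifferentiableAt ℂ D v)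
    (hF : ∀ v : ℂ, a ≤ v.im → v.im ≤ b → v ≠ u → F v = D v + (v - u)⁻¹ • h)
    {C s : ℝ} (hs : 0 < s)
    (hdec : ∀ v : ℂ, a ≤ v.im → v.im ≤ b → 1 ≤ |v.re - u.re| →
      ‖F v‖ ≤ C * Real.exp (-s * |v.re - u.re|)) :
    Integrable (fun x : ℝ => F (x + a * Complex.I)) ∧
    Integrable (fun x : ℝ => F (x + b * Complex.I)) ∧
    (∫ x : ℝ, F (x + a * Complex.I)) - ∫ x : ℝ, F (x + b * Complex.I) =
      (2 * Real.pi * Complex.I : ℂ) • h := by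
  have hab : a ≤ b := (ha.trans hb).le
  -- horizontal lines at a height different from that of the pole
  have line : ∀ y : ℝ, a ≤ y → y ≤ b → y ≠ u.im →
      Continuous (fun x : ℝ => D (x + y * Complex.I)) ∧
      Continuous (fun x : ℝ => ((x : ℂ) + y * Complex.I - u)⁻¹) ∧
      Integrable (fun x : ℝ => F (x + y * Complex.I)) := by
    intro y hy1 hy2 hyu
    have hne : ∀ x : ℝ, (x : ℂ) + y * Complex.I ≠ u := fun x hx => hyu (by simp [← hx])
    have c1 : Continuous (fun x : ℝ => D (x + y * Complex.I)) :=
      continuous_iff_continuousAt.2 fun x =>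
        (hD _ (by simpa using hy1) (by simpa using hy2)).continuousAt.comp
          (f := fun x : ℝ => (x : ℂ) + y * Complex.I) (by fun_prop)
    have c2 : Continuous (fun x : ℝ => ((x : ℂ) + y * Complex.I - u)⁻¹) :=
      Continuous.inv₀ (by fun_prop) fun x => sub_ne_zero.2 (hne x)
    refine ⟨c1, c2, integrable_of_continuous_of_exp_decay (c := u.re) (C := C) ?_ hs ?_⟩
    · have : (fun x : ℝ => F (x + y * Complex.I)) = fun x : ℝ =>
          D (x + y * Complex.I) + ((x : ℂ) + y * Complex.I - u)⁻¹ • h := by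
        ext x
        exact hF _ (by simpa using hy1) (by simpa using hy2) (hne x)
      rw [this]
      exact c1.add (c2.smul continuous_const)
    · intro x hx
      simpa using hdec (x + y * Complex.I) (by simpa using hy1) (by simpa using hy2)
        (by simpa using hx)
  obtain ⟨cDa, cia, iFa⟩ := line a le_rfl hab ha.ne
  obtain ⟨cDb, cib, iFb⟩ := line b hab le_rfl hb.ne'
  refine ⟨iFa, iFb, ?_⟩
  set c := u.re with hc
  have hlim1 : Tendsto (fun N : ℝ => c - N) atTop atBot :=
    tendsto_atBot_add_const_left _ _ tendsto_neg_atTop_atBot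
  have hlim2 : Tendsto (fun N : ℝ => c + N) atTop atTop :=
    tendsto_atTop_add_const_left _ _ tendsto_id
  have L1 := (intervalIntegral_tendsto_integral iFa hlim1 hlim2).sub
    (intervalIntegral_tendsto_integral iFb hlim1 hlim2)
  refine tendsto_nhds_unique L1 ?_
  -- the vertical sides
  have side : ∀ σ : ℝ, |σ| = 1 →
      Tendsto (fun N : ℝ => ∫ y in a..b, D (((c + σ * N : ℝ) : ℂ) + y * Complex.I)) atTop
        (𝓝 0) := by
    intro σ hσ
    have hb : ∀ᶠ N : ℝ in atTop,
        ‖∫ y in a..b, D (((c + σ * N : ℝ) : ℂ) + y * Complex.I)‖ ≤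
          (C * Real.exp (-s * N) + N⁻¹ * ‖h‖) * |b - a| := by
      filter_upwards [eventually_ge_atTop 1] with N hN
      refine intervalIntegral.norm_integral_le_of_norm_le_const fun y hy => ?_
      rw [Set.uIoc_of_le hab] at hy
      set v : ℂ := ((c + σ * N : ℝ) : ℂ) + y * Complex.I with hv
      have hvre : v.re - u.re = σ * N := by simp [hv, ← hc]
      have habs : |v.re - u.re| = N := by
        rw [hvre, abs_mul, hσ, one_mul, abs_of_nonneg (by linarith)]
      have hvim : v.im = y := by simp [hv]
      have hvu : v ≠ u := fun e => by rw [e] at habs; simp at habs; linarith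
      have h1 := hdec v (by rw [hvim]; exact hy.1.le) (by rw [hvim]; exact hy.2)
        (by rw [habs]; exact hN)
      have h2 := hF v (by rw [hvim]; exact hy.1.le) (by rw [hvim]; exact hy.2) hvu
      rw [habs] at h1
      -- On the vertical sides `D` is `F` minus the pole term, and both tend to zero.
      rw [eq_sub_of_add_eq h2.symm]
      refine (norm_sub_le _ _).trans (add_le_add h1 ?_)
      rw [norm_smul, norm_inv]
      gcongr
      have := Complex.abs_re_le_norm (v - u)
      rwa [Complex.sub_re, habs] at this
    refine squeeze_zero_norm' hb ?_
    have e1 : Tendsto (fun N : ℝ => Real.exp (-s * N)) atTop (𝓝 0) :=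
      Real.tendsto_exp_atBot.comp (tendsto_id.const_mul_atTop_of_neg (by linarith))
    simpa using ((e1.const_mul C).add (tendsto_inv_atTop_zero.mul_const ‖h‖)).mul_const |b - a|
  have hp := side 1 (by simp)
  have hm := side (-1) (by simp)
  -- the explicit integrals
  have pole : ∀ y : ℝ, y ≠ u.im → ∀ N : ℝ,
      ∫ x in (c - N)..(c + N), ((x : ℂ) + y * Complex.I - u)⁻¹ =
        -(2 * Real.arctan (N / (y - u.im)) : ℝ) * Complex.I := by
    intro y hy N
    rw [← integral_inv_add_mul_I N (sub_ne_zero.2 hy)]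
    have := intervalIntegral.integral_comp_sub_right (a := c - N) (b := c + N)
      (fun x : ℝ => ((x : ℂ) + (y - u.im : ℝ) * Complex.I)⁻¹) c
    simp only [sub_sub_cancel_left, add_sub_cancel_left] at this
    rw [← this]
    refine intervalIntegral.integral_congr fun x _ => ?_
    congr 1
    apply Complex.ext <;> simp [hc]
  -- The pole lies above one line and below the other, so the arctangents tend to `-π/2` and `π/2`,
  -- and their contributions add up to `2πi`.
  have L2 : Tendsto (fun N : ℝ => (-(2 * Real.arctan (N / (a - u.im)) : ℝ) * Complex.I -
      -(2 * Real.arctan (N / (b - u.im)) : ℝ) * Complex.I) • h -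
      Complex.I • (∫ y in a..b, D (((c + 1 * N : ℝ) : ℂ) + y * Complex.I)) +
      Complex.I • ∫ y in a..b, D (((c + (-1) * N : ℝ) : ℂ) + y * Complex.I)) atTop
      (𝓝 ((2 * Real.pi * Complex.I : ℂ) • h)) := by
    have t1 : Tendsto (fun N : ℝ => Real.arctan (N / (a - u.im))) atTop (𝓝 (-(Real.pi / 2))) :=
      (Real.tendsto_arctan_atBot.mono_right nhdsWithin_le_nhds).comp
        (tendsto_id.atTop_div_const_of_neg (sub_neg.2 ha))
    have t2 : Tendsto (fun N : ℝ => Real.arctan (N / (b - u.im))) atTop (𝓝 (Real.pi / 2)) :=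
      (Real.tendsto_arctan_atTop.mono_right nhdsWithin_le_nhds).comp
        (tendsto_id.atTop_div_const (sub_pos.2 hb))
    have o : ∀ {f : ℝ → ℝ} {l : ℝ}, Tendsto f atTop (𝓝 l) →
        Tendsto (fun N => -((2 * f N : ℝ) : ℂ) * Complex.I) atTop
          (𝓝 (-((2 * l : ℝ) : ℂ) * Complex.I)) := fun hf =>
      (((Complex.continuous_ofReal.tendsto _).comp (hf.const_mul 2)).neg).mul_const _
    have := ((((o t1).sub (o t2)).smul_const h).sub (hp.const_smul Complex.I)).add
      (hm.const_smul Complex.I)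
    convert! this using 2
    simp only [smul_zero, sub_zero, add_zero]
    congr 1
    push_cast
    ring
  refine L2.congr fun N => ?_
  rw [← pole a ha.ne, ← pole b hb.ne', sub_smul]
  have rect := Complex.integral_boundary_rect_eq_zero_of_differentiableOn D
    (((c + (-1) * N : ℝ) : ℂ) + a * Complex.I) (((c + 1 * N : ℝ) : ℂ) + b * Complex.I) (by
      intro v hv
      have := hv.2
      simp only [Complex.add_im, Complex.ofReal_im, Complex.mul_im, Complex.ofReal_re,
        Complex.I_im, Complex.I_re, mul_one, mul_zero, add_zero, zero_add, Set.mem_preimage,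
        Set.uIcc_of_le hab] at this
      exact (hD v this.1 this.2).differentiableWithinAt)
  simp only [Complex.add_im, Complex.ofReal_im, Complex.mul_im, Complex.ofReal_re,
    Complex.I_im, Complex.I_re, mul_one, mul_zero, add_zero, zero_add, Complex.add_re,
    Complex.mul_re, sub_self] at rect
  have split : ∀ y : ℝ, a ≤ y → y ≤ b → y ≠ u.im →
      ∫ x in (c - N)..(c + N), F (x + y * Complex.I) =
        (∫ x in (c - N)..(c + N), D (x + y * Complex.I)) +
          (∫ x in (c - N)..(c + N), ((x : ℂ) + y * Complex.I - u)⁻¹) • h := by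
    intro y hy1 hy2 hyu
    obtain ⟨c1, c2, -⟩ := line y hy1 hy2 hyu
    rw [← intervalIntegral.integral_smul_const, ← intervalIntegral.integral_add
      (c1.intervalIntegrable _ _) (Continuous.intervalIntegrable (by exact c2.smul continuous_const) _ _)]
    refine intervalIntegral.integral_congr fun x _ => ?_
    exact hF _ (by simpa using hy1) (by simpa using hy2) fun hx => hyu (by simp [← hx])
  rw [split a le_rfl hab ha.ne, split b hab le_rfl hb.ne']
  have e1 : c + 1 * N = c + N := by ring
  have e2 : c + -1 * N = c - N := by ring
  rw [e1, e2] at rect ⊢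
  rw [← sub_eq_zero, ← neg_eq_zero, ← rect]
  abel

/-- Cauchy's theorem on a horizontal strip: horizontal contours may be shifted. -/
theorem strip_shift [CompleteSpace E] {F : ℂ → E} {a b : ℝ} (hab : a ≤ b)
    (hF : ∀ v : ℂ, a ≤ v.im → v.im ≤ b → DifferentiableAt ℂ F v) {C s : ℝ} (hs : 0 < s)
    (hdec : ∀ v : ℂ, a ≤ v.im → v.im ≤ b → ‖F v‖ ≤ C * Real.exp (-s * |v.re|)) :
    ∫ x : ℝ, F (x + a * Complex.I) = ∫ x : ℝ, F (x + b * Complex.I) := by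
  rcases hab.eq_or_lt with rfl | hab
  · rfl
  -- A fictitious pole in the middle of the strip, with residue `0`.
  have := (strip_residue (F := F) (D := F) (h := 0) (u := ((a + b) / 2 : ℝ) * Complex.I)
    (C := C) (by simp; linarith) (by simp; linarith) hF (by simp) hs
    (fun v h1 h2 _ => by simpa using hdec v h1 h2)).2.2
  rwa [smul_zero, sub_eq_zero] at this

theorem exp_ne_exp_of_abs_im_sub_lt {u v : ℂ} (h : |v.im - u.im| < 2 * Real.pi) (hne : v ≠ u) :
    Complex.exp v - Complex.exp u ≠ 0 := by
  intro he
  obtain ⟨n, hn⟩ := Complex.exp_eq_exp_iff_exists_int.1 (sub_eq_zero.1 he)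
  have him : v.im - u.im = n * (2 * Real.pi) := by
    rw [hn]
    simp
  rw [him, abs_mul, abs_of_pos Real.two_pi_pos] at h
  have h1 : |(n : ℝ)| < 1 := by
    by_contra! h'
    nlinarith [Real.two_pi_pos]
  have h2 : n = 0 := by
    rw [← Int.cast_abs] at h1
    exact Int.abs_lt_one_iff.1 (by exact_mod_cast h1)
  exact hne (by simpa [h2] using hn)

/-- The Cauchy integral formula on a sector, in logarithmic coordinates. -/
theorem strip_cauchy [CompleteSpace E] {g : ℂ → E} {a b : ℝ} {u : ℂ}
    (ha : a < u.im) (hb : u.im < b) (hab : b - a < 2 * Real.pi)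
    (hg : ∀ v : ℂ, a ≤ v.im → v.im ≤ b → DifferentiableAt ℂ g v) {C s : ℝ} (hs : 0 < s)
    (hdec : ∀ v : ℂ, a ≤ v.im → v.im ≤ b → ‖g v‖ ≤ C * min 1 (Real.exp (-s * v.re))) :
    (∫ x : ℝ, (Complex.exp (x + a * Complex.I) /
        (Complex.exp (x + a * Complex.I) - Complex.exp u)) • g (x + a * Complex.I)) -
      ∫ x : ℝ, (Complex.exp (x + b * Complex.I) /
        (Complex.exp (x + b * Complex.I) - Complex.exp u)) • g (x + b * Complex.I) =
      (2 * Real.pi * Complex.I : ℂ) • g u := by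
  have hC : 0 ≤ C := by
    have := (norm_nonneg _).trans (hdec u ha.le hb.le)
    have hpos : 0 < min 1 (Real.exp (-s * u.re)) := lt_min one_pos (Real.exp_pos _)
    nlinarith
  have hne : ∀ v : ℂ, a ≤ v.im → v.im ≤ b → v ≠ u → Complex.exp v - Complex.exp u ≠ 0 :=
    fun v h1 h2 => exp_ne_exp_of_abs_im_sub_lt (by rw [abs_lt]; constructor <;> linarith)
  -- Replacing `exp v - exp u` by its quotient by `v - u` removes the pole: the integrand is `(v -
  -- u)⁻¹ • H v`, where `H` is holomorphic on the strip and `H u = g u`.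
  set H : ℂ → E := fun v => (Complex.exp v / dslope Complex.exp u v) • g v with hH
  have hds : Differentiable ℂ (dslope Complex.exp u) := by
    rw [← differentiableOn_univ]
    exact (Complex.differentiableOn_dslope univ_mem).2 Complex.differentiable_exp.differentiableOn
  have hdu : dslope Complex.exp u u = Complex.exp u := by simp
  have hdv : ∀ v, v ≠ u → dslope Complex.exp u v =
      (v - u)⁻¹ * (Complex.exp v - Complex.exp u) := fun v hv => by
    rw [dslope_of_ne _ hv, slope_def_module, smul_eq_mul]
  have hd0 : ∀ v : ℂ, a ≤ v.im → v.im ≤ b → dslope Complex.exp u v ≠ 0 := by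
    intro v h1 h2
    rcases eq_or_ne v u with rfl | hvu
    · rw [hdu]
      exact Complex.exp_ne_zero _
    · rw [hdv v hvu]
      exact mul_ne_zero (inv_ne_zero (sub_ne_zero.2 hvu)) (hne v h1 h2 hvu)
  have hHd : ∀ v : ℂ, a ≤ v.im → v.im ≤ b → DifferentiableAt ℂ H v := fun v h1 h2 =>
    ((Complex.differentiable_exp v).div (hds v) (hd0 v h1 h2)).smul (hg v h1 h2)
  have hHu : H u = g u := by simp [hH]
  have hnhds : {v : ℂ | a < v.im ∧ v.im < b} ∈ 𝓝 u :=
    ((isOpen_lt continuous_const Complex.continuous_im).inter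
      (isOpen_lt Complex.continuous_im continuous_const)).mem_nhds ⟨ha, hb⟩
  have hD : ∀ v : ℂ, a ≤ v.im → v.im ≤ b → DifferentiableAt ℂ (dslope H u) v := by
    intro v h1 h2
    rcases eq_or_ne v u with rfl | hvu
    · exact ((Complex.differentiableOn_dslope hnhds).2 fun w hw =>
        (hHd w hw.1.le hw.2.le).differentiableWithinAt).differentiableAt hnhds
    · exact (differentiableAt_dslope_of_ne hvu).2 (hHd v h1 h2)
  -- At the right end `g` decays with rate `s`; at the left end the Cauchy factor decays with rate
  -- `1`.
  have hs' : 0 < min s 1 := lt_min hs one_pos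
  refine (hHu ▸ (strip_residue (h := H u) (D := dslope H u) (s := min s 1)
    (C := 2 * C * max 1 (Real.exp (-s * u.re)))
    (F := fun v => (Complex.exp v / (Complex.exp v - Complex.exp u)) • g v)
    ha hb hD ?_ hs' ?_).2.2 :)
  · intro v h1 h2 hvu
    have e1 := sub_ne_zero.2 hvu
    have e2 := hne v h1 h2 hvu
    rw [dslope_of_ne _ hvu, slope_def_module, ← smul_add, sub_add_cancel, hH]
    simp only
    rw [hdv v hvu, smul_smul]
    congr 1
    field_simp
  · intro v h1 h2 habs
    have hgv := hdec v h1 h2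
    have hreg : ‖Complex.exp v / (Complex.exp v - Complex.exp u)‖ * ‖g v‖ ≤
        (2 * max 1 (Real.exp (-s * u.re)) * Real.exp (-(min s 1) * |v.re - u.re|)) * C := by
      -- Real parts at distance at least `1` make the moduli of the exponentials differ by a factor
      -- of at least `2`, so their difference is at least half the larger one.
      have hexp1 : (2 : ℝ) * Real.exp (-1) ≤ 1 := by
        have := Real.add_one_le_exp (1 : ℝ)
        rw [Real.exp_neg]
        have h3 := Real.exp_pos 1
        field_simp
        linarith
      rw [norm_div, Complex.norm_exp]
      rcases le_abs.1 habs with h | h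
      · have hpos : |v.re - u.re| = v.re - u.re := abs_of_nonneg (by linarith)
        have hu : Real.exp u.re * 2 ≤ Real.exp v.re := by
          have : Real.exp u.re ≤ Real.exp v.re * Real.exp (-1) := by
            rw [← Real.exp_add]; gcongr; linarith
          nlinarith [Real.exp_pos v.re]
        have hden : Real.exp v.re / 2 ≤ ‖Complex.exp v - Complex.exp u‖ := by
          have := norm_sub_norm_le (Complex.exp v) (Complex.exp u)
          rw [Complex.norm_exp, Complex.norm_exp] at this
          linarith
        have hfrac : Real.exp v.re / ‖Complex.exp v - Complex.exp u‖ ≤ 2 := by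
          have h4 := Real.exp_pos v.re
          rw [div_le_iff₀ (by linarith)]
          linarith
        have hg2 : ‖g v‖ ≤ C * (max 1 (Real.exp (-s * u.re)) *
            Real.exp (-(min s 1) * |v.re - u.re|)) := by
          refine hgv.trans (mul_le_mul_of_nonneg_left ((min_le_right _ _).trans ?_) hC)
          have : Real.exp (-s * v.re) = Real.exp (-s * u.re) * Real.exp (-s * |v.re - u.re|) := by
            rw [← Real.exp_add, hpos]; ring_nf
          rw [this]
          gcongr
          · exact le_max_right _ _
          · exact min_le_left _ _
        calc _ ≤ 2 * (C * (max 1 (Real.exp (-s * u.re)) *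
            Real.exp (-(min s 1) * |v.re - u.re|))) := by gcongr
          _ = _ := by ring
      · have hneg : |v.re - u.re| = u.re - v.re := by
          rw [abs_of_nonpos (by linarith)]; ring
        have hu : Real.exp v.re * 2 ≤ Real.exp u.re := by
          have : Real.exp v.re ≤ Real.exp u.re * Real.exp (-1) := by
            rw [← Real.exp_add]; gcongr; linarith
          nlinarith [Real.exp_pos u.re]
        have hden : Real.exp u.re / 2 ≤ ‖Complex.exp v - Complex.exp u‖ := by
          have := norm_sub_norm_le (Complex.exp u) (Complex.exp v)
          rw [Complex.norm_exp, Complex.norm_exp, norm_sub_rev] at this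
          linarith
        have hfrac : Real.exp v.re / ‖Complex.exp v - Complex.exp u‖ ≤
            2 * Real.exp (-(min s 1) * |v.re - u.re|) := by
          have h4 := Real.exp_pos u.re
          have h5 : Real.exp v.re = Real.exp (-1 * |v.re - u.re|) * Real.exp u.re := by
            rw [← Real.exp_add, hneg]; ring_nf
          have h6 : Real.exp (-1 * |v.re - u.re|) ≤ Real.exp (-(min s 1) * |v.re - u.re|) := by
            gcongr
            exact min_le_right _ _
          rw [div_le_iff₀ (by linarith), h5]
          have h7 := Real.exp_pos (-(min s 1) * |v.re - u.re|)
          nlinarith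
        have hg2 : ‖g v‖ ≤ max 1 (Real.exp (-s * u.re)) * C := by
          refine (hgv.trans (mul_le_mul_of_nonneg_left (min_le_left _ _) hC)).trans ?_
          rw [mul_comm]
          gcongr
          exact le_max_left _ _
        calc _ ≤ (2 * Real.exp (-(min s 1) * |v.re - u.re|)) *
            (max 1 (Real.exp (-s * u.re)) * C) := by gcongr
          _ = _ := by ring
    rw [norm_smul]
    exact hreg.trans (le_of_eq (by ring))

end StripCauchy

/-! ### Sectors and their exteriors -/

section SectorGeometry

/-- Trades the angle for an inequality between real part and modulus, which does not see the branch
cut of `arg`. -/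
theorem mem_sector_iff {φ : ℝ} (h0 : 0 < φ) (hπ : φ ≤ Real.pi) {z : ℂ} :
    z ∈ sector φ ↔ Real.cos φ * ‖z‖ < z.re := by
  rcases eq_or_ne z 0 with rfl | hz
  · simp [sector]
  have hn := norm_pos_iff.2 hz
  have h1 : z.re = ‖z‖ * Real.cos |z.arg| := by
    rw [Real.cos_abs, Complex.norm_mul_cos_arg]
  have h2 : Real.cos φ * ‖z‖ < z.re ↔ Real.cos φ < Real.cos |z.arg| := by
    rw [h1, mul_comm ‖z‖]
    exact mul_lt_mul_iff_left₀ hn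
  rw [h2, Real.strictAntiOn_cos.lt_iff_gt ⟨h0.le, hπ⟩
    ⟨abs_nonneg _, Complex.abs_arg_le_pi z⟩]
  simp [sector, hz]

theorem isOpen_sector {φ : ℝ} (h0 : 0 < φ) (hπ : φ ≤ Real.pi) : IsOpen (sector φ) := by
  have : sector φ = {z | Real.cos φ * ‖z‖ < z.re} := Set.ext fun z => mem_sector_iff h0 hπ
  rw [this]
  exact isOpen_lt (by fun_prop) Complex.continuous_re

theorem exp_mem_sector {φ : ℝ} (h0 : 0 < φ) (hπ : φ ≤ Real.pi) {v : ℂ}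
    (hv : Real.cos φ < Real.cos v.im) : Complex.exp v ∈ sector φ := by
  rw [mem_sector_iff h0 hπ, Complex.norm_exp, Complex.exp_re, mul_comm]
  gcongr

theorem exists_exp_of_mem_sector {φ : ℝ} {z : ℂ} (hz : z ∈ sector φ) :
    ∃ v : ℂ, Complex.exp v = z ∧ |v.im| < φ ∧ v.im ≤ Real.pi ∧ -Real.pi < v.im :=
  ⟨Complex.log z, Complex.exp_log hz.1, by
    rw [Complex.log_im]; exact hz.2, Complex.log_im_le_pi z,
    Complex.neg_pi_lt_log_im z⟩

/-- The open complement of the closed sector of half-angle `θ`. -/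
def outerSector (θ : ℝ) : Set ℂ :=
  {z | z.re < Real.cos θ * ‖z‖}

theorem isOpen_outerSector (θ : ℝ) : IsOpen (outerSector θ) :=
  isOpen_lt Complex.continuous_re (by fun_prop)

theorem ne_zero_of_mem_outerSector {θ : ℝ} {z : ℂ} (hz : z ∈ outerSector θ) : z ≠ 0 := by
  rintro rfl
  simp [outerSector] at hz

theorem exp_mem_outerSector {θ : ℝ} {v : ℂ} (hv : Real.cos v.im < Real.cos θ) :
    Complex.exp v ∈ outerSector θ := by
  rw [outerSector, Set.mem_ofPred_eq, Complex.norm_exp, Complex.exp_re, mul_comm]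
  gcongr

theorem neg_one_lt_cos {θ : ℝ} (h0 : 0 < θ) (hπ : θ < Real.pi) : -1 < Real.cos θ := by
  rw [← Real.cos_pi]
  exact Real.strictAntiOn_cos ⟨h0.le, hπ.le⟩ ⟨Real.pi_pos.le, le_rfl⟩ hπ

theorem neg_one_mem_outerSector {θ : ℝ} (h0 : 0 < θ) (hπ : θ < Real.pi) :
    (-1 : ℂ) ∈ outerSector θ := by
  simpa [outerSector] using neg_one_lt_cos h0 hπ

/-- Two sectors separated by an angle: the distance controls both moduli. -/
theorem norm_le_norm_sub_of_separated {c c' : ℝ} (hc : |c| ≤ 1) (hc' : |c'| ≤ 1) (hcc : c' < c)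
    {z w : ℂ} (hz : c * ‖z‖ ≤ z.re) (hw : w.re ≤ c' * ‖w‖) :
    ‖w‖ ≤ 2 / (c - c') * ‖z - w‖ ∧ ‖z‖ ≤ 2 / (c - c') * ‖z - w‖ := by
  have hd : 0 < c - c' := sub_pos.2 hcc
  have h1 : z.re - w.re ≤ ‖z - w‖ := by
    rw [← Complex.sub_re]; exact Complex.re_le_norm _
  have h2 := abs_le.1 (abs_norm_sub_norm_le z w)
  -- Both claims follow from `(c - c')‖w‖ ≤ (Re z - Re w) - c(‖z‖ - ‖w‖)` and `(c - c')‖z‖ ≤ (Re z -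
  -- Re w) - c'(‖z‖ - ‖w‖)`, where each summand is at most `‖z - w‖`.
  have lip : ∀ k : ℝ, |k| ≤ 1 → -(k * (‖z‖ - ‖w‖)) ≤ ‖z - w‖ := by
    intro k hk
    rw [abs_le] at hk
    have h3 := abs_norm_sub_norm_le z w
    have h4 : |k * (‖z‖ - ‖w‖)| ≤ 1 * ‖z - w‖ := by
      rw [abs_mul]
      exact mul_le_mul (abs_le.2 hk) h3 (abs_nonneg _) zero_le_one
    have := neg_abs_le (k * (‖z‖ - ‖w‖))
    linarith
  have e1 := lip c hc
  have e2 := lip c' hc'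
  constructor <;> rw [div_mul_eq_mul_div, le_div_iff₀ hd] <;> nlinarith

end SectorGeometry

/-! ### Integrals along the boundary of a sector in logarithmic coordinates -/

section LineIntegrals

variable {E : Type*} [NormedAddCommGroup E] [NormedSpace ℂ E]

/-- The integral over the horizontal line at height `y`. -/
def lineInt (F : ℂ → E) (y : ℝ) : E :=
  ∫ x : ℝ, F (x + y * Complex.I)

/-- The integral over the positively oriented boundary of the sector of half-angle `ω`, in
logarithmic coordinates. -/
def veeInt (F : ℂ → E) (ω : ℝ) : E :=
  lineInt F (-ω) - lineInt F ω

theorem integral_Ioi_eq_integral_exp (G : ℝ → E) :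
    ∫ r in Set.Ioi (0 : ℝ), G r = ∫ x : ℝ, Real.exp x • G (Real.exp x) := by
  have := integral_image_eq_integral_abs_deriv_smul (s := Set.univ) MeasurableSet.univ
    (fun x _ => (Real.hasDerivAt_exp x).hasDerivWithinAt) Real.exp_injective.injOn G
  rw [Set.image_univ, Real.range_exp, setIntegral_univ] at this
  rw [this]
  refine integral_congr_ae (ae_of_all _ fun x => ?_)
  simp only [abs_of_pos (Real.exp_pos x)]

theorem lineInt_congr {F G : ℂ → E} {y : ℝ} (h : ∀ v : ℂ, v.im = y → F v = G v) :
    lineInt F y = lineInt G y :=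
  integral_congr_ae (ae_of_all _ fun x => h _ (by simp))

theorem veeInt_congr {F G : ℂ → E} {ω : ℝ} (h : ∀ v : ℂ, |v.im| = |ω| → F v = G v) :
    veeInt F ω = veeInt G ω := by
  rw [veeInt, veeInt, lineInt_congr fun v hv => h v (by rw [hv, abs_neg]),
    lineInt_congr fun v hv => h v (by rw [hv])]

/-- Integrability over the two boundary rays. -/
def VeeIntegrable (F : ℂ → E) (ω : ℝ) : Prop :=
  Integrable (fun x : ℝ => F (x + (-ω : ℝ) * Complex.I)) ∧
    Integrable (fun x : ℝ => F (x + ω * Complex.I))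

theorem veeIntegrable_of_decay {F : ℂ → E} {ω C s : ℝ} (hs : 0 < s)
    (hc : ∀ v : ℂ, |v.im| = |ω| → ContinuousAt F v)
    (hd : ∀ v : ℂ, |v.im| = |ω| → ‖F v‖ ≤ C * Real.exp (-s * |v.re|)) : VeeIntegrable F ω := by
  have : ∀ y : ℝ, |y| = |ω| → Integrable (fun x : ℝ => F (x + y * Complex.I)) := by
    intro y hy
    refine integrable_of_continuous_of_exp_decay (c := 0) (C := C)
      (continuous_iff_continuousAt.2 fun x => ?_) hs fun x _ => ?_
    · exact (hc (x + y * Complex.I) (by simpa using hy)).comp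
        (f := fun x : ℝ => (x : ℂ) + y * Complex.I) (by fun_prop)
    · simpa using hd (x + y * Complex.I) (by simpa using hy)
  exact ⟨this _ (abs_neg ω), this _ rfl⟩

theorem VeeIntegrable.add {F G : ℂ → E} {ω : ℝ} (hF : VeeIntegrable F ω)
    (hG : VeeIntegrable G ω) : VeeIntegrable (fun v => F v + G v) ω :=
  ⟨hF.1.add hG.1, hF.2.add hG.2⟩

theorem veeInt_add {F G : ℂ → E} {ω : ℝ} (hF : VeeIntegrable F ω) (hG : VeeIntegrable G ω) :
    veeInt (fun v => F v + G v) ω = veeInt F ω + veeInt G ω := by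
  simp only [veeInt, lineInt, integral_add hF.1 hG.1, integral_add hF.2 hG.2]
  abel

theorem veeInt_sub {F G : ℂ → E} {ω : ℝ} (hF : VeeIntegrable F ω) (hG : VeeIntegrable G ω) :
    veeInt (fun v => F v - G v) ω = veeInt F ω - veeInt G ω := by
  simp only [veeInt, lineInt, integral_sub hF.1 hG.1, integral_sub hF.2 hG.2]
  abel

theorem veeInt_smul (c : ℂ) (F : ℂ → E) (ω : ℝ) :
    veeInt (fun v => c • F v) ω = c • veeInt F ω := by
  simp only [veeInt, lineInt, integral_smul, smul_sub]

theorem veeInt_clm {E' : Type*} [NormedAddCommGroup E'] [NormedSpace ℂ E'] [CompleteSpace E]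
    [CompleteSpace E'] (L : E →L[ℂ] E') {F : ℂ → E} {ω : ℝ} (hF : VeeIntegrable F ω) :
    veeInt (fun v => L (F v)) ω = L (veeInt F ω) := by
  simp only [veeInt, lineInt, L.integral_comp_comm hF.1, L.integral_comp_comm hF.2, map_sub]

theorem norm_veeInt_le {F : ℂ → E} {ω C s : ℝ}
    (hs : 0 < s) (hd : ∀ v : ℂ, |v.im| = |ω| → ‖F v‖ ≤ C * Real.exp (-s * |v.re|)) :
    ‖veeInt F ω‖ ≤ 2 * C * ∫ x : ℝ, Real.exp (-s * |x|) := by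
  have : ∀ y : ℝ, |y| = |ω| → ‖lineInt F y‖ ≤ C * ∫ x : ℝ, Real.exp (-s * |x|) := by
    intro y hy
    rw [← integral_const_mul]
    refine norm_integral_le_of_norm_le ((integrable_exp_neg_mul_abs hs).const_mul C)
      (ae_of_all _ fun x => ?_)
    simpa using hd (x + y * Complex.I) (by simpa using hy)
  have h1 := this _ (abs_neg ω)
  have h2 := this _ rfl
  refine (norm_sub_le _ _).trans ?_
  linarith

end LineIntegrals

/-! ### Resolvent families of sectorial type -/

section Families

variable {X : Type*} [NormedAddCommGroup X] [NormedSpace ℂ X]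

/-- A resolvent family defined outside the closed sector of half-angle `θ`, with
`‖z R(z)‖ ≤ M`. -/
structure IsSectorialFamily (R : ℂ → X →L[ℂ] X) (θ M : ℝ) : Prop where
  pos : 0 < θ
  lt_pi : θ < Real.pi
  bound : ∀ z ∈ outerSector θ, ‖z • R z‖ ≤ M
  ident : ∀ z ∈ outerSector θ, ∀ w ∈ outerSector θ, R z - R w = (w - z) • (R z * R w)

namespace IsSectorialFamily

variable {R : ℂ → X →L[ℂ] X} {θ M : ℝ}

theorem nonneg (h : IsSectorialFamily R θ M) : 0 ≤ M :=
  (norm_nonneg _).trans (h.bound _ (neg_one_mem_outerSector h.pos h.lt_pi))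

theorem norm_le (h : IsSectorialFamily R θ M) {z : ℂ} (hz : z ∈ outerSector θ) :
    ‖R z‖ ≤ M / ‖z‖ := by
  have h0 := norm_pos_iff.2 (ne_zero_of_mem_outerSector hz)
  rw [le_div_iff₀ h0, mul_comm, ← norm_smul]
  exact h.bound z hz

/-- The resolvent identity gives a local Lipschitz bound; once continuity is known, the same
identity yields the derivative. -/
theorem continuousAt (h : IsSectorialFamily R θ M) {z : ℂ} (hz : z ∈ outerSector θ) :
    ContinuousAt R z := by
  have h0 := ne_zero_of_mem_outerSector hz
  rw [ContinuousAt, tendsto_iff_norm_sub_tendsto_zero]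
  have hlim : Tendsto (fun w => ‖z - w‖ * (M / ‖w‖ * ‖R z‖)) (𝓝 z) (𝓝 0) := by
    have : ContinuousAt (fun w => ‖z - w‖ * (M / ‖w‖ * ‖R z‖)) z := by
      have : ContinuousAt (fun w : ℂ => M / ‖w‖) z :=
        continuousAt_const.div continuous_norm.continuousAt (norm_ne_zero_iff.2 h0)
      fun_prop
    simpa [ContinuousAt] using this
  refine squeeze_zero' (Eventually.of_forall fun _ => norm_nonneg _) ?_ hlim
  filter_upwards [(isOpen_outerSector θ).mem_nhds hz] with w hw
  rw [h.ident w hw z hz, norm_smul]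
  gcongr
  refine (norm_mul_le _ _).trans ?_
  gcongr
  exact h.norm_le hw

theorem hasDerivAt (h : IsSectorialFamily R θ M) {z : ℂ} (hz : z ∈ outerSector θ) :
    HasDerivAt R (-(R z * R z)) z := by
  rw [hasDerivAt_iff_tendsto_slope]
  have h1 : Tendsto (fun w => -(R w * R z)) (𝓝[≠] z) (𝓝 (-(R z * R z))) :=
    (((h.continuousAt hz).mul continuousAt_const).neg).mono_left nhdsWithin_le_nhds
  refine h1.congr' ?_
  filter_upwards [nhdsWithin_le_nhds ((isOpen_outerSector θ).mem_nhds hz),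
    self_mem_nhdsWithin] with w hw hne
  rw [slope_def_module, h.ident w hw z hz, smul_smul]
  have : w - z ≠ 0 := sub_ne_zero.2 hne
  rw [show (w - z)⁻¹ * (z - w) = -1 by field_simp; ring, neg_one_smul]

theorem differentiableAt (h : IsSectorialFamily R θ M) {z : ℂ} (hz : z ∈ outerSector θ) :
    DifferentiableAt ℂ R z :=
  (h.hasDerivAt hz).differentiableAt

theorem mul_eq (h : IsSectorialFamily R θ M) {z w : ℂ} (hz : z ∈ outerSector θ)
    (hw : w ∈ outerSector θ) (hne : w ≠ z) : R z * R w = (w - z)⁻¹ • (R z - R w) := by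
  rw [h.ident z hz w hw, smul_smul, inv_mul_cancel₀ (sub_ne_zero.2 hne), one_smul]

theorem comm (h : IsSectorialFamily R θ M) {z w : ℂ} (hz : z ∈ outerSector θ)
    (hw : w ∈ outerSector θ) : R z * R w = R w * R z := by
  rcases eq_or_ne w z with rfl | hne
  · rfl
  rw [h.mul_eq hz hw hne, h.mul_eq hw hz hne.symm, ← neg_sub (R w), smul_neg, ← neg_smul,
    ← inv_neg, neg_sub]

end IsSectorialFamily

end Families

/-! ### Decay of `H^∞_0` functions in logarithmic coordinates -/

section HInftyZero

theorem MemHInftyZero.exists_exp_decay {φ : ℝ} (h0 : 0 < φ) (hπ : φ ≤ Real.pi) {f : ℂ → ℂ}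
    (hf : MemHInftyZero φ f) : ∃ C s : ℝ, 0 < C ∧ 0 < s ∧ ∀ v : ℂ,
      Real.cos φ < Real.cos v.im → ‖f (Complex.exp v)‖ ≤ C * Real.exp (-s * |v.re|) := by
  obtain ⟨-, -, C, s, hC, hs, h⟩ := hf
  refine ⟨C, s, hC, hs, fun v hv => (h _ (exp_mem_sector h0 hπ hv)).trans ?_⟩
  rw [Complex.norm_exp, ← Real.exp_mul, ← Real.exp_mul]
  gcongr
  rcases le_total 0 v.re with hr | hr
  · refine (min_le_right _ _).trans (le_of_eq ?_)
    rw [abs_of_nonneg hr]; ring_nf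
  · refine (min_le_left _ _).trans (le_of_eq ?_)
    rw [abs_of_nonpos hr]; ring_nf

theorem MemHInftyZero.differentiableAt_exp {φ : ℝ} (h0 : 0 < φ) (hπ : φ ≤ Real.pi) {f : ℂ → ℂ}
    (hf : MemHInftyZero φ f) {v : ℂ} (hv : Real.cos φ < Real.cos v.im) :
    DifferentiableAt ℂ (fun v => f (Complex.exp v)) v :=
  ((hf.1 _ (exp_mem_sector h0 hπ hv)).differentiableAt
    ((isOpen_sector h0 hπ).mem_nhds (exp_mem_sector h0 hπ hv))).comp v
    Complex.differentiable_exp.differentiableAt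

theorem cos_lt_cos_of_abs_lt {x y : ℝ} (h : |x| < y) (hy : y ≤ Real.pi) :
    Real.cos y < Real.cos x := by
  rw [← Real.cos_abs x]
  exact Real.cos_lt_cos_of_nonneg_of_le_pi (abs_nonneg _) hy h

theorem cos_lt_cos_of_lt_abs {x y : ℝ} (hy : 0 ≤ y) (h : y < |x|) (hx : |x| ≤ Real.pi) :
    Real.cos x < Real.cos y := by
  rw [← Real.cos_abs x]
  exact Real.cos_lt_cos_of_nonneg_of_le_pi hy hx h

theorem outerSector_mono {θ ω : ℝ} (h0 : 0 ≤ θ) (h : θ ≤ ω) (hω : ω ≤ Real.pi) :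
    outerSector ω ⊆ outerSector θ := by
  intro z hz
  refine lt_of_lt_of_le (show z.re < Real.cos ω * ‖z‖ from hz) ?_
  gcongr
  exact Real.cos_le_cos_of_nonneg_of_le_pi h0 hω h

/-- Separation of sectors, with the cosine of the argument of `w` as the second opening. -/
theorem exists_norm_le_of_mem_outerSector {ω : ℝ} {w : ℂ} (hw : w ∈ outerSector ω) :
    ∃ K : ℝ, 0 ≤ K ∧ ∀ z : ℂ, Real.cos ω * ‖z‖ ≤ z.re →
      ‖w‖ ≤ K * ‖w - z‖ ∧ ‖z‖ ≤ K * ‖w - z‖ := by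
  have hw0 := norm_pos_iff.2 (ne_zero_of_mem_outerSector hw)
  have hlt : w.re / ‖w‖ < Real.cos ω := by rw [div_lt_iff₀ hw0]; exact hw
  refine ⟨2 / (Real.cos ω - w.re / ‖w‖), div_nonneg zero_le_two (sub_nonneg.2 hlt.le),
    fun z hz => ?_⟩
  rw [norm_sub_rev]
  refine norm_le_norm_sub_of_separated (Real.abs_cos_le_one ω) ?_ hlt hz ?_
  · rw [abs_div, abs_norm, div_le_one hw0]
    exact Complex.abs_re_le_norm w
  · rw [div_mul_cancel₀ _ hw0.ne']

end HInftyZero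

/-! ### The Dunford-Riesz integral -/

section SectorCalculus

variable {X : Type*} [NormedAddCommGroup X] [NormedSpace ℂ X]

/-- The integrand of the Dunford-Riesz integral in logarithmic coordinates. -/
def calcKernel (R : ℂ → X →L[ℂ] X) (f : ℂ → ℂ) (v : ℂ) : X →L[ℂ] X :=
  (Complex.exp v * f (Complex.exp v)) • R (Complex.exp v)

/-- The Dunford-Riesz integral in logarithmic coordinates. -/
def sectorCalc (R : ℂ → X →L[ℂ] X) (ω : ℝ) (f : ℂ → ℂ) : X →L[ℂ] X :=
  (2 * (Real.pi : ℂ) * Complex.I)⁻¹ • veeInt (calcKernel R f) ω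

variable {R : ℂ → X →L[ℂ] X} {θ M ω φ : ℝ} {f g : ℂ → ℂ}

namespace IsSectorialFamily

theorem norm_exp_smul_le (h : IsSectorialFamily R θ M) {v : ℂ}
    (hv : Real.cos v.im < Real.cos θ) (c : ℂ) :
    ‖(Complex.exp v * c) • R (Complex.exp v)‖ ≤ M * ‖c‖ := by
  rw [mul_comm, mul_smul, norm_smul, mul_comm]
  gcongr
  exact h.bound _ (exp_mem_outerSector hv)

theorem norm_calcKernel_le (h : IsSectorialFamily R θ M) {v : ℂ} {C s : ℝ}
    (hv : Real.cos v.im < Real.cos θ)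
    (hf : ‖f (Complex.exp v)‖ ≤ C * Real.exp (-s * |v.re|)) :
    ‖calcKernel R f v‖ ≤ M * C * Real.exp (-s * |v.re|) := by
  refine (h.norm_exp_smul_le hv _).trans ?_
  rw [mul_assoc]
  exact mul_le_mul_of_nonneg_left hf h.nonneg

theorem differentiableAt_exp (h : IsSectorialFamily R θ M) {v : ℂ}
    (hv : Real.cos v.im < Real.cos θ) : DifferentiableAt ℂ (fun v => R (Complex.exp v)) v :=
  DifferentiableAt.comp (g := R) v (h.differentiableAt (exp_mem_outerSector hv))
    Complex.differentiable_exp.differentiableAt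

theorem differentiableAt_calcKernel (h : IsSectorialFamily R θ M) {v : ℂ}
    (hv : Real.cos v.im < Real.cos θ)
    (hf : DifferentiableAt ℂ (fun v => f (Complex.exp v)) v) :
    DifferentiableAt ℂ (calcKernel R f) v :=
  (Complex.differentiable_exp.differentiableAt.mul hf).smul (h.differentiableAt_exp hv)

theorem veeIntegrable_calcKernel (h : IsSectorialFamily R θ M) (hθω : θ < ω) (hωφ : ω < φ)
    (hφ : φ ≤ Real.pi) (hf : MemHInftyZero φ f) : VeeIntegrable (calcKernel R f) ω := by
  have hω0 : 0 < ω := h.pos.trans hθω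
  obtain ⟨C, s, -, hs, hd⟩ := hf.exists_exp_decay (hω0.trans hωφ) hφ
  have hω : |ω| = ω := abs_of_pos hω0
  have key : ∀ v : ℂ, |v.im| = |ω| → Real.cos φ < Real.cos v.im ∧
      Real.cos v.im < Real.cos θ := fun v hv =>
    ⟨cos_lt_cos_of_abs_lt (by rw [hv, hω]; exact hωφ) hφ,
      cos_lt_cos_of_lt_abs h.pos.le (by rw [hv, hω]; exact hθω) (by rw [hv, hω]; linarith)⟩
  exact veeIntegrable_of_decay hs
    (fun v hv => (h.differentiableAt_calcKernel (key v hv).2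
      (hf.differentiableAt_exp (hω0.trans hωφ) hφ (key v hv).1)).continuousAt)
    (fun v hv => h.norm_calcKernel_le (key v hv).2 (hd v (key v hv).1))

variable [CompleteSpace X]

/-- Each of the two lines is shifted within `ω ≤ |Im v| ≤ ω'`, where both the resolvent and `f` are
holomorphic. -/
theorem sectorCalc_eq (h : IsSectorialFamily R θ M) {ω' : ℝ} (hθω : θ < ω) (hωω : ω ≤ ω')
    (hωφ : ω' < φ) (hφ : φ ≤ Real.pi) (hf : MemHInftyZero φ f) :
    sectorCalc R ω f = sectorCalc R ω' f := by
  have hω0 : 0 < ω := h.pos.trans hθω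
  have hφ0 : 0 < φ := by linarith
  obtain ⟨C, s, -, hs, hd⟩ := hf.exists_exp_decay hφ0 hφ
  have key : ∀ v : ℂ, ω ≤ |v.im| → |v.im| ≤ ω' → Real.cos φ < Real.cos v.im ∧
      Real.cos v.im < Real.cos θ := fun v h1 h2 =>
    ⟨cos_lt_cos_of_abs_lt (by linarith) hφ, cos_lt_cos_of_lt_abs h.pos.le (by linarith)
      (by linarith)⟩
  have hdiff : ∀ v : ℂ, ω ≤ |v.im| → |v.im| ≤ ω' → DifferentiableAt ℂ (calcKernel R f) v :=
    fun v h1 h2 => h.differentiableAt_calcKernel (key v h1 h2).2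
      (hf.differentiableAt_exp hφ0 hφ (key v h1 h2).1)
  have hdec : ∀ v : ℂ, ω ≤ |v.im| → |v.im| ≤ ω' →
      ‖calcKernel R f v‖ ≤ M * C * Real.exp (-s * |v.re|) :=
    fun v h1 h2 => h.norm_calcKernel_le (key v h1 h2).2 (hd v (key v h1 h2).1)
  have up := strip_shift hωω
    (fun v h1 h2 => hdiff v (by rwa [abs_of_nonneg (by linarith)])
      (by rwa [abs_of_nonneg (by linarith)])) hs
    (fun v h1 h2 => hdec v (by rwa [abs_of_nonneg (by linarith)])
      (by rwa [abs_of_nonneg (by linarith)]))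
  have low := strip_shift (neg_le_neg hωω)
    (fun v h1 h2 => hdiff v (by rw [abs_of_nonpos (by linarith)]; linarith)
      (by rw [abs_of_nonpos (by linarith)]; linarith)) hs
    (fun v h1 h2 => hdec v (by rw [abs_of_nonpos (by linarith)]; linarith)
      (by rw [abs_of_nonpos (by linarith)]; linarith))
  rw [sectorCalc, sectorCalc, veeInt, veeInt]
  simp only [lineInt]
  rw [up, low]

end IsSectorialFamily

theorem exp_re_ge_of_abs_im_le {ω : ℝ} (hω : ω ≤ Real.pi) {v : ℂ} (hv : |v.im| ≤ ω) :
    Real.cos ω * ‖Complex.exp v‖ ≤ (Complex.exp v).re := by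
  rw [Complex.norm_exp, Complex.exp_re, mul_comm, ← Real.cos_abs v.im]
  gcongr
  exact Real.cos_le_cos_of_nonneg_of_le_pi (abs_nonneg _) hω hv

/-- Cauchy's theorem for `f(z) / (w - z)` with `w` outside the contour. -/
theorem veeInt_div_sub_eq_zero (hω0 : 0 < ω) (hωφ : ω < φ) (hφ : φ ≤ Real.pi)
    (hf : MemHInftyZero φ f) {w : ℂ} (hw : w ∈ outerSector ω) :
    VeeIntegrable (fun v => Complex.exp v * f (Complex.exp v) * (w - Complex.exp v)⁻¹) ω ∧
    veeInt (fun v => Complex.exp v * f (Complex.exp v) * (w - Complex.exp v)⁻¹) ω = 0 := by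
  have hφ0 : 0 < φ := by linarith
  obtain ⟨C, s, hC, hs, hd⟩ := hf.exists_exp_decay hφ0 hφ
  obtain ⟨K, hK0, hK⟩ := exists_norm_le_of_mem_outerSector hw
  have hw0 := norm_pos_iff.2 (ne_zero_of_mem_outerSector hw)
  have key : ∀ v : ℂ, |v.im| ≤ ω → w - Complex.exp v ≠ 0 ∧ Real.cos φ < Real.cos v.im := by
    intro v hv
    have h1 := hK _ (exp_re_ge_of_abs_im_le (by linarith) hv)
    refine ⟨fun h0 => ?_, cos_lt_cos_of_abs_lt (by linarith) hφ⟩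
    rw [h0, norm_zero, mul_zero] at h1
    linarith [h1.1]
  have hdiff : ∀ v : ℂ, |v.im| ≤ ω → DifferentiableAt ℂ
      (fun v => Complex.exp v * f (Complex.exp v) * (w - Complex.exp v)⁻¹) v := fun v hv =>
    (Complex.differentiable_exp.differentiableAt.mul
      (hf.differentiableAt_exp hφ0 hφ (key v hv).2)).mul
      (((differentiableAt_const w).sub Complex.differentiable_exp.differentiableAt).inv
        (key v hv).1)
  have hdec : ∀ v : ℂ, |v.im| ≤ ω →
      ‖Complex.exp v * f (Complex.exp v) * (w - Complex.exp v)⁻¹‖ ≤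
        (K * C) * Real.exp (-s * |v.re|) := by
    intro v hv
    have h1 := (hK _ (exp_re_ge_of_abs_im_le (by linarith) hv)).2
    have h2 := norm_pos_iff.2 (key v hv).1
    rw [norm_mul, norm_mul, norm_inv, mul_right_comm, ← div_eq_mul_inv, mul_assoc]
    have h3 : ‖Complex.exp v‖ / ‖w - Complex.exp v‖ ≤ K := by rwa [div_le_iff₀ h2]
    exact mul_le_mul h3 (hd v (key v hv).2) (norm_nonneg _) hK0
  refine ⟨veeIntegrable_of_decay hs (fun v hv => (hdiff v ?_).continuousAt)
    (fun v hv => hdec v ?_), ?_⟩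
  · rw [hv, abs_of_pos hω0]
  · rw [hv, abs_of_pos hω0]
  · rw [veeInt, sub_eq_zero]
    exact strip_shift (by linarith) (fun v h1 h2 => hdiff v (abs_le.2 ⟨h1, h2⟩)) hs
      (fun v h1 h2 => hdec v (abs_le.2 ⟨h1, h2⟩))

/-- Cauchy's formula for `f ∈ H^∞_0` on a sector. -/
theorem veeInt_div_sub (hω0 : 0 < ω) (hωφ : ω < φ) (hφ : φ ≤ Real.pi)
    (hf : MemHInftyZero φ f) {u : ℂ} (hu : |u.im| < ω) :
    veeInt (fun v => Complex.exp v * f (Complex.exp v) *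
      (Complex.exp v - Complex.exp u)⁻¹) ω = 2 * Real.pi * Complex.I * f (Complex.exp u) := by
  have hφ0 : 0 < φ := by linarith
  obtain ⟨C, s, hC, hs, hd⟩ := hf.exists_exp_decay hφ0 hφ
  rw [abs_lt] at hu
  have key : ∀ v : ℂ, -ω ≤ v.im → v.im ≤ ω → Real.cos φ < Real.cos v.im := fun v h1 h2 =>
    cos_lt_cos_of_abs_lt ((abs_le.2 ⟨h1, h2⟩).trans_lt hωφ) hφ
  have := strip_cauchy (g := fun v => f (Complex.exp v)) (C := C) (s := s) hu.1 hu.2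
    (by linarith) (fun v h1 h2 => hf.differentiableAt_exp hφ0 hφ (key v h1 h2)) hs
    (fun v h1 h2 => (hd v (key v h1 h2)).trans (by
      gcongr
      refine le_min ?_ ?_
      · rw [Real.exp_le_one_iff]
        nlinarith [abs_nonneg v.re]
      · gcongr 1
        nlinarith [le_abs_self v.re]))
  rw [← smul_eq_mul (a := 2 * (Real.pi : ℂ) * Complex.I), ← this, veeInt, lineInt, lineInt]
  congr 1 <;> refine integral_congr_ae (ae_of_all _ fun x => ?_) <;>
    simp only [smul_eq_mul] <;> ring

variable [CompleteSpace X]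

namespace IsSectorialFamily

/-- The resolvent identity splits `R z * R w` into `(w - z)⁻¹ • (R z - R w)`. The part with `R w`
carries a scalar integral that vanishes because `w` lies outside the contour. -/
theorem sectorCalc_mul_resolvent (h : IsSectorialFamily R θ M) (hθω : θ < ω) (hωφ : ω < φ)
    (hφ : φ ≤ Real.pi) (hf : MemHInftyZero φ f) {w : ℂ} (hw : w ∈ outerSector ω) :
    sectorCalc R ω f * R w = sectorCalc R ω (fun z => f z * (w - z)⁻¹) := by
  have hω0 : 0 < ω := h.pos.trans hθω
  have hφ0 : 0 < φ := by linarith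
  have hw' := outerSector_mono h.pos.le hθω.le (by linarith) hw
  obtain ⟨i1, e1⟩ := veeInt_div_sub_eq_zero hω0 hωφ hφ hf hw
  have iK := h.veeIntegrable_calcKernel hθω hωφ hφ hf
  have eR := veeInt_clm ((ContinuousLinearMap.mul ℂ (X →L[ℂ] X)).flip (R w)) iK
  have eS := veeInt_clm ((ContinuousLinearMap.id ℂ ℂ).smulRight (R w)) i1
  simp only [ContinuousLinearMap.flip_apply, ContinuousLinearMap.mul_apply',
    ContinuousLinearMap.smulRight_apply, ContinuousLinearMap.id_apply, e1, zero_smul] at eR eS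
  rw [sectorCalc, sectorCalc, smul_mul_assoc, ← eR]
  congr 1
  have key : ∀ v : ℂ, |v.im| = |ω| → Complex.exp v ∈ outerSector θ ∧ w ≠ Complex.exp v := by
    intro v hv
    rw [abs_of_pos hω0] at hv
    refine ⟨exp_mem_outerSector (cos_lt_cos_of_lt_abs h.pos.le (by linarith) (by linarith)), ?_⟩
    rintro rfl
    exact absurd (exp_re_ge_of_abs_im_le (v := v) (by linarith) hv.le) (not_le.2 hw)
  have iS : VeeIntegrable (fun v => (Complex.exp v * f (Complex.exp v) *
      (w - Complex.exp v)⁻¹) • R w) ω := ⟨i1.1.smul_const _, i1.2.smul_const _⟩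
  have iM : VeeIntegrable (fun v => calcKernel R f v * R w) ω :=
    ⟨iK.1.mul_const _, iK.2.mul_const _⟩
  have := veeInt_add iM iS
  rw [eS, add_zero] at this
  rw [← this]
  refine veeInt_congr fun v hv => ?_
  obtain ⟨k1, k2⟩ := key v hv
  simp only [calcKernel]
  rw [smul_mul_assoc, h.mul_eq k1 hw' k2, smul_smul, smul_sub, sub_add_cancel, mul_assoc]

end IsSectorialFamily

end SectorCalculus

/-! ### Interchange of two contour integrals -/

section Fubini

variable {E : Type*} [NormedAddCommGroup E] [NormedSpace ℂ E]

theorem veeInt_smul_const (c : ℂ → ℂ) (x : E) (ω : ℝ) [CompleteSpace E] :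
    veeInt (fun v => c v • x) ω = veeInt c ω • x := by
  simp only [veeInt, lineInt, integral_smul_const, sub_smul]

theorem veeInt_veeInt_swap {K : ℂ → ℂ → E} {ω ω' C s s' : ℝ} (hs : 0 < s)
    (hs' : 0 < s')
    (hc : ∀ y y' : ℝ, |y| = |ω| → |y'| = |ω'| →
      Continuous fun p : ℝ × ℝ => K (p.1 + y * Complex.I) (p.2 + y' * Complex.I))
    (hd : ∀ v w : ℂ, |v.im| = |ω| → |w.im| = |ω'| →
      ‖K v w‖ ≤ C * (Real.exp (-s * |v.re|) * Real.exp (-s' * |w.re|))) :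
    veeInt (fun v => veeInt (K v) ω') ω = veeInt (fun w => veeInt (fun v => K v w) ω) ω' := by
  have hi : ∀ y y' : ℝ, |y| = |ω| → |y'| = |ω'| → Integrable
      (fun p : ℝ × ℝ => K (p.1 + y * Complex.I) (p.2 + y' * Complex.I))
      (volume.prod volume) := by
    intro y y' hy hy'
    refine ((((integrable_exp_neg_mul_abs hs).mul_prod
      (integrable_exp_neg_mul_abs hs')).const_mul C)).mono'
      (hc y y' hy hy').aestronglyMeasurable (ae_of_all _ fun p => ?_)
    simpa using hd (p.1 + y * Complex.I) (p.2 + y' * Complex.I) (by simpa using hy)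
      (by simpa using hy')
  have sw : ∀ y y' : ℝ, |y| = |ω| → |y'| = |ω'| →
      lineInt (fun v => lineInt (K v) y') y = lineInt (fun w => lineInt (fun v => K v w) y) y' :=
    fun y y' hy hy' => integral_integral_swap (hi y y' hy hy')
  have vi1 : ∀ y' : ℝ, |y'| = |ω'| → VeeIntegrable (fun v => lineInt (K v) y') ω := fun y' hy' =>
    ⟨(hi _ y' (abs_neg ω) hy').integral_prod_left, (hi _ y' rfl hy').integral_prod_left⟩
  have vi2 : ∀ y : ℝ, |y| = |ω| → VeeIntegrable (fun w => lineInt (fun v => K v w) y) ω' :=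
    fun y hy =>
    ⟨(hi y _ hy (abs_neg ω')).integral_prod_right, (hi y _ hy rfl).integral_prod_right⟩
  have e1 : veeInt (fun v => veeInt (K v) ω') ω =
      veeInt (fun v => lineInt (K v) (-ω')) ω - veeInt (fun v => lineInt (K v) ω') ω :=
    veeInt_sub (vi1 _ (abs_neg ω')) (vi1 _ rfl)
  have e2 : veeInt (fun w => veeInt (fun v => K v w) ω) ω' =
      veeInt (fun w => lineInt (fun v => K v w) (-ω)) ω' -
        veeInt (fun w => lineInt (fun v => K v w) ω) ω' :=
    veeInt_sub (vi2 _ (abs_neg ω)) (vi2 _ rfl)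
  rw [e1, e2]
  simp only [veeInt]
  rw [sw _ _ (abs_neg ω) (abs_neg ω'), sw _ _ rfl (abs_neg ω'), sw _ _ (abs_neg ω) rfl,
    sw _ _ rfl rfl]
  abel

end Fubini

/-! ### Algebra of `H^∞_0` and multiplicativity -/

section Multiplicativity

variable {X : Type*} [NormedAddCommGroup X] [NormedSpace ℂ X]
variable {R : ℂ → X →L[ℂ] X} {θ M ω φ : ℝ} {f g : ℂ → ℂ}

theorem MemHInftyZero.of_bounds {φ C a : ℝ} {f : ℂ → ℂ} (hf : DifferentiableOn ℂ f (sector φ))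
    (ha : 0 < a) (h1 : ∀ z ∈ sector φ, ‖f z‖ ≤ C * ‖z‖ ^ a)
    (h2 : ∀ z ∈ sector φ, ‖f z‖ ≤ C * ‖z‖ ^ (-a)) : MemHInftyZero φ f := by
  have h3 : ∀ z ∈ sector φ, ‖f z‖ ≤ max C 1 * min (‖z‖ ^ a) (‖z‖ ^ (-a)) := by
    intro z hz
    rw [mul_min_of_nonneg _ _ (by positivity)]
    refine le_min ((h1 z hz).trans ?_) ((h2 z hz).trans ?_) <;> gcongr <;> exact le_max_left _ _
  refine ⟨hf, ⟨max C 1, fun z hz => (h3 z hz).trans ?_⟩, max C 1, a, by positivity, ha, h3⟩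
  have h0 := norm_pos_iff.2 hz.1
  refine mul_le_of_le_one_right (by positivity) ?_
  rcases le_total ‖z‖ 1 with h | h
  · exact (min_le_left _ _).trans (Real.rpow_le_one h0.le h ha.le)
  · exact (min_le_right _ _).trans (Real.rpow_le_one_of_one_le_of_nonpos h (by linarith))

theorem MemHInftyZero.add {φ : ℝ} {f g : ℂ → ℂ} (hf : MemHInftyZero φ f)
    (hg : MemHInftyZero φ g) : MemHInftyZero φ fun z => f z + g z := by
  obtain ⟨df, ⟨Mf, hMf⟩, Cf, s, hCf, hs, bf⟩ := hf
  obtain ⟨dg, ⟨Mg, hMg⟩, Cg, t, hCg, ht, bg⟩ := hg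
  have key : ∀ (s' C : ℝ) (F : ℂ → ℂ), 0 < C → min s t ≤ s' →
      (∀ z ∈ sector φ, ‖F z‖ ≤ C * min (‖z‖ ^ s') (‖z‖ ^ (-s'))) →
      ∀ z ∈ sector φ, ‖F z‖ ≤ C * min (‖z‖ ^ min s t) (‖z‖ ^ (-min s t)) := by
    intro s' C F hC hst h z hz
    refine (h z hz).trans (mul_le_mul_of_nonneg_left ?_ hC.le)
    have h0 := norm_pos_iff.2 hz.1
    have hm : 0 < min s t := lt_min hs ht
    rcases le_total ‖z‖ 1 with h1 | h1
    · have e1 : ‖z‖ ^ s' ≤ ‖z‖ ^ min s t := Real.rpow_le_rpow_of_exponent_ge h0 h1 hst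
      have e2 : ‖z‖ ^ min s t ≤ ‖z‖ ^ (-min s t) :=
        Real.rpow_le_rpow_of_exponent_ge h0 h1 (by linarith)
      exact (min_le_left _ _).trans (le_min e1 (e1.trans e2))
    · have e1 : ‖z‖ ^ (-s') ≤ ‖z‖ ^ (-min s t) :=
        Real.rpow_le_rpow_of_exponent_le h1 (by linarith)
      have e2 : ‖z‖ ^ (-min s t) ≤ ‖z‖ ^ min s t :=
        Real.rpow_le_rpow_of_exponent_le h1 (by linarith)
      exact (min_le_right _ _).trans (le_min (e1.trans e2) e1)
  refine ⟨df.add dg, ⟨Mf + Mg, fun z hz => (norm_add_le _ _).trans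
    (add_le_add (hMf z hz) (hMg z hz))⟩, Cf + Cg, min s t, by positivity, lt_min hs ht,
    fun z hz => (norm_add_le _ _).trans ?_⟩
  rw [add_mul]
  exact add_le_add (key s Cf f hCf (min_le_left _ _) bf z hz)
    (key t Cg g hCg (min_le_right _ _) bg z hz)

/-- `H^∞_0` is an ideal in the bounded holomorphic functions. -/
theorem MemHInftyZero.mul_bounded {φ : ℝ} {f g : ℂ → ℂ} (hf : MemHInftyZero φ f)
    (hg : DifferentiableOn ℂ g (sector φ)) {B : ℝ} (hB : ∀ z ∈ sector φ, ‖g z‖ ≤ B) :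
    MemHInftyZero φ fun z => f z * g z := by
  obtain ⟨df, ⟨Mf, hMf⟩, C, s, hC, hs, bf⟩ := hf
  have hb : ∀ z ∈ sector φ, ‖g z‖ ≤ max B 1 := fun z hz => (hB z hz).trans (le_max_left _ _)
  refine ⟨df.mul hg, ⟨Mf * max B 1, fun z hz => ?_⟩, C * max B 1, s, by positivity, hs,
    fun z hz => ?_⟩
  · rw [norm_mul]
    exact mul_le_mul (hMf z hz) (hb z hz) (norm_nonneg _) ((norm_nonneg _).trans (hMf z hz))
  · rw [norm_mul, mul_right_comm]
    exact mul_le_mul (bf z hz) (hb z hz) (norm_nonneg _) ((norm_nonneg _).trans (bf z hz))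

theorem MemHInftyZero.const_mul {φ : ℝ} {f : ℂ → ℂ} (hf : MemHInftyZero φ f) (c : ℂ) :
    MemHInftyZero φ fun z => c * f z := by
  simpa only [mul_comm c] using hf.mul_bounded (g := fun _ => c) (differentiableOn_const c)
    (B := ‖c‖) fun _ _ => le_rfl

theorem MemHInftyZero.congr {φ : ℝ} {f g : ℂ → ℂ} (hf : MemHInftyZero φ f)
    (h : ∀ z ∈ sector φ, g z = f z) : MemHInftyZero φ g := by
  obtain ⟨df, ⟨B, hB⟩, C, s, hC, hs, bf⟩ := hf
  exact ⟨df.congr h, ⟨B, fun z hz => by rw [h z hz]; exact hB z hz⟩, C, s, hC, hs,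
    fun z hz => by rw [h z hz]; exact bf z hz⟩

theorem MemHInftyZero.bounded {φ : ℝ} {f : ℂ → ℂ} (hf : MemHInftyZero φ f) :
    ∃ B : ℝ, ∀ z ∈ sector φ, ‖f z‖ ≤ B :=
  hf.2.1

/-- `1 + z` is bounded below by `1` and by `|z|`, up to a constant, on a sector. -/
theorem exists_norm_inv_one_add_le {φ : ℝ} (h0 : 0 < φ) (hπ : φ < Real.pi) :
    ∃ K : ℝ, 0 < K ∧ ∀ z ∈ sector φ, 1 + z ≠ 0 ∧ ‖(1 + z)⁻¹‖ ≤ K ∧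
      ‖z‖ * ‖(1 + z)⁻¹‖ ≤ K := by
  obtain ⟨K, hK0, hK⟩ := exists_norm_le_of_mem_outerSector (neg_one_mem_outerSector h0 hπ)
  refine ⟨K + 1, by positivity, fun z hz => ?_⟩
  obtain ⟨h1, h2⟩ := hK z ((mem_sector_iff h0 hπ.le).1 hz).le
  have e : (-1 : ℂ) - z = -(1 + z) := by ring
  rw [e, norm_neg] at h1 h2
  rw [norm_neg, norm_one] at h1
  have hne : 1 + z ≠ 0 := fun h => by
    rw [h, norm_zero, mul_zero] at h1
    linarith
  have hp := norm_pos_iff.2 hne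
  refine ⟨hne, ?_, ?_⟩
  · rw [norm_inv, inv_le_iff_one_le_mul₀ hp]
    linarith
  · rw [norm_inv, ← div_eq_mul_inv, div_le_iff₀ hp]
    linarith

theorem differentiableOn_inv_one_add {φ : ℝ} (h0 : 0 < φ) (hπ : φ < Real.pi) :
    DifferentiableOn ℂ (fun z : ℂ => (1 + z)⁻¹) (sector φ) := by
  obtain ⟨K, -, hK⟩ := exists_norm_inv_one_add_le h0 hπ
  exact DifferentiableOn.inv (by fun_prop) fun z hz => (hK z hz).1

/-- The function `z (1 + z)⁻²`. -/
def bump (z : ℂ) : ℂ :=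
  z * (1 + z)⁻¹ * (1 + z)⁻¹

theorem memHInftyZero_bump {φ : ℝ} (h0 : 0 < φ) (hπ : φ < Real.pi) : MemHInftyZero φ bump := by
  obtain ⟨K, hK0, hK⟩ := exists_norm_inv_one_add_le h0 hπ
  have d := differentiableOn_inv_one_add h0 hπ
  refine MemHInftyZero.of_bounds (C := K * K) (a := 1) ((differentiableOn_id.mul d).mul d)
    one_pos (fun z hz => ?_) fun z hz => ?_
  · obtain ⟨-, h1, -⟩ := hK z hz
    rw [bump, norm_mul, norm_mul, Real.rpow_one, mul_assoc, mul_comm]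
    gcongr
  · obtain ⟨-, -, h1⟩ := hK z hz
    have hz0 := norm_pos_iff.2 hz.1
    rw [bump, norm_mul, norm_mul, Real.rpow_neg_one, ← div_eq_mul_inv, le_div_iff₀ hz0,
      mul_assoc, mul_comm _ ‖z‖]
    exact mul_le_mul h1 h1 (by positivity) hK0.le

variable [CompleteSpace X]

namespace IsSectorialFamily

/-- Multiplicativity of the Dunford-Riesz calculus. -/
theorem sectorCalc_mul (h : IsSectorialFamily R θ M) (hθω : θ < ω) (hωφ : ω < φ)
    (hφ : φ ≤ Real.pi) (hf : MemHInftyZero φ f) (hg : MemHInftyZero φ g) :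
    sectorCalc R ω f * sectorCalc R ω g = sectorCalc R ω (fun z => f z * g z) := by
  have hω0 : 0 < ω := h.pos.trans hθω
  have hφ0 : 0 < φ := by linarith
  -- The integral of `g` moves to a wider contour, so that the two contours are separated and the
  -- double kernel has no singularity.
  obtain ⟨ω', hωω', hω'φ⟩ := exists_between hωφ
  rw [h.sectorCalc_eq hθω hωω'.le hω'φ hφ hg]
  obtain ⟨C, s, hC, hs, hd⟩ := hf.exists_exp_decay hφ0 hφ
  obtain ⟨C', s', hC', hs', hd'⟩ := hg.exists_exp_decay hφ0 hφ
  have hcos : Real.cos ω' < Real.cos ω :=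
    Real.cos_lt_cos_of_nonneg_of_le_pi hω0.le (by linarith) hωω'
  have aω : |ω| = ω := abs_of_pos hω0
  have aω' : |ω'| = ω' := abs_of_pos (by linarith)
  have kv : ∀ v : ℂ, |v.im| = |ω| → Real.cos φ < Real.cos v.im ∧ Real.cos v.im < Real.cos θ :=
    fun v hv => ⟨cos_lt_cos_of_abs_lt (by linarith) hφ,
      cos_lt_cos_of_lt_abs h.pos.le (by linarith) (by linarith)⟩
  have kw : ∀ v : ℂ, |v.im| = |ω'| → Real.cos φ < Real.cos v.im ∧ Real.cos v.im < Real.cos ω ∧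
      Real.cos v.im < Real.cos θ :=
    fun v hv => ⟨cos_lt_cos_of_abs_lt (by linarith) hφ,
      cos_lt_cos_of_lt_abs hω0.le (by linarith) (by linarith),
      cos_lt_cos_of_lt_abs h.pos.le (by linarith) (by linarith)⟩
  set L : ℝ := 2 / (Real.cos ω - Real.cos ω') with hL
  have hL0 : 0 ≤ L := div_nonneg zero_le_two (by linarith)
  have hsep : ∀ v w : ℂ, |v.im| = |ω| → |w.im| = |ω'| →
      ‖Complex.exp w‖ ≤ L * ‖Complex.exp w - Complex.exp v‖ ∧
        Complex.exp w - Complex.exp v ≠ 0 := by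
    intro v w hv hw
    have h1 := (norm_le_norm_sub_of_separated (Real.abs_cos_le_one ω) (Real.abs_cos_le_one ω')
      hcos (exp_re_ge_of_abs_im_le (v := v) (by linarith) (by linarith)) (w := Complex.exp w)
      (by rw [Complex.norm_exp, Complex.exp_re, mul_comm, ← Real.cos_abs w.im, hw, aω'])).1
    rw [norm_sub_rev] at h1
    refine ⟨h1, fun h0 => ?_⟩
    rw [h0, norm_zero, mul_zero] at h1
    linarith [norm_pos_iff.2 (Complex.exp_ne_zero w)]
  -- Integrating in `v` first produces `f(A)` times the integrand of `g(A)`. Integrating in `w`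
  -- first is Cauchy's formula for `g` at `exp v`, which lies inside the wider contour, and produces
  -- the integrand of `(fg)(A)`.
  set K : ℂ → ℂ → X →L[ℂ] X := fun v w =>
    (Complex.exp w * g (Complex.exp w) * (Complex.exp w - Complex.exp v)⁻¹) • calcKernel R f v
    with hK
  have swap : veeInt (fun v => veeInt (K v) ω') ω =
      veeInt (fun w => veeInt (fun v => K v w) ω) ω' := by
    refine veeInt_veeInt_swap (C := L * C' * (M * C)) hs hs' ?_ ?_
    · intro y y' hy hy'
      have c1 : Continuous fun x : ℝ => calcKernel R f (x + y * Complex.I) :=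
        continuous_iff_continuousAt.2 fun x =>
          (h.differentiableAt_calcKernel (kv (x + y * Complex.I) (by simpa using hy)).2
            (hf.differentiableAt_exp hφ0 hφ
              (kv (x + y * Complex.I) (by simpa using hy)).1)).continuousAt.comp
            (f := fun x : ℝ => (x : ℂ) + y * Complex.I) (by fun_prop)
      have c2 : Continuous fun x : ℝ => g (Complex.exp (x + y' * Complex.I)) :=
        continuous_iff_continuousAt.2 fun x =>
          (hg.differentiableAt_exp hφ0 hφ
              (kw (x + y' * Complex.I) (by simpa using hy')).1).continuousAt.comp
            (f := fun x : ℝ => (x : ℂ) + y' * Complex.I) (by fun_prop)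
      have c3 : Continuous fun p : ℝ × ℝ => (Complex.exp (p.2 + y' * Complex.I) -
          Complex.exp (p.1 + y * Complex.I))⁻¹ :=
        Continuous.inv₀ (by fun_prop) fun p =>
          (hsep _ _ (by simpa using hy) (by simpa using hy')).2
      have c4 : Continuous fun x : ℝ => Complex.exp (x + y' * Complex.I) := by fun_prop
      exact (((c4.comp continuous_snd).mul (c2.comp continuous_snd)).mul c3).smul
        (c1.comp continuous_fst)
    · intro v w hv hw
      obtain ⟨s1, s2⟩ := hsep v w hv hw
      rw [hK, norm_smul]
      have e1 : ‖Complex.exp w * g (Complex.exp w) * (Complex.exp w - Complex.exp v)⁻¹‖ ≤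
          L * (C' * Real.exp (-s' * |w.re|)) := by
        rw [norm_mul, norm_mul, norm_inv, mul_right_comm, ← div_eq_mul_inv]
        refine mul_le_mul ?_ (hd' w (kw w hw).1) (norm_nonneg _) hL0
        rwa [div_le_iff₀ (norm_pos_iff.2 s2)]
      have e2 := h.norm_calcKernel_le (kv v hv).2 (hd v (kv v hv).1)
      calc _ ≤ L * (C' * Real.exp (-s' * |w.re|)) * (M * C * Real.exp (-s * |v.re|)) :=
            mul_le_mul e1 e2 (norm_nonneg _) (by positivity)
        _ = _ := by ring
  have left : veeInt (fun w => veeInt (fun v => K v w) ω) ω' =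
      (2 * (Real.pi : ℂ) * Complex.I) •
        (sectorCalc R ω f * veeInt (calcKernel R g) ω') := by
    have e := veeInt_clm (ContinuousLinearMap.mul ℂ (X →L[ℂ] X) (sectorCalc R ω f))
      (h.veeIntegrable_calcKernel (by linarith) hω'φ hφ hg)
    simp only [ContinuousLinearMap.mul_apply'] at e
    rw [← e, ← veeInt_smul]
    refine veeInt_congr fun w hw => ?_
    rw [calcKernel, mul_smul_comm, h.sectorCalc_mul_resolvent hθω hωφ hφ hf
      (exp_mem_outerSector (kw w hw).2.1), sectorCalc, smul_comm _ (_ * _), smul_smul,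
      smul_smul, ← veeInt_smul, mul_inv_cancel_right₀ Complex.two_pi_I_ne_zero]
    refine veeInt_congr fun v _ => ?_
    simp only [hK, calcKernel, smul_smul]
    congr 1
    ring
  have right : veeInt (fun v => veeInt (K v) ω') ω =
      (2 * (Real.pi : ℂ) * Complex.I) • veeInt (calcKernel R fun z => f z * g z) ω := by
    rw [← veeInt_smul]
    refine veeInt_congr fun v hv => ?_
    rw [hK]
    simp only
    rw [veeInt_smul_const, veeInt_div_sub (by linarith) hω'φ hφ hg (by linarith), calcKernel,
      calcKernel, smul_smul, smul_smul]
    congr 1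
    ring
  have hpi : (2 * (Real.pi : ℂ) * Complex.I) ≠ 0 := Complex.two_pi_I_ne_zero
  rw [left, right] at swap
  have e := smul_right_injective (X →L[ℂ] X) hpi swap
  change sectorCalc R ω f * ((2 * (Real.pi : ℂ) * Complex.I)⁻¹ • _) =
    (2 * (Real.pi : ℂ) * Complex.I)⁻¹ • _
  rw [mul_smul_comm]
  exact congrArg _ e.symm

theorem sectorCalc_add (h : IsSectorialFamily R θ M) (hθω : θ < ω) (hωφ : ω < φ)
    (hφ : φ ≤ Real.pi) (hf : MemHInftyZero φ f) (hg : MemHInftyZero φ g) :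
    sectorCalc R ω (fun z => f z + g z) = sectorCalc R ω f + sectorCalc R ω g := by
  rw [sectorCalc, sectorCalc, sectorCalc, ← smul_add, ← veeInt_add
    (h.veeIntegrable_calcKernel hθω hωφ hφ hf) (h.veeIntegrable_calcKernel hθω hωφ hφ hg)]
  congr 1
  refine veeInt_congr fun v _ => ?_
  simp only [calcKernel, mul_add, add_smul]

theorem sectorCalc_const_mul (c : ℂ) :
    sectorCalc R ω (fun z => c * f z) = c • sectorCalc R ω f := by
  rw [sectorCalc, sectorCalc, smul_comm c, ← veeInt_smul c]
  congr 1
  refine veeInt_congr fun v _ => ?_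
  simp only [calcKernel, smul_smul]
  congr 1
  ring

/-- The Dunford-Riesz integral of `z (1 + z)⁻²`. -/
theorem sectorCalc_bump (h : IsSectorialFamily R θ M) (hθω : θ < ω) (hω : ω < Real.pi) :
    sectorCalc R ω bump = -R (-1) - R (-1) * R (-1) := by
  have hω0 : 0 < ω := h.pos.trans hθω
  obtain ⟨φ, hωφ, hφ⟩ := exists_between hω
  have hφ0 : 0 < φ := by linarith
  have aω : |ω| = ω := abs_of_pos hω0
  have hb := memHInftyZero_bump hφ0 hφ
  have hm1 := neg_one_mem_outerSector h.pos h.lt_pi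
  have hcos1 : Real.cos ω < 1 := by
    simpa using Real.cos_lt_cos_of_nonneg_of_le_pi le_rfl hω.le hω0
  have hcosθ : Real.cos ω < Real.cos θ :=
    Real.cos_lt_cos_of_nonneg_of_le_pi h.pos.le hω.le hθω
  set K : ℝ := 2 / (1 - Real.cos ω) with hKdef
  have hK0 : 0 < K := div_pos two_pos (by linarith)
  -- separation of the point `1` from the exterior of the sector
  have sep1 : ∀ v : ℂ, Real.cos v.im ≤ Real.cos ω → Complex.exp v - 1 ≠ 0 ∧
      ‖(Complex.exp v - 1)⁻¹‖ ≤ K ∧ ‖Complex.exp v‖ * ‖(Complex.exp v - 1)⁻¹‖ ≤ K := by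
    intro v hv
    obtain ⟨s1, s2⟩ := norm_le_norm_sub_of_separated (c := 1) (c' := Real.cos ω) (by simp)
      (Real.abs_cos_le_one ω) hcos1 (z := 1) (w := Complex.exp v) (by simp) (by
        rw [Complex.norm_exp, Complex.exp_re, mul_comm]; gcongr)
    rw [norm_sub_rev, norm_one] at s2
    rw [norm_sub_rev] at s1
    have hne : Complex.exp v - 1 ≠ 0 := fun h0 => by
      rw [h0, norm_zero, mul_zero] at s2; linarith
    have hp := norm_pos_iff.2 hne
    refine ⟨hne, ?_, ?_⟩
    · rw [norm_inv, inv_le_iff_one_le_mul₀ hp]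
      exact s2
    · rw [norm_inv, ← div_eq_mul_inv, div_le_iff₀ hp]
      exact s1
  obtain ⟨K', hK'0, sep2⟩ := exists_norm_inv_one_add_le hφ0 hφ
  have hvω : ∀ v : ℂ, |v.im| = |ω| → Real.cos v.im = Real.cos ω := fun v hv => by
    rw [← Real.cos_abs, hv, aω]
  have hsec : ∀ v : ℂ, |v.im| = |ω| → Complex.exp v ∈ sector φ := fun v hv =>
    exp_mem_sector hφ0 hφ.le (cos_lt_cos_of_abs_lt (by linarith) hφ.le)
  -- The double pole of `bump` at `-1` is avoided by the resolvent identity: `bump(z) R(z) = f(z)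
  -- R(z) + 2 f(z) R(z) R(-1) - 2 bump(z) (z - 1)⁻¹ R(-1)`. The factor `(z - 1)⁻¹` gives `f` decay
  -- at infinity; its price is a scalar residue at `1`.
  set f : ℂ → ℂ := fun z => z * (1 + z)⁻¹ * (z - 1)⁻¹ with hf
  have i1 : VeeIntegrable (calcKernel R f) ω := by
    refine veeIntegrable_of_decay (C := M * (K' * K)) (s := 1) one_pos (fun v hv => ?_)
      fun v hv => ?_
    · have hd : DifferentiableAt ℂ (fun v => f (Complex.exp v)) v :=
        (Complex.differentiable_exp.differentiableAt.mul
          ((Complex.differentiable_exp.differentiableAt.const_add 1).inv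
            (sep2 _ (hsec v hv)).1)).mul
          ((Complex.differentiable_exp.differentiableAt.sub_const 1).inv
            (sep1 v (hvω v hv).le).1)
      exact (h.differentiableAt_calcKernel (by rw [hvω v hv]; exact hcosθ) hd).continuousAt
    · refine h.norm_calcKernel_le (by rw [hvω v hv]; exact hcosθ) ?_
      obtain ⟨-, a1, a2⟩ := sep2 _ (hsec v hv)
      obtain ⟨-, b1, b2⟩ := sep1 v (hvω v hv).le
      rw [hf]
      simp only [norm_mul]
      rcases le_total 0 v.re with hr | hr
      · rw [abs_of_nonneg hr]
        have : Real.exp (-1 * v.re) * ‖Complex.exp v‖ = 1 := by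
          rw [Complex.norm_exp, ← Real.exp_add]; simp
        have h2 : ‖(Complex.exp v - 1)⁻¹‖ ≤ K * Real.exp (-1 * v.re) := by
          calc _ = Real.exp (-1 * v.re) * (‖Complex.exp v‖ * ‖(Complex.exp v - 1)⁻¹‖) := by
                rw [← mul_assoc, this, one_mul]
            _ ≤ Real.exp (-1 * v.re) * K := by gcongr
            _ = _ := mul_comm _ _
        rw [mul_assoc K']
        exact mul_le_mul a2 h2 (norm_nonneg _) hK'0.le
      · rw [abs_of_nonpos hr, Complex.norm_exp, show -1 * -v.re = v.re by ring]
        calc _ ≤ Real.exp v.re * K' * K := by gcongr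
          _ = _ := by ring
  have i2 : VeeIntegrable (fun v => Complex.exp v * bump (Complex.exp v) *
      (Complex.exp v - Complex.exp 0)⁻¹) ω := by
    obtain ⟨C, s, hC, hs, hd⟩ := hb.exists_exp_decay hφ0 hφ.le
    refine veeIntegrable_of_decay (C := K * C) hs (fun v hv => ?_) fun v hv => ?_
    · have hcv : Real.cos φ < Real.cos v.im := cos_lt_cos_of_abs_lt (by linarith) hφ.le
      refine ((Complex.differentiable_exp.differentiableAt.mul
        (hb.differentiableAt_exp hφ0 hφ.le hcv)).mul
        ((Complex.differentiable_exp.differentiableAt.sub_const _).inv ?_)).continuousAt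
      rw [Complex.exp_zero]
      exact (sep1 v (hvω v hv).le).1
    · rw [Complex.exp_zero, norm_mul, norm_mul, mul_right_comm, mul_assoc K]
      exact mul_le_mul (sep1 v (hvω v hv).le).2.2
        (hd v (cos_lt_cos_of_abs_lt (by linarith) hφ.le)) (norm_nonneg _) hK0.le
  have v1 : veeInt (calcKernel R f) ω =
      -((2 * Real.pi * Complex.I : ℂ) • ((1 / 2 : ℂ) • R (-1))) := by
    have hstrip : ∀ v : ℂ, ω ≤ v.im → v.im ≤ 2 * Real.pi - ω →
        Real.cos v.im ≤ Real.cos ω := by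
      intro v h1 h2
      have : Real.cos (Real.pi - ω) ≤ Real.cos |v.im - Real.pi| :=
        Real.cos_le_cos_of_nonneg_of_le_pi (abs_nonneg _) (by linarith)
          (abs_le.2 ⟨by linarith, by linarith⟩)
      rw [Real.cos_abs, Real.cos_pi_sub, Real.cos_sub_pi] at this
      linarith
    -- The exterior of the sector is the strip `ω ≤ Im v ≤ 2π - ω`, in which `-1 = exp(πi)` is the
    -- only pole. By periodicity its upper edge is the line at height `-ω`, with the opposite
    -- orientation to the original contour.
    have hc := strip_cauchy (a := ω) (b := 2 * Real.pi - ω) (u := Real.pi * Complex.I)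
      (g := fun v => (Complex.exp v * (Complex.exp v - 1)⁻¹) • R (Complex.exp v))
      (C := M * K) (s := 1) (by simpa using hω) (by simp; linarith) (by linarith)
      (fun v h1 h2 => (Complex.differentiable_exp.differentiableAt.mul
        ((Complex.differentiable_exp.differentiableAt.sub_const 1).inv
          (sep1 v (hstrip v h1 h2)).1)).smul
        (h.differentiableAt_exp ((hstrip v h1 h2).trans_lt hcosθ))) one_pos
      (fun v h1 h2 => by
        obtain ⟨-, b1, b2⟩ := sep1 v (hstrip v h1 h2)
        refine (h.norm_exp_smul_le ((hstrip v h1 h2).trans_lt hcosθ) _).trans ?_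
        rw [mul_assoc]
        refine mul_le_mul_of_nonneg_left ?_ h.nonneg
        rw [mul_min_of_nonneg _ _ hK0.le, mul_one]
        refine le_min b1 ?_
        have : Real.exp (-1 * v.re) * ‖Complex.exp v‖ = 1 := by
          rw [Complex.norm_exp, ← Real.exp_add]; simp
        calc _ = Real.exp (-1 * v.re) * (‖Complex.exp v‖ * ‖(Complex.exp v - 1)⁻¹‖) := by
              rw [← mul_assoc, this, one_mul]
          _ ≤ Real.exp (-1 * v.re) * K := by gcongr
          _ = _ := mul_comm _ _)
    rw [Complex.exp_pi_mul_I] at hc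
    have hval : (-1 * (-1 - 1 : ℂ)⁻¹) = 1 / 2 := by norm_num
    simp only [hval] at hc
    rw [← hc, neg_sub, veeInt]
    have kern : ∀ v : ℂ, calcKernel R f v = (Complex.exp v / (Complex.exp v - -1)) •
        (Complex.exp v * (Complex.exp v - 1)⁻¹) • R (Complex.exp v) := by
      intro v
      rw [calcKernel, hf, smul_smul]
      congr 1
      rw [sub_neg_eq_add, div_eq_mul_inv, add_comm (Complex.exp v)]
      ring
    congr 1
    · refine integral_congr_ae (ae_of_all _ fun x => ?_)
      have : Complex.exp (x + (2 * Real.pi - ω : ℝ) * Complex.I) =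
          Complex.exp (x + (-ω : ℝ) * Complex.I) := by
        rw [Complex.exp_eq_exp_iff_exists_int]
        exact ⟨1, by push_cast; ring⟩
      simp only [kern, this]
    · exact integral_congr_ae (ae_of_all _ fun x => kern _)
  have v2 := veeInt_div_sub hω0 hωφ hφ.le hb (u := 0) (by simpa using hω0)
  have hpt : ∀ v : ℂ, |v.im| = |ω| → calcKernel R bump v =
      (calcKernel R f v + calcKernel R f v * ((2 : ℂ) • R (-1))) -
        (Complex.exp v * bump (Complex.exp v) * (Complex.exp v - Complex.exp 0)⁻¹) •
          ((2 : ℂ) • R (-1)) := by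
    intro v hv
    have h1 := (sep1 v (hvω v hv).le).1
    have h2 := (sep2 _ (hsec v hv)).1
    have hz : Complex.exp v ∈ outerSector θ :=
      exp_mem_outerSector (by rw [hvω v hv]; exact hcosθ)
    have h3 : -1 - Complex.exp v ≠ 0 := fun h0 => h2 (by linear_combination -h0)
    simp only [calcKernel, hf, bump, Complex.exp_zero]
    rw [smul_mul_assoc, mul_smul_comm, h.mul_eq hz hm1 (fun e => h3 (by rw [e]; ring))]
    simp only [smul_sub, smul_smul]
    set z := Complex.exp v
    match_scalars
    · field_simp
      ring
    · field_simp
      ring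
  have hi3 : VeeIntegrable (fun v => calcKernel R f v * ((2 : ℂ) • R (-1))) ω :=
    ⟨i1.1.mul_const _, i1.2.mul_const _⟩
  have hi4 : VeeIntegrable (fun v => (Complex.exp v * bump (Complex.exp v) *
      (Complex.exp v - Complex.exp 0)⁻¹) • ((2 : ℂ) • R (-1))) ω :=
    ⟨i2.1.smul_const _, i2.2.smul_const _⟩
  have eR := veeInt_clm ((ContinuousLinearMap.mul ℂ (X →L[ℂ] X)).flip ((2 : ℂ) • R (-1))) i1
  simp only [ContinuousLinearMap.flip_apply, ContinuousLinearMap.mul_apply'] at eR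
  have hbump1 : bump 1 = 1 / 4 := by norm_num [bump]
  rw [sectorCalc, veeInt_congr hpt, veeInt_sub (i1.add hi3) hi4, veeInt_add i1 hi3, eR,
    veeInt_smul_const, v1, v2, Complex.exp_zero, hbump1]
  have hpi : (2 * (Real.pi : ℂ) * Complex.I) ≠ 0 := Complex.two_pi_I_ne_zero
  simp only [neg_mul, smul_mul_assoc, mul_smul_comm]
  set T := R (-1)
  match_scalars <;> field_simp
  norm_num

end IsSectorialFamily

end Multiplicativity

/-! ### The calculus on the extended class `𝓔` -/

section ExtendedCalculus

variable {X : Type*} [NormedAddCommGroup X] [NormedSpace ℂ X]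
variable {R : ℂ → X →L[ℂ] X} {θ M ω φ : ℝ} {f g : ℂ → ℂ} {d d' : (ℂ → ℂ) × ℂ × ℂ}

/-- The value of the calculus on a decomposition `f₀ + l (1 + z)⁻¹ + m`. -/
def decompCalc (R : ℂ → X →L[ℂ] X) (ω : ℝ) (d : (ℂ → ℂ) × ℂ × ℂ) : X →L[ℂ] X :=
  sectorCalc R ω d.1 + d.2.1 • (-R (-1)) + d.2.2 • ContinuousLinearMap.id ℂ X

open Classical in
/-- The calculus of a resolvent family on `𝓔(S_φ)`. -/
def extCalc (R : ℂ → X →L[ℂ] X) (ω φ : ℝ) (f : ℂ → ℂ) : X →L[ℂ] X :=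
  if h : MemE φ f then decompCalc R ω h.choose else 0

theorem sectorCalc_congr (hω : 0 < ω) (hωφ : ω < φ) (hφ : φ ≤ Real.pi)
    (h : ∀ z ∈ sector φ, f z = g z) : sectorCalc R ω f = sectorCalc R ω g := by
  rw [sectorCalc, sectorCalc]
  congr 1
  refine veeInt_congr fun v hv => ?_
  rw [calcKernel, calcKernel, h]
  rw [abs_of_pos hω] at hv
  exact exp_mem_sector (hω.trans hωφ) hφ (cos_lt_cos_of_abs_lt (by linarith) hφ)

/-- Uniqueness of the decomposition makes the choice in the definition irrelevant. -/
theorem extCalc_eq (hω : 0 < ω) (hωφ : ω < φ) (hφ : φ ≤ Real.pi)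
    (hd : IsDecomposition φ f d) : extCalc R ω φ f = decompCalc R ω d := by
  have hE : MemE φ f := ⟨d, hd⟩
  rw [extCalc, dif_pos hE]
  obtain ⟨h1, h2⟩ := hE.choose_spec.unique (hω.trans hωφ) hd
  rw [decompCalc, decompCalc, h1, sectorCalc_congr hω hωφ hφ h2]

theorem IsDecomposition.congr (hd : IsDecomposition φ f d) (h : ∀ z ∈ sector φ, g z = f z) :
    IsDecomposition φ g d :=
  ⟨hd.1, fun z hz => (h z hz).trans (hd.2 z hz)⟩

theorem extCalc_congr (hω : 0 < ω) (hωφ : ω < φ) (hφ : φ ≤ Real.pi) (hf : MemE φ f)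
    (h : ∀ z ∈ sector φ, g z = f z) : extCalc R ω φ g = extCalc R ω φ f := by
  obtain ⟨d, hd⟩ := hf
  rw [extCalc_eq hω hωφ hφ hd, extCalc_eq hω hωφ hφ (hd.congr h)]

theorem memHInftyZero_zero : MemHInftyZero φ fun _ => 0 :=
  ⟨differentiableOn_const 0, ⟨0, by simp⟩, 1, 1, one_pos, one_pos, fun z _ => by
    rw [norm_zero]; positivity⟩

theorem MemHInftyZero.isDecomposition (hf : MemHInftyZero φ f) :
    IsDecomposition φ f (f, 0, 0) :=
  ⟨hf, by simp⟩

theorem MemHInftyZero.memE (hf : MemHInftyZero φ f) : MemE φ f :=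
  ⟨_, hf.isDecomposition⟩

theorem isDecomposition_inv_one_add : IsDecomposition φ (fun z => (1 + z)⁻¹)
    (fun _ => 0, 1, 0) :=
  ⟨memHInftyZero_zero, by simp⟩

theorem isDecomposition_const (c : ℂ) : IsDecomposition φ (fun _ => c) (fun _ => 0, 0, c) :=
  ⟨memHInftyZero_zero, by simp⟩

theorem isDecomposition_mul_inv_one_add (h0 : 0 < φ) (hπ : φ < Real.pi) :
    IsDecomposition φ (fun z => z * (1 + z)⁻¹) (fun _ => 0, -1, 1) := by
  obtain ⟨K, -, hK⟩ := exists_norm_inv_one_add_le h0 hπ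
  refine ⟨memHInftyZero_zero, fun z hz => ?_⟩
  have := (hK z hz).1
  simp only
  field_simp
  ring

theorem IsDecomposition.add (hd : IsDecomposition φ f d) (hd' : IsDecomposition φ g d') :
    IsDecomposition φ (fun z => f z + g z)
      (fun z => d.1 z + d'.1 z, d.2.1 + d'.2.1, d.2.2 + d'.2.2) :=
  ⟨hd.1.add hd'.1, fun z hz => by simp only [hd.2 z hz, hd'.2 z hz]; ring⟩

theorem MemE.add (hf : MemE φ f) (hg : MemE φ g) : MemE φ fun z => f z + g z :=
  let ⟨_, hd⟩ := hf
  let ⟨_, hd'⟩ := hg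
  ⟨_, hd.add hd'⟩

/-- The decomposition of a product. -/
def decompMul (d d' : (ℂ → ℂ) × ℂ × ℂ) : (ℂ → ℂ) × ℂ × ℂ :=
  (fun z => d.1 z * d'.1 z + (d'.2.1 * (d.1 z * (1 + z)⁻¹) + (d'.2.2 * d.1 z +
      (d.2.1 * (d'.1 z * (1 + z)⁻¹) + (d.2.2 * d'.1 z + -(d.2.1 * d'.2.1) * bump z)))),
    d.2.1 * d'.2.1 + d.2.1 * d'.2.2 + d.2.2 * d'.2.1, d.2.2 * d'.2.2)

theorem MemHInftyZero.mul_inv_one_add (h0 : 0 < φ) (hπ : φ < Real.pi)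
    (hf : MemHInftyZero φ f) : MemHInftyZero φ fun z => f z * (1 + z)⁻¹ := by
  obtain ⟨K, -, hK⟩ := exists_norm_inv_one_add_le h0 hπ
  exact hf.mul_bounded (differentiableOn_inv_one_add h0 hπ) fun z hz => (hK z hz).2.1

/-- The one product that needs rewriting is `(1 + z)⁻² = (1 + z)⁻¹ - bump z`, whence the last
summand of `decompMul`. -/
theorem IsDecomposition.mul (h0 : 0 < φ) (hπ : φ < Real.pi) (hd : IsDecomposition φ f d)
    (hd' : IsDecomposition φ g d') :
    IsDecomposition φ (fun z => f z * g z) (decompMul d d') := by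
  obtain ⟨K, -, hK⟩ := exists_norm_inv_one_add_le h0 hπ
  obtain ⟨B, hB⟩ := hd'.1.bounded
  refine ⟨(hd.1.mul_bounded hd'.1.1 hB).add (((hd.1.mul_inv_one_add h0 hπ).const_mul _).add
    ((hd.1.const_mul _).add (((hd'.1.mul_inv_one_add h0 hπ).const_mul _).add
      ((hd'.1.const_mul _).add ((memHInftyZero_bump h0 hπ).const_mul _))))), fun z hz => ?_⟩
  have := (hK z hz).1
  simp only [hd.2 z hz, hd'.2 z hz, decompMul, bump]
  field_simp
  ring

theorem MemE.mul (h0 : 0 < φ) (hπ : φ < Real.pi) (hf : MemE φ f) (hg : MemE φ g) :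
    MemE φ fun z => f z * g z :=
  let ⟨_, hd⟩ := hf
  let ⟨_, hd'⟩ := hg
  ⟨_, hd.mul h0 hπ hd'⟩

theorem MemE.bounded (h0 : 0 < φ) (hπ : φ < Real.pi) (hf : MemE φ f) :
    ∃ B : ℝ, ∀ z ∈ sector φ, ‖f z‖ ≤ B := by
  obtain ⟨d, hd⟩ := hf
  obtain ⟨K, -, hK⟩ := exists_norm_inv_one_add_le h0 hπ
  obtain ⟨B, hB⟩ := hd.1.bounded
  refine ⟨B + ‖d.2.1‖ * K + ‖d.2.2‖, fun z hz => ?_⟩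
  rw [hd.2 z hz]
  refine (norm_add_le _ _).trans (add_le_add_left ((norm_add_le _ _).trans
    (add_le_add (hB z hz) ?_)) _)
  rw [norm_mul]
  gcongr
  exact (hK z hz).2.1

theorem extCalc_const (hω : 0 < ω) (hωφ : ω < φ) (hφ : φ ≤ Real.pi) (c : ℂ) :
    extCalc R ω φ (fun _ => c) = c • ContinuousLinearMap.id ℂ X := by
  rw [extCalc_eq hω hωφ hφ (isDecomposition_const c)]
  simp [decompCalc, sectorCalc, calcKernel, veeInt, lineInt]

theorem extCalc_inv_one_add (hω : 0 < ω) (hωφ : ω < φ) (hφ : φ ≤ Real.pi) :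
    extCalc R ω φ (fun z => (1 + z)⁻¹) = -R (-1) := by
  rw [extCalc_eq hω hωφ hφ isDecomposition_inv_one_add]
  simp [decompCalc, sectorCalc, calcKernel, veeInt, lineInt]

theorem extCalc_mul_inv_one_add (hω : 0 < ω) (hωφ : ω < φ) (hφ : φ < Real.pi) :
    extCalc R ω φ (fun z => z * (1 + z)⁻¹) = ContinuousLinearMap.id ℂ X + R (-1) := by
  rw [extCalc_eq hω hωφ hφ.le (isDecomposition_mul_inv_one_add (hω.trans hωφ) hφ)]
  simp [decompCalc, sectorCalc, calcKernel, veeInt, lineInt, add_comm]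

namespace IsSectorialFamily

/-- The calculus on `𝓔(S_φ)` is bounded by a constant that depends on the family only through
its sectoriality constant. -/
theorem exists_norm_extCalc_le (hθ : 0 < θ) (hθω : θ < ω) (hωφ : ω < φ)
    (hφ : φ ≤ Real.pi) (M : ℝ) (f : ℂ → ℂ) : ∃ C : ℝ, 0 < C ∧ ∀ R : ℂ → X →L[ℂ] X,
      IsSectorialFamily R θ M → ‖extCalc R ω φ f‖ ≤ C := by
  by_cases hE : MemE φ f
  swap
  · exact ⟨1, one_pos, fun R _ => by simp [extCalc, hE]⟩
  obtain ⟨d, hd⟩ := hE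
  have hω : 0 < ω := hθ.trans hθω
  obtain ⟨C, s, hC, hs, hdec⟩ := hd.1.exists_exp_decay (hω.trans hωφ) hφ
  set C' : ℝ := ‖(2 * (Real.pi : ℂ) * Complex.I)⁻¹‖ *
      (2 * (M * C) * ∫ x : ℝ, Real.exp (-s * |x|)) + ‖d.2.1‖ * M + ‖d.2.2‖ with hC'
  refine ⟨max C' 1, by positivity, fun R h => le_trans ?_ (le_max_left _ _)⟩
  rw [extCalc_eq hω hωφ hφ hd, decompCalc, hC']
  refine (norm_add_le _ _).trans (add_le_add ((norm_add_le _ _).trans (add_le_add ?_ ?_)) ?_)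
  · rw [sectorCalc, norm_smul]
    gcongr
    refine norm_veeInt_le hs fun v hv => ?_
    rw [abs_of_pos hω] at hv
    exact h.norm_calcKernel_le
      (cos_lt_cos_of_lt_abs h.pos.le (by linarith) (by linarith))
      (hdec v (cos_lt_cos_of_abs_lt (by linarith) hφ))
  · rw [norm_smul, norm_neg]
    gcongr
    simpa using h.norm_le (neg_one_mem_outerSector h.pos h.lt_pi)
  · rw [norm_smul]
    exact mul_le_of_le_one_right (norm_nonneg _) ContinuousLinearMap.norm_id_le

variable [CompleteSpace X]

theorem extCalc_add (h : IsSectorialFamily R θ M) (hθω : θ < ω) (hωφ : ω < φ)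
    (hφ : φ ≤ Real.pi) (hf : MemE φ f) (hg : MemE φ g) :
    extCalc R ω φ (fun z => f z + g z) = extCalc R ω φ f + extCalc R ω φ g := by
  have hω : 0 < ω := h.pos.trans hθω
  obtain ⟨d, hd⟩ := hf
  obtain ⟨d', hd'⟩ := hg
  rw [extCalc_eq hω hωφ hφ hd, extCalc_eq hω hωφ hφ hd', extCalc_eq hω hωφ hφ (hd.add hd'),
    decompCalc, decompCalc, decompCalc, h.sectorCalc_add hθω hωφ hφ hd.1 hd'.1]
  simp only
  module

theorem resolvent_mul_sectorCalc (h : IsSectorialFamily R θ M) (hθω : θ < ω) (hωφ : ω < φ)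
    (hφ : φ ≤ Real.pi) (hf : MemHInftyZero φ f) {w : ℂ} (hw : w ∈ outerSector ω) :
    R w * sectorCalc R ω f = sectorCalc R ω f * R w := by
  have hω : 0 < ω := h.pos.trans hθω
  have iK := h.veeIntegrable_calcKernel hθω hωφ hφ hf
  have e1 := veeInt_clm ((ContinuousLinearMap.mul ℂ (X →L[ℂ] X)).flip (R w)) iK
  have e2 := veeInt_clm (ContinuousLinearMap.mul ℂ (X →L[ℂ] X) (R w)) iK
  simp only [ContinuousLinearMap.flip_apply, ContinuousLinearMap.mul_apply'] at e1 e2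
  rw [sectorCalc, smul_mul_assoc, mul_smul_comm, ← e1, ← e2]
  congr 1
  refine veeInt_congr fun v hv => ?_
  rw [abs_of_pos hω] at hv
  rw [calcKernel, smul_mul_assoc, mul_smul_comm, h.comm
    (exp_mem_outerSector (cos_lt_cos_of_lt_abs h.pos.le (by linarith) (by linarith)))
    (outerSector_mono h.pos.le hθω.le (by linarith) hw)]

/-- The calculus on `𝓔(S_φ)` is multiplicative. -/
theorem extCalc_mul (h : IsSectorialFamily R θ M) (hθω : θ < ω) (hωφ : ω < φ)
    (hφ : φ < Real.pi) (hf : MemE φ f) (hg : MemE φ g) :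
    extCalc R ω φ (fun z => f z * g z) = extCalc R ω φ f * extCalc R ω φ g := by
  have hω : 0 < ω := h.pos.trans hθω
  have h0 : 0 < φ := hω.trans hωφ
  obtain ⟨d, hd⟩ := hf
  obtain ⟨d', hd'⟩ := hg
  obtain ⟨B, hB⟩ := hd'.1.bounded
  have hm : (-1 : ℂ) ∈ outerSector ω := neg_one_mem_outerSector hω (by linarith)
  have hS : ∀ F : ℂ → ℂ, MemHInftyZero φ F →
      sectorCalc R ω (fun z => F z * (1 + z)⁻¹) = -(sectorCalc R ω F * R (-1)) := by
    intro F hF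
    rw [h.sectorCalc_mul_resolvent hθω hωφ hφ.le hF hm, ← neg_one_smul ℂ,
      ← sectorCalc_const_mul]
    refine sectorCalc_congr hω hωφ hφ.le fun z _ => ?_
    rw [show (-1 : ℂ) - z = -(1 + z) by ring, inv_neg]
    ring
  have m1 := hd.1.mul_bounded hd'.1.1 hB
  have m2 := (hd.1.mul_inv_one_add h0 hφ).const_mul d'.2.1
  have m3 := hd.1.const_mul d'.2.2
  have m4 := (hd'.1.mul_inv_one_add h0 hφ).const_mul d.2.1
  have m5 := hd'.1.const_mul d.2.2
  have m6 := (memHInftyZero_bump h0 hφ).const_mul (-(d.2.1 * d'.2.1))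
  rw [extCalc_eq hω hωφ hφ.le hd, extCalc_eq hω hωφ hφ.le hd',
    extCalc_eq hω hωφ hφ.le (hd.mul h0 hφ hd'), decompCalc, decompCalc, decompCalc]
  simp only [decompMul]
  rw [h.sectorCalc_add hθω hωφ hφ.le m1 (m2.add (m3.add (m4.add (m5.add m6)))),
    h.sectorCalc_add hθω hωφ hφ.le m2 (m3.add (m4.add (m5.add m6))),
    h.sectorCalc_add hθω hωφ hφ.le m3 (m4.add (m5.add m6)),
    h.sectorCalc_add hθω hωφ hφ.le m4 (m5.add m6), h.sectorCalc_add hθω hωφ hφ.le m5 m6]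
  simp only [sectorCalc_const_mul]
  -- `sectorCalc_bump` accounts for `(1 + A)⁻²`; what remains is bilinear expansion, with one
  -- commutation for the mixed term.
  rw [hS _ hd.1, hS _ hd'.1, ← h.sectorCalc_mul hθω hωφ hφ.le hd.1 hd'.1,
    h.sectorCalc_bump hθω (by linarith), ← h.resolvent_mul_sectorCalc hθω hωφ hφ.le hd'.1 hm]
  change _ = (_ + _ + d.2.2 • (1 : X →L[ℂ] X)) * (_ + _ + d'.2.2 • (1 : X →L[ℂ] X))
  change _ + (d.2.2 * d'.2.2) • (1 : X →L[ℂ] X) = _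
  simp only [add_mul, mul_add, smul_mul_assoc, mul_smul_comm, one_mul, mul_one, neg_mul, mul_neg,
    smul_neg]
  module

theorem resolvent_mul_extCalc (h : IsSectorialFamily R θ M) (hθω : θ < ω) (hωφ : ω < φ)
    (hφ : φ ≤ Real.pi) (hf : MemE φ f) {w : ℂ} (hw : w ∈ outerSector ω) :
    R w * extCalc R ω φ f = extCalc R ω φ f * R w := by
  have hω : 0 < ω := h.pos.trans hθω
  obtain ⟨d, hd⟩ := hf
  have e1 := h.resolvent_mul_sectorCalc hθω hωφ hφ hd.1 hw
  have e2 := h.comm (outerSector_mono h.pos.le hθω.le (by linarith) hw)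
    (neg_one_mem_outerSector h.pos h.lt_pi)
  rw [extCalc_eq hω hωφ hφ hd, decompCalc]
  change R w * (_ + _ + d.2.2 • (1 : X →L[ℂ] X)) = (_ + _ + d.2.2 • (1 : X →L[ℂ] X)) * R w
  simp only [mul_add, add_mul, e1, mul_smul_comm, smul_mul_assoc, mul_neg, neg_mul, e2, mul_one,
    one_mul]

/-- If `p(z) = z f(z)`, then `f(B) = (1 + B)⁻¹ (f(B) + p(B))`. -/
theorem extCalc_eq_neg_resolvent_mul (h : IsSectorialFamily R θ M) (hθω : θ < ω) (hωφ : ω < φ)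
    (hφ : φ < Real.pi) (hf : MemE φ f) (hg : MemE φ g) (hfg : ∀ z ∈ sector φ, g z = z * f z) :
    extCalc R ω φ f = -R (-1) * (extCalc R ω φ f + extCalc R ω φ g) := by
  have hω : 0 < ω := h.pos.trans hθω
  obtain ⟨K, -, hK⟩ := exists_norm_inv_one_add_le (hω.trans hωφ) hφ
  rw [← h.extCalc_add hθω hωφ hφ.le hf hg, ← extCalc_inv_one_add (R := R) hω hωφ hφ.le,
    ← h.extCalc_mul hθω hωφ hφ ⟨_, isDecomposition_inv_one_add⟩ (hf.add hg)]
  refine (extCalc_congr hω hωφ hφ.le hf fun z hz => ?_).symm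
  have := (hK z hz).1
  rw [hfg z hz]
  field_simp

/-- If `g(z) = z f(z)`, then `g(B) (1 + B)⁻¹ = f(B) (1 - (1 + B)⁻¹)`. -/
theorem extCalc_mul_resolvent (h : IsSectorialFamily R θ M) (hθω : θ < ω) (hωφ : ω < φ)
    (hφ : φ < Real.pi) (hf : MemE φ f) (hg : MemE φ g) (hfg : ∀ z ∈ sector φ, g z = z * f z) :
    extCalc R ω φ g * -R (-1) = extCalc R ω φ f * (ContinuousLinearMap.id ℂ X + R (-1)) := by
  have hω : 0 < ω := h.pos.trans hθω
  have hi := isDecomposition_mul_inv_one_add (hω.trans hωφ) hφ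
  rw [← extCalc_inv_one_add (R := R) hω hωφ hφ.le,
    ← extCalc_mul_inv_one_add (R := R) hω hωφ hφ,
    ← h.extCalc_mul hθω hωφ hφ hg ⟨_, isDecomposition_inv_one_add⟩,
    ← h.extCalc_mul hθω hωφ hφ hf ⟨_, hi⟩]
  refine extCalc_congr hω hωφ hφ.le (hf.mul (hω.trans hωφ) hφ ⟨_, hi⟩) fun z hz => ?_
  rw [hfg z hz]
  ring

end IsSectorialFamily

end ExtendedCalculus

/-! ### Dependence of `f(tA)` on `t` -/

section Dilation

variable {X : Type*} [NormedAddCommGroup X] [NormedSpace ℂ X]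
variable {R : ℂ → X →L[ℂ] X} {θ M ω φ : ℝ} {f g : ℂ → ℂ}

/-- The resolvent family of `tA`, in terms of that of `A`. -/
def dilate (R : ℂ → X →L[ℂ] X) (t : ℝ) (z : ℂ) : X →L[ℂ] X :=
  (t : ℂ)⁻¹ • R ((t : ℂ)⁻¹ * z)

theorem smul_mem_outerSector {r : ℝ} (hr : 0 < r) {z : ℂ} (hz : z ∈ outerSector θ) :
    (r : ℂ) * z ∈ outerSector θ := by
  have hz : z.re < Real.cos θ * ‖z‖ := hz
  have h1 : ((r : ℂ) * z).re = r * z.re := by simp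
  rw [outerSector, Set.mem_ofPred_eq, h1, norm_mul, Complex.norm_real, Real.norm_of_nonneg hr.le]
  nlinarith

theorem smul_mem_sector {r : ℝ} (hr : 0 < r) {z : ℂ} (hz : z ∈ sector φ) :
    (r : ℂ) * z ∈ sector φ := by
  refine ⟨mul_ne_zero (by exact_mod_cast hr.ne') hz.1, ?_⟩
  rw [Complex.arg_real_mul _ hr]
  exact hz.2

theorem IsSectorialFamily.dilated (h : IsSectorialFamily R θ M) {t : ℝ} (ht : 0 < t) :
    IsSectorialFamily (dilate R t) θ M := by
  have ht0 : (t : ℂ) ≠ 0 := by exact_mod_cast ht.ne'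
  have hm : ∀ z ∈ outerSector θ, (t : ℂ)⁻¹ * z ∈ outerSector θ := fun z hz => by
    rw [← Complex.ofReal_inv]
    exact smul_mem_outerSector (inv_pos.2 ht) hz
  refine ⟨h.pos, h.lt_pi, fun z hz => ?_, fun z hz w hw => ?_⟩
  · rw [dilate, smul_smul, mul_comm z]
    exact h.bound _ (hm z hz)
  · rw [dilate, dilate, ← smul_sub, h.ident _ (hm z hz) _ (hm w hw),
      smul_mul_assoc, mul_smul_comm, smul_smul, smul_smul, smul_smul]
    congr 1
    ring

theorem lineInt_comp_add {E : Type*} [NormedAddCommGroup E] [NormedSpace ℂ E] (F : ℂ → E)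
    (y τ : ℝ) : lineInt (fun v => F (v + τ)) y = lineInt F y := by
  rw [lineInt, lineInt, ← integral_add_right_eq_self (fun x : ℝ => F (x + y * Complex.I)) τ]
  refine integral_congr_ae (ae_of_all _ fun x => ?_)
  simp only
  congr 1
  push_cast
  ring

/-- Dilation is translation by `log t` along the contour, so `t` can be moved from the resolvent to
`f`. -/
theorem sectorCalc_dilate {t : ℝ} (ht : 0 < t) :
    sectorCalc (dilate R t) ω f = sectorCalc R ω fun z => f (t * z) := by
  have he : Complex.exp (Real.log t : ℝ) = t := by
    rw [← Complex.ofReal_exp, Real.exp_log ht]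
  have ht0 : (t : ℂ) ≠ 0 := by exact_mod_cast ht.ne'
  have hk : ∀ v : ℂ, calcKernel (dilate R t) f (v + (Real.log t : ℝ)) =
      calcKernel R (fun z => f (t * z)) v := by
    intro v
    rw [calcKernel, calcKernel, Complex.exp_add, he, dilate, smul_smul,
      mul_comm (Complex.exp v) (t : ℂ), inv_mul_cancel_left₀ ht0]
    congr 1
    field_simp
  rw [sectorCalc, sectorCalc, veeInt, veeInt, ← lineInt_comp_add _ _ (Real.log t),
    ← lineInt_comp_add _ ω (Real.log t)]
  simp only [hk]

/-- Dominated convergence: the dilated families share the constant `M`, so the majorant does not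
depend on `t`. -/
theorem IsSectorialFamily.continuousOn_sectorCalc_dilate (h : IsSectorialFamily R θ M)
    (hθω : θ < ω) (hωφ : ω < φ) (hφ : φ ≤ Real.pi) (hf : MemHInftyZero φ f) :
    ContinuousOn (fun t : ℝ => sectorCalc (dilate R t) ω f) (Set.Ioi 0) := by
  have hω : 0 < ω := h.pos.trans hθω
  have hφ0 : 0 < φ := hω.trans hωφ
  obtain ⟨C, s, hC, hs, hd⟩ := hf.exists_exp_decay hφ0 hφ
  have line : ∀ y : ℝ, |y| = ω → ContinuousOn
      (fun t : ℝ => lineInt (calcKernel (dilate R t) f) y) (Set.Ioi 0) := by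
    intro y hy
    have hy1 : Real.cos φ < Real.cos y := cos_lt_cos_of_abs_lt (by linarith) hφ
    have hy2 : Real.cos y < Real.cos θ :=
      cos_lt_cos_of_lt_abs h.pos.le (by linarith) (by linarith)
    have him : ∀ x : ℝ, ((x : ℂ) + y * Complex.I).im = y := fun x => by simp
    refine continuousOn_of_dominated (bound := fun x : ℝ => M * C * Real.exp (-s * |x|))
      (fun t ht => ?_) (fun t ht => ae_of_all _ fun x => ?_)
      ((integrable_exp_neg_mul_abs hs).const_mul _) (ae_of_all _ fun x => ?_)
    · refine (continuous_iff_continuousAt.2 fun x => ?_).aestronglyMeasurable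
      exact ((h.dilated ht).differentiableAt_calcKernel (by rw [him x]; exact hy2)
        (hf.differentiableAt_exp hφ0 hφ (by rw [him x]; exact hy1))).continuousAt.comp
        (f := fun x : ℝ => (x : ℂ) + y * Complex.I) (by fun_prop)
    · have := (h.dilated ht).norm_calcKernel_le (by rw [him x]; exact hy2)
        (hd _ (by rw [him x]; exact hy1))
      rwa [show ((x : ℂ) + y * Complex.I).re = x by simp] at this
    · intro t ht
      have ht0 : (t : ℂ) ≠ 0 := by exact_mod_cast (ne_of_gt ht)
      have hz : (t : ℂ)⁻¹ * Complex.exp (x + y * Complex.I) ∈ outerSector θ := by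
        rw [← Complex.ofReal_inv]
        exact smul_mem_outerSector (inv_pos.2 ht)
          (exp_mem_outerSector (by rw [him x]; exact hy2))
      have c1 : ContinuousAt (fun t : ℝ => (t : ℂ)⁻¹) t :=
        ContinuousAt.inv₀ (by fun_prop) ht0
      refine ContinuousAt.continuousWithinAt ?_
      simp only [calcKernel, dilate]
      have c2 : ContinuousAt (fun t : ℝ => R ((t : ℂ)⁻¹ * Complex.exp (x + y * Complex.I))) t :=
        ContinuousAt.comp (g := R) (h.continuousAt hz) (c1.mul continuousAt_const)
      have c3 : ContinuousAt (fun t : ℝ => (t : ℂ)⁻¹ •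
          R ((t : ℂ)⁻¹ * Complex.exp (x + y * Complex.I))) t := c1.smul c2
      exact c3.const_smul (Complex.exp (x + y * Complex.I) * f (Complex.exp (x + y * Complex.I)))
  have l1 := line (-ω) (by rw [abs_neg, abs_of_pos hω])
  have l2 := line ω (abs_of_pos hω)
  simp only [sectorCalc, veeInt]
  fun_prop

theorem IsSectorialFamily.continuousOn_extCalc_dilate (h : IsSectorialFamily R θ M)
    (hθω : θ < ω) (hωφ : ω < φ) (hφ : φ ≤ Real.pi) (hf : MemE φ f) :
    ContinuousOn (fun t : ℝ => extCalc (dilate R t) ω φ f) (Set.Ioi 0) := by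
  have hω : 0 < ω := h.pos.trans hθω
  obtain ⟨d, hd⟩ := hf
  simp only [extCalc_eq hω hωφ hφ hd, decompCalc]
  have c0 := h.continuousOn_sectorCalc_dilate hθω hωφ hφ hd.1
  suffices ContinuousOn (fun t : ℝ => dilate R t (-1)) (Set.Ioi 0) by fun_prop
  intro t ht
  have ht0 : (t : ℂ) ≠ 0 := by exact_mod_cast (ne_of_gt ht)
  have hz : (t : ℂ)⁻¹ * -1 ∈ outerSector θ := by
    rw [← Complex.ofReal_inv]
    exact smul_mem_outerSector (inv_pos.2 ht) (neg_one_mem_outerSector h.pos h.lt_pi)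
  have c1 : ContinuousAt (fun t : ℝ => (t : ℂ)⁻¹) t := ContinuousAt.inv₀ (by fun_prop) ht0
  have c2 : ContinuousAt (fun t : ℝ => R ((t : ℂ)⁻¹ * -1)) t :=
    ContinuousAt.comp (g := R) (h.continuousAt hz) (c1.mul continuousAt_const)
  exact (c1.smul c2).continuousWithinAt

/-- Differentiation of the Dunford-Riesz integral along dilations. -/
theorem IsSectorialFamily.hasDerivAt_sectorCalc_dilate [CompleteSpace X]
    (h : IsSectorialFamily R θ M) (hθω : θ < ω) (hωφ : ω < φ) (hφ : φ ≤ Real.pi)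
    (hf : MemHInftyZero φ f) (hg : MemHInftyZero φ g)
    (hfg : ∀ z ∈ sector φ, ∀ τ : ℝ, HasDerivAt (fun τ : ℝ => f (Real.exp τ * z))
      (g (Real.exp τ * z)) τ) (τ₀ : ℝ) :
    HasDerivAt (fun τ : ℝ => sectorCalc (dilate R (Real.exp τ)) ω f)
      (sectorCalc (dilate R (Real.exp τ₀)) ω g) τ₀ := by
  have hω : 0 < ω := h.pos.trans hθω
  have hφ0 : 0 < φ := hω.trans hωφ
  obtain ⟨C, s, hC, hs, hd⟩ := hf.exists_exp_decay hφ0 hφ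
  obtain ⟨C', s', hC', hs', hd'⟩ := hg.exists_exp_decay hφ0 hφ
  have hmul : ∀ (τ : ℝ) (v : ℂ), (Real.exp τ : ℂ) * Complex.exp v = Complex.exp (v + τ) := by
    intro τ v
    rw [Complex.exp_add, Complex.ofReal_exp, mul_comm]
  have line : ∀ y : ℝ, |y| = ω → HasDerivAt
      (fun τ : ℝ => lineInt (calcKernel R fun z => f (Real.exp τ * z)) y)
      (lineInt (calcKernel R fun z => g (Real.exp τ₀ * z)) y) τ₀ := by
    intro y hy
    have hy1 : Real.cos φ < Real.cos y := cos_lt_cos_of_abs_lt (by linarith) hφ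
    have hy2 : Real.cos y < Real.cos θ :=
      cos_lt_cos_of_lt_abs h.pos.le (by linarith) (by linarith)
    have him : ∀ x : ℝ, ((x : ℂ) + y * Complex.I).im = y := fun x => by simp
    have himτ : ∀ x τ : ℝ, ((x : ℂ) + y * Complex.I + τ).im = y := fun x => by simp
    have hreτ : ∀ x τ : ℝ, ((x : ℂ) + y * Complex.I + τ).re = x + τ := fun x => by simp
    have hcont : ∀ F : ℂ → ℂ, MemHInftyZero φ F → ∀ τ : ℝ,
        Continuous fun x : ℝ => calcKernel R (fun z => F (Real.exp τ * z))
          (x + y * Complex.I) := by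
      intro F hF τ
      refine continuous_iff_continuousAt.2 fun x => ?_
      have h1 : DifferentiableAt ℂ (fun v => F (Real.exp τ * Complex.exp v))
          (x + y * Complex.I) := by
        simp only [hmul]
        exact DifferentiableAt.comp (g := fun v => F (Complex.exp v)) _
          (hF.differentiableAt_exp hφ0 hφ (by rw [himτ]; exact hy1))
          (differentiableAt_id.add_const _)
      exact (h.differentiableAt_calcKernel (f := fun z => F (Real.exp τ * z))
        (by rw [him x]; exact hy2) h1).continuousAt.comp
        (f := fun x : ℝ => (x : ℂ) + y * Complex.I) (by fun_prop)
    -- For `τ` within distance `1` of `τ₀`, translating an exponentially decaying function by `τ`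
    -- costs at most the factor `exp(s(|τ₀| + 1))`.
    have hbd : ∀ (F : ℂ → ℂ) (C s : ℝ), 0 < C → 0 < s → (∀ v : ℂ, Real.cos φ < Real.cos v.im →
        ‖F (Complex.exp v)‖ ≤ C * Real.exp (-s * |v.re|)) → ∀ τ ∈ Metric.ball τ₀ 1, ∀ x : ℝ,
        ‖calcKernel R (fun z => F (Real.exp τ * z)) (x + y * Complex.I)‖ ≤
          M * (C * Real.exp (s * (|τ₀| + 1))) * Real.exp (-s * |x|) := by
      intro F C s hC hs hF τ hτ x
      have h2 := hF (x + y * Complex.I + τ) (by rw [himτ]; exact hy1)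
      rw [← hmul, hreτ] at h2
      have h3 : |x| - (|τ₀| + 1) ≤ |x + τ| := by
        have e1 : |x| ≤ |x + τ| + |τ| := by
          have := abs_sub (x + τ) τ
          rwa [add_sub_cancel_right] at this
        have e2 : |τ| ≤ |τ₀| + 1 := by
          rw [Metric.mem_ball, Real.dist_eq] at hτ
          have := abs_add_le τ₀ (τ - τ₀)
          rw [add_sub_cancel] at this
          linarith
        linarith
      have h4 : Real.exp (-s * |x + τ|) ≤ Real.exp (s * (|τ₀| + 1)) * Real.exp (-s * |x|) := by
        rw [← Real.exp_add]
        gcongr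
        nlinarith
      refine (h.norm_exp_smul_le (by rw [him x]; exact hy2) _).trans ?_
      rw [mul_assoc M, mul_assoc C]
      exact mul_le_mul_of_nonneg_left
        (h2.trans (mul_le_mul_of_nonneg_left h4 hC.le)) h.nonneg
    refine (hasDerivAt_integral_of_dominated_loc_of_deriv_le (𝕜 := ℝ)
      (F := fun (τ x : ℝ) => calcKernel R (fun z => f (Real.exp τ * z)) (x + y * Complex.I))
      (F' := fun (τ x : ℝ) => calcKernel R (fun z => g (Real.exp τ * z)) (x + y * Complex.I))
      (bound := fun x : ℝ => M * (C' * Real.exp (s' * (|τ₀| + 1))) * Real.exp (-s' * |x|))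
      (Metric.ball_mem_nhds τ₀ one_pos)
      (Eventually.of_forall fun τ => (hcont f hf τ).aestronglyMeasurable) ?_
      (hcont g hg τ₀).aestronglyMeasurable
      (ae_of_all _ fun x τ hτ => hbd g C' s' hC' hs' hd' τ hτ x)
      ((integrable_exp_neg_mul_abs hs').const_mul _)
      (ae_of_all _ fun x τ _ => ?_)).2
    · exact ((integrable_exp_neg_mul_abs hs).const_mul _).mono'
        (hcont f hf τ₀).aestronglyMeasurable
        (ae_of_all _ fun x => hbd f C s hC hs hd τ₀ (Metric.mem_ball_self one_pos) x)
    · have h1 := hfg _ (exp_mem_sector hφ0 hφ (v := x + y * Complex.I)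
        (by rw [him x]; exact hy1)) τ
      have h2 := (h1.const_mul (Complex.exp (x + y * Complex.I))).smul_const
        (R (Complex.exp (x + y * Complex.I)))
      exact h2
  have e : (fun τ : ℝ => sectorCalc (dilate R (Real.exp τ)) ω f) = fun τ : ℝ =>
      sectorCalc R ω fun z => f (Real.exp τ * z) :=
    funext fun τ => sectorCalc_dilate (Real.exp_pos τ)
  rw [e, sectorCalc_dilate (Real.exp_pos τ₀)]
  simp only [sectorCalc, veeInt]
  exact ((line _ (by rw [abs_neg, abs_of_pos hω])).fun_sub (line _ (abs_of_pos hω))).fun_const_smul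
    (2 * (Real.pi : ℂ) * Complex.I)⁻¹

end Dilation

/-! ### From resolvent families to sectorial operators -/

section SectorialOperators

variable {X : Type*} [NormedAddCommGroup X] [NormedSpace ℂ X] {A : X →ₗ.[ℂ] X}
variable {R : ℂ → X →L[ℂ] X} {θ M ω φ : ℝ} {f g : ℂ → ℂ}

/-- With `B = exp(τ)A` this is the derivative of `-(1 + B)⁻¹`, namely `B(1 + B)⁻²`; by
`sectorCalc_bump` it is the operator attached to `bump`. -/
theorem IsSectorialFamily.hasDerivAt_dilate_neg_one (h : IsSectorialFamily R θ M) (τ₀ : ℝ) :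
    HasDerivAt (fun τ : ℝ => dilate R (Real.exp τ) (-1))
      (-(dilate R (Real.exp τ₀) (-1) +
        dilate R (Real.exp τ₀) (-1) * dilate R (Real.exp τ₀) (-1))) τ₀ := by
  have h0 : ((Real.exp τ₀ : ℝ) : ℂ) ≠ 0 := by exact_mod_cast (Real.exp_pos τ₀).ne'
  have c1 : HasDerivAt (fun τ : ℝ => ((Real.exp τ : ℝ) : ℂ)⁻¹)
      (-((Real.exp τ₀ : ℝ) : ℂ)⁻¹) τ₀ := by
    have := (Real.hasDerivAt_exp τ₀).ofReal_comp.fun_inv h0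
    convert! this using 1
    field_simp
  have hz : ((Real.exp τ₀ : ℝ) : ℂ)⁻¹ * -1 ∈ outerSector θ := by
    rw [← Complex.ofReal_inv]
    exact smul_mem_outerSector (inv_pos.2 (Real.exp_pos τ₀))
      (neg_one_mem_outerSector h.pos h.lt_pi)
  have c2 := HasDerivAt.scomp τ₀ (h.hasDerivAt hz) (c1.mul_const (-1))
  have c3 := c1.smul c2
  convert! c3 using 1
  simp only [dilate, smul_mul_assoc, mul_smul_comm, Function.comp_apply]
  module

theorem IsSectorialFamily.hasDerivAt_extCalc_dilate [CompleteSpace X]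
    (h : IsSectorialFamily R θ M) (hθω : θ < ω) (hωφ : ω < φ) (hφ : φ < Real.pi)
    (hf : MemE φ f) (hg : MemHInftyZero φ g)
    (hfg : ∀ z ∈ sector φ, ∀ τ : ℝ, HasDerivAt (fun τ : ℝ => f (Real.exp τ * z))
      (g (Real.exp τ * z)) τ) (τ₀ : ℝ) :
    HasDerivAt (fun τ : ℝ => extCalc (dilate R (Real.exp τ)) ω φ f)
      (extCalc (dilate R (Real.exp τ₀)) ω φ g) τ₀ := by
  have hω : 0 < ω := h.pos.trans hθω
  have hφ0 : 0 < φ := hω.trans hωφ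
  obtain ⟨d, hd⟩ := hf
  obtain ⟨K, -, hK⟩ := exists_norm_inv_one_add_le hφ0 hφ
  -- Subtracting `l(1 + z)⁻¹` from `f` adds `l bump` to the logarithmic derivative. The resolvent
  -- term of the calculus contributes the opposite operator, so only `g` remains.
  have hq := (memHInftyZero_bump hφ0 hφ).const_mul d.2.1
  have hd0 : ∀ z ∈ sector φ, ∀ τ : ℝ, HasDerivAt (fun τ : ℝ => d.1 (Real.exp τ * z))
      (g (Real.exp τ * z) + d.2.1 * bump (Real.exp τ * z)) τ := by
    intro z hz τ
    have e : (fun τ : ℝ => d.1 (Real.exp τ * z)) = fun τ : ℝ =>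
        f (Real.exp τ * z) - d.2.1 * (1 + Real.exp τ * z)⁻¹ - d.2.2 := by
      ext τ
      rw [hd.2 _ (smul_mem_sector (Real.exp_pos τ) hz)]
      ring
    have hne := (hK _ (smul_mem_sector (Real.exp_pos τ) hz)).1
    have h1 := (((Real.hasDerivAt_exp τ).ofReal_comp.mul_const z).const_add 1).fun_inv hne
    have h2 := ((hfg z hz τ).fun_sub (h1.const_mul d.2.1)).sub_const d.2.2
    rw [e]
    convert! h2 using 1
    rw [bump]
    field_simp
    ring
  have hT := h.hasDerivAt_sectorCalc_dilate hθω hωφ hφ.le hd.1 (hg.add hq) hd0 τ₀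
  have hR := h.hasDerivAt_dilate_neg_one τ₀
  have hE := (hT.fun_add (hR.fun_neg.fun_const_smul d.2.1)).add_const
    (d.2.2 • ContinuousLinearMap.id ℂ X)
  simp only [extCalc_eq hω hωφ hφ.le hd, extCalc_eq hω hωφ hφ.le hg.isDecomposition, decompCalc]
  convert! hE using 1
  have hD := h.dilated (Real.exp_pos τ₀)
  rw [hD.sectorCalc_add hθω hωφ hφ.le hg hq, sectorCalc_const_mul,
    hD.sectorCalc_bump hθω (by linarith)]
  module

theorem contourIntegral_eq_sectorCalc (A : X →ₗ.[ℂ] X) (ω : ℝ) (f : ℂ → ℂ) :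
    contourIntegral A ω f = sectorCalc (resolventOf A) ω f := by
  have key : ∀ y : ℝ, (∫ r in Set.Ioi (0 : ℝ), (Complex.exp ((y : ℂ) * Complex.I) *
      f (r * Complex.exp ((y : ℂ) * Complex.I))) •
        resolventOf A (r * Complex.exp ((y : ℂ) * Complex.I))) =
      lineInt (calcKernel (resolventOf A) f) y := by
    intro y
    rw [integral_Ioi_eq_integral_exp, lineInt]
    refine integral_congr_ae (ae_of_all _ fun x => ?_)
    simp only [calcKernel]
    rw [Complex.exp_add, ← Complex.ofReal_exp, mul_assoc, mul_smul (Real.exp x : ℂ),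
      Complex.coe_smul]
  rw [contourIntegral, sectorCalc, veeInt, ← key, ← key]
  push_cast
  rfl

theorem primaryCalculus_eq_extCalc (A : X →ₗ.[ℂ] X) (φ : ℝ) (f : ℂ → ℂ) :
    primaryCalculus A φ f = extCalc (resolventOf A) ((sectorialityAngle A + φ) / 2) φ f := by
  unfold primaryCalculus extCalc
  split_ifs
  · rw [decompCalc, hInftyZeroCalculus, contourIntegral_eq_sectorCalc]
  · rfl

theorem isResolventAt_resolventOf {z : ℂ} (hz : z ∈ resolventSetOf A) :
    IsResolventAt A z (resolventOf A z) := by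
  have hz : ∃ R : X →L[ℂ] X, IsResolventAt A z R := hz
  rw [resolventOf, dif_pos hz]
  exact hz.choose_spec

theorem IsResolventAt.sub_eq {z w : ℂ} {Rz Rw : X →L[ℂ] X} (hz : IsResolventAt A z Rz)
    (hw : IsResolventAt A w Rw) : Rz - Rw = (w - z) • (Rz * Rw) := by
  ext x
  obtain ⟨hd, hx⟩ := hw.1 x
  have h1 := hz.2 ⟨Rw x, hd⟩
  simp only at h1
  have h2 : x = (z • Rw x - A ⟨Rw x, hd⟩) + (w - z) • Rw x := by
    conv_lhs => rw [← hx]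
    module
  have h3 := congrArg Rz h2
  rw [map_add, h1, map_smul] at h3
  simp only [sub_apply, smul_apply,
    mul_apply_eq_comp]
  rw [h3]
  abel

theorem IsResolventAt.smul {t : ℝ} (ht : t ≠ 0) {z : ℂ} {R : X →L[ℂ] X}
    (h : IsResolventAt A z R) :
    IsResolventAt ((t : ℂ) • A) ((t : ℂ) * z) ((t : ℂ)⁻¹ • R) := by
  have ht0 : (t : ℂ) ≠ 0 := by exact_mod_cast ht
  refine ⟨fun x => ?_, fun y => ?_⟩
  · obtain ⟨hd, hx⟩ := h.1 x
    have hd' : ((t : ℂ)⁻¹ • R) x ∈ ((t : ℂ) • A).domain := A.domain.smul_mem _ hd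
    refine ⟨hd', ?_⟩
    have e : (⟨((t : ℂ)⁻¹ • R) x, hd'⟩ : A.domain) = (t : ℂ)⁻¹ • ⟨R x, hd⟩ := rfl
    rw [LinearPMap.smul_apply]
    erw [e]
    rw [LinearPMap.map_smul, smul_inv_smul₀ ht0, smul_apply, smul_smul,
      mul_right_comm, mul_inv_cancel₀ ht0, one_mul, hx]
  · have := h.2 y
    rw [LinearPMap.smul_apply, mul_smul, ← smul_sub, smul_apply, map_smul,
      inv_smul_smul₀ ht0]
    exact this

/-- No condition on `z` is needed: off the resolvent set both sides take the default value `0`. -/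
theorem resolventOf_smul {t : ℝ} (ht : t ≠ 0) (z : ℂ) :
    resolventOf ((t : ℂ) • A) z = dilate (resolventOf A) t z := by
  have ht0 : (t : ℂ) ≠ 0 := by exact_mod_cast ht
  by_cases hz : (t : ℂ)⁻¹ * z ∈ resolventSetOf A
  · have h1 := (isResolventAt_resolventOf hz).smul ht
    rw [mul_inv_cancel_left₀ ht0] at h1
    exact (isResolventAt_resolventOf ⟨_, h1⟩).unique h1
  · have hz' : ¬ ∃ R : X →L[ℂ] X, IsResolventAt ((t : ℂ) • A) z R := by
      rintro ⟨R, hR⟩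
      have h1 := hR.smul (inv_ne_zero ht)
      rw [Complex.ofReal_inv, smul_smul, inv_mul_cancel₀ ht0, one_smul] at h1
      exact hz ⟨_, h1⟩
    rw [resolventOf, dif_neg hz', dilate, resolventOf, dif_neg (by exact hz), smul_zero]

theorem IsSectorialOfAngle.smul {t : ℝ} (ht : 0 < t) (h : IsSectorialOfAngle A φ) :
    IsSectorialOfAngle ((t : ℂ) • A) φ := by
  have ht0 : (t : ℂ) ≠ 0 := by exact_mod_cast ht.ne'
  obtain ⟨h1, h2, h3⟩ := h
  refine ⟨h1, fun z hz => ?_, fun φ' hφ' hπ => ?_⟩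
  · have hz' : (t : ℂ)⁻¹ * z ∈ spectrumOf A := by
      intro hr
      refine hz ⟨(t : ℂ)⁻¹ • resolventOf A ((t : ℂ)⁻¹ * z), ?_⟩
      have := (isResolventAt_resolventOf hr).smul ht.ne'
      rwa [mul_inv_cancel_left₀ ht0] at this
    have h4 := map_mem_closure (f := fun w : ℂ => (t : ℂ) * w) (by fun_prop) (h2 hz')
      (t := sector φ) fun w hw => smul_mem_sector ht hw
    simpa only [mul_inv_cancel_left₀ ht0] using h4
  · obtain ⟨C, hC⟩ := h3 φ' hφ' hπ
    refine ⟨C, fun z hz0 hz => ?_⟩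
    rw [resolventOf_smul ht.ne', dilate, smul_smul, mul_comm z]
    refine hC _ (mul_ne_zero (inv_ne_zero ht0) hz0) fun hs => hz ?_
    have := smul_mem_sector ht hs
    rwa [mul_inv_cancel_left₀ ht0] at this

/-- The contour of `primaryCalculus` is determined by this angle and `φ`, so all `tA` use the same
contour. -/
theorem sectorialityAngle_smul {t : ℝ} (ht : 0 < t) :
    sectorialityAngle ((t : ℂ) • A) = sectorialityAngle A := by
  have ht0 : (t : ℂ) ≠ 0 := by exact_mod_cast ht.ne'
  rw [sectorialityAngle, sectorialityAngle]
  congr 1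
  ext φ
  refine ⟨fun h => ?_, fun h => h.smul ht⟩
  have := IsSectorialOfAngle.smul (inv_pos.2 ht) h
  rwa [Complex.ofReal_inv, smul_smul, inv_mul_cancel₀ ht0, one_smul] at this

theorem primaryCalculus_smul {t : ℝ} (ht : 0 < t) (φ : ℝ) (f : ℂ → ℂ) :
    primaryCalculus ((t : ℂ) • A) φ f =
      extCalc (dilate (resolventOf A) t) ((sectorialityAngle A + φ) / 2) φ f := by
  rw [primaryCalculus_eq_extCalc, sectorialityAngle_smul ht]
  congr 1
  exact funext fun z => resolventOf_smul ht.ne' z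

theorem mem_resolventSetOf_of_outerSector {φ' : ℝ} (hA : IsSectorialOfAngle A φ') (h : φ' < θ)
    (hθ : θ < Real.pi) {z : ℂ} (hz : z ∈ outerSector θ) : z ∈ resolventSetOf A := by
  by_contra hn
  have h1 := hA.2.1 hn
  have hcl : closure (sector φ') ⊆ {z | Real.cos φ' * ‖z‖ ≤ z.re} :=
    closure_minimal (fun z hz => ((mem_sector_iff hA.1.1 hA.1.2.le).1 hz).le)
      (isClosed_le (by fun_prop) Complex.continuous_re)
  have h2 : Real.cos φ' * ‖z‖ ≤ z.re := hcl h1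
  have h3 : z ∈ outerSector φ' := outerSector_mono hA.1.1.le h.le hθ.le hz
  exact absurd h2 (not_le.2 h3)

/-- The contour is fixed at the midpoint angle. Since `φ_A` is an infimum, some admissible angle
lies below it, and `θ` is placed strictly between the two. -/
theorem IsSectorial.exists_family (hA : IsSectorial A) (hφ : sectorialityAngle A < φ)
    (hπ : φ < Real.pi) : ∃ θ M : ℝ, IsSectorialFamily (resolventOf A) θ M ∧
      θ < (sectorialityAngle A + φ) / 2 ∧ (sectorialityAngle A + φ) / 2 < φ ∧
      ∀ z ∈ outerSector θ, z ∈ resolventSetOf A := by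
  obtain ⟨φ', hφ', hlt⟩ := exists_lt_of_csInf_lt (s := {φ : ℝ | IsSectorialOfAngle A φ}) hA
    (b := (sectorialityAngle A + φ) / 2) (by rw [← sectorialityAngle]; linarith)
  have hφ' : IsSectorialOfAngle A φ' := hφ'
  obtain ⟨θ, h1, h2⟩ := exists_between hlt
  have hθπ : θ < Real.pi := by linarith
  have hres : ∀ z ∈ outerSector θ, z ∈ resolventSetOf A := fun z hz =>
    mem_resolventSetOf_of_outerSector hφ' h1 hθπ hz
  obtain ⟨C, hC⟩ := hφ'.2.2 θ h1 hθπ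
  have hθ0 : 0 < θ := hφ'.1.1.trans h1
  refine ⟨θ, C, ⟨hθ0, hθπ, fun z hz => hC z (ne_zero_of_mem_outerSector hz) fun hs => ?_,
    fun z hz w hw => (isResolventAt_resolventOf (hres z hz)).sub_eq
      (isResolventAt_resolventOf (hres w hw))⟩, h2, by linarith, hres⟩
  exact lt_asymm ((mem_sector_iff hθ0 hθπ.le).1 hs) hz

/-- Data describing a sectorial operator together with contours for the calculus on `S_φ`. -/
structure HasCalculus (A : X →ₗ.[ℂ] X) (θ M ω φ : ℝ) : Prop where
  family : IsSectorialFamily (resolventOf A) θ M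
  lt_contour : θ < ω
  contour_lt : ω < φ
  lt_pi : φ < Real.pi
  res : ∀ z ∈ outerSector θ, z ∈ resolventSetOf A
  eq : ω = (sectorialityAngle A + φ) / 2

theorem IsSectorial.exists_hasCalculus (hA : IsSectorial A) (hφ : sectorialityAngle A < φ)
    (hπ : φ < Real.pi) : ∃ θ M ω : ℝ, HasCalculus A θ M ω φ := by
  obtain ⟨θ, M, h1, h2, h3, h4⟩ := hA.exists_family hφ hπ
  exact ⟨θ, M, _, h1, h2, h3, hπ, h4, rfl⟩

namespace HasCalculus

theorem contour_pos (h : HasCalculus A θ M ω φ) : 0 < ω := h.family.pos.trans h.lt_contour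

theorem angle_pos (h : HasCalculus A θ M ω φ) : 0 < φ := h.contour_pos.trans h.contour_lt

theorem calculus_eq (h : HasCalculus A θ M ω φ) {t : ℝ} (ht : 0 < t) (f : ℂ → ℂ) : primaryCalculus
    ((t : ℂ) • A) φ f =
    extCalc (dilate (resolventOf A) t) ω φ f := by
  rw [primaryCalculus_smul ht, h.eq]

theorem exists_norm_calculus_le (h : HasCalculus A θ M ω φ)
    (f : ℂ → ℂ) : ∃ C : ℝ, 0 < C ∧ ∀ t : ℝ, 0 < t →
    ‖primaryCalculus ((t : ℂ) • A) φ f‖ ≤ C := by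
  obtain ⟨C, hC, hb⟩ := IsSectorialFamily.exists_norm_extCalc_le (X := X) h.family.pos
    h.lt_contour h.contour_lt h.lt_pi.le M f
  refine ⟨C, hC, fun t ht => ?_⟩
  rw [h.calculus_eq ht]
  exact hb _ (h.family.dilated ht)

theorem continuousOn_calculus (h : HasCalculus A θ M ω φ) (hf : MemE φ f) :
    ContinuousOn (fun t : ℝ => primaryCalculus ((t : ℂ) • A) φ f) (Set.Ioi 0) :=
  (h.family.continuousOn_extCalc_dilate h.lt_contour h.contour_lt h.lt_pi.le hf).congr
    fun _ ht => h.calculus_eq ht f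

/-- `-R(-1, tA)` is the inverse of `1 + tA`. -/
theorem isResolventAt_dilate (h : HasCalculus A θ M ω φ) {t : ℝ} (ht : 0 < t) :
    IsResolventAt ((t : ℂ) • A) (-1) (dilate (resolventOf A) t (-1)) := by
  have ht0 : (t : ℂ) ≠ 0 := by exact_mod_cast ht.ne'
  have hm : (t : ℂ)⁻¹ * -1 ∈ outerSector θ := by
    rw [← Complex.ofReal_inv]
    exact smul_mem_outerSector (inv_pos.2 ht) (neg_one_mem_outerSector h.family.pos h.family.lt_pi)
  have := (isResolventAt_resolventOf (h.res _ hm)).smul ht.ne'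
  rwa [mul_inv_cancel_left₀ ht0] at this

theorem resolvent_mem (h : HasCalculus A θ M ω φ) {t : ℝ} (ht : 0 < t) (y : X) :
    ∃ hd : -dilate (resolventOf A) t (-1) y ∈ A.domain,
      (t : ℂ) • A ⟨-dilate (resolventOf A) t (-1) y, hd⟩ =
        y + dilate (resolventOf A) t (-1) y := by
  obtain ⟨hd, hy⟩ := (h.isResolventAt_dilate ht).1 y
  have hd' : dilate (resolventOf A) t (-1) y ∈ A.domain := hd
  refine ⟨A.domain.neg_mem hd', ?_⟩
  have e : (⟨-dilate (resolventOf A) t (-1) y, A.domain.neg_mem hd'⟩ : A.domain) =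
    -⟨dilate (resolventOf A) t (-1) y, hd'⟩ := rfl
  rw [e, LinearPMap.map_neg, smul_neg]
  rw [LinearPMap.smul_apply, neg_one_smul] at hy
  have hy' : -dilate (resolventOf A) t (-1) y -
    (t : ℂ) • A ⟨dilate (resolventOf A) t (-1) y, hd'⟩ = y := hy
  have hy2 := congrArg (fun w => w + dilate (resolventOf A) t (-1) y) hy'
  rw [← hy2]
  abel

theorem resolvent_apply (h : HasCalculus A θ M ω φ) {t : ℝ} (ht : 0 < t) (b : A.domain) :
    -dilate (resolventOf A) t (-1) ((b : X) + (t : ℂ) • A b) = b := by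
  have := (h.isResolventAt_dilate ht).2 b
  rw [LinearPMap.smul_apply, neg_one_smul] at this
  rw [← map_neg, neg_add']
  exact this

theorem resolvent_injective (h : HasCalculus A θ M ω φ) {t : ℝ} (ht : 0 < t) {y : X}
    (hy : dilate (resolventOf A) t (-1) y = 0) : y = 0 := by
  obtain ⟨hd, he⟩ := h.resolvent_mem ht y
  have e : (⟨-dilate (resolventOf A) t (-1) y, hd⟩ : A.domain) = 0 :=
    Subtype.ext (by simp [hy])
  rw [e, LinearPMap.map_zero, smul_zero, hy, add_zero] at he
  exact he.symm

variable [CompleteSpace X]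

theorem calculus_mul (h : HasCalculus A θ M ω φ) {t : ℝ} (ht : 0 < t) (hf : MemE φ f)
    (hg : MemE φ g) :
    primaryCalculus ((t : ℂ) • A) φ (fun z => f z * g z) =
      primaryCalculus ((t : ℂ) • A) φ f * primaryCalculus ((t : ℂ) • A) φ g := by
  simp only [h.calculus_eq ht]
  exact (h.family.dilated ht).extCalc_mul h.lt_contour h.contour_lt h.lt_pi hf hg

theorem calculus_add (h : HasCalculus A θ M ω φ) {t : ℝ} (ht : 0 < t) (hf : MemE φ f)
    (hg : MemE φ g) :
    primaryCalculus ((t : ℂ) • A) φ (fun z => f z + g z) =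
      primaryCalculus ((t : ℂ) • A) φ f + primaryCalculus ((t : ℂ) • A) φ g := by
  simp only [h.calculus_eq ht]
  exact (h.family.dilated ht).extCalc_add h.lt_contour h.contour_lt h.lt_pi.le hf hg

theorem calculus_congr (h : HasCalculus A θ M ω φ) {t : ℝ} (ht : 0 < t) (hf : MemE φ f)
    (hfg : ∀ z ∈ sector φ, g z = f z) :
    primaryCalculus ((t : ℂ) • A) φ g = primaryCalculus ((t : ℂ) • A) φ f := by
  simp only [h.calculus_eq ht]
  exact extCalc_congr h.contour_pos h.contour_lt h.lt_pi.le hf hfg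

theorem calculus_const (h : HasCalculus A θ M ω φ) {t : ℝ} (ht : 0 < t) (c : ℂ) :
    primaryCalculus ((t : ℂ) • A) φ (fun _ => c) = c • ContinuousLinearMap.id ℂ X := by
  rw [h.calculus_eq ht]
  exact extCalc_const h.contour_pos h.contour_lt h.lt_pi.le c

/-- If `g(z) = z f(z)`, then `f(tA)` maps into the domain and `tA f(tA) = g(tA)`. -/
theorem calculus_mem_domain (h : HasCalculus A θ M ω φ) {t : ℝ} (ht : 0 < t) (hf : MemE φ f)
    (hg : MemE φ g)
    (hfg : ∀ z ∈ sector φ, g z = z * f z) (x : X) :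
    ∃ hd : primaryCalculus ((t : ℂ) • A) φ f x ∈ A.domain,
      (t : ℂ) • A ⟨primaryCalculus ((t : ℂ) • A) φ f x, hd⟩ =
        primaryCalculus ((t : ℂ) • A) φ g x := by
  have e := congrArg (fun T : X →L[ℂ] X => T x) ((h.family.dilated ht).extCalc_eq_neg_resolvent_mul
    h.lt_contour h.contour_lt h.lt_pi hf hg hfg)
  simp only [← h.calculus_eq ht, mul_apply_eq_comp, neg_apply,
    add_apply] at e
  obtain ⟨hd, he⟩ := h.resolvent_mem ht (primaryCalculus ((t : ℂ) • A) φ f x +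
    primaryCalculus ((t : ℂ) • A) φ g x)
  simp only [← e] at hd he
  refine ⟨hd, he.trans ?_⟩
  rw [eq_neg_iff_add_eq_zero] at e
  rw [← sub_eq_zero]
  rw [← e]
  abel

/-- If `g(z) = z f(z)`, then `g(tA) b = f(tA) tA b` on the domain. -/
theorem calculus_apply_domain (h : HasCalculus A θ M ω φ) {t : ℝ} (ht : 0 < t) (hf : MemE φ f)
    (hg : MemE φ g)
    (hfg : ∀ z ∈ sector φ, g z = z * f z) (b : A.domain) :
    primaryCalculus ((t : ℂ) • A) φ g b =
      (t : ℂ) • primaryCalculus ((t : ℂ) • A) φ f (A b) := by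
  have e := congrArg (fun T : X →L[ℂ] X => T ((b : X) + (t : ℂ) • A b))
    ((h.family.dilated ht).extCalc_mul_resolvent h.lt_contour h.contour_lt h.lt_pi hf hg hfg)
  have hb := h.resolvent_apply ht b
  simp only [← h.calculus_eq ht, mul_apply_eq_comp, neg_apply,
    add_apply, ContinuousLinearMap.id_apply, hb] at e
  rw [e, ← map_smul]
  congr 1
  rw [neg_eq_iff_eq_neg] at hb
  rw [hb]
  abel

theorem calculus_comm_resolvent (h : HasCalculus A θ M ω φ) {t : ℝ} (ht : 0 < t) (hf : MemE φ f)
    (x : X) :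
    resolventOf A (-1) (primaryCalculus ((t : ℂ) • A) φ f x) =
      primaryCalculus ((t : ℂ) • A) φ f (resolventOf A (-1) x) := by
  have ht0 : (t : ℂ) ≠ 0 := by exact_mod_cast ht.ne'
  -- Evaluating the dilated family at `-t` gives `t⁻¹ R(-1, A)`: the resolvent of `A` itself, at a
  -- point independent of `t`.
  have hw : (t : ℂ) * -1 ∈ outerSector ω := smul_mem_outerSector ht
    (neg_one_mem_outerSector h.contour_pos (h.contour_lt.trans h.lt_pi))
  have e := congrArg (fun T : X →L[ℂ] X => (t : ℂ) • T x)
    ((h.family.dilated ht).resolvent_mul_extCalc h.lt_contour h.contour_lt h.lt_pi.le hf hw)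
  simp only [← h.calculus_eq ht, mul_apply_eq_comp, dilate, inv_mul_cancel_left₀ ht0,
    smul_apply, map_smul, smul_inv_smul₀ ht0] at e
  exact e

theorem hasDerivAt_calculus (h : HasCalculus A θ M ω φ) (hf : MemE φ f)
    (hg : MemHInftyZero φ g)
    (hfg : ∀ z ∈ sector φ, ∀ τ : ℝ, HasDerivAt (fun τ : ℝ => f (Real.exp τ * z))
      (g (Real.exp τ * z)) τ) {t : ℝ} (ht : 0 < t) :
    HasDerivAt (fun t : ℝ => primaryCalculus ((t : ℂ) • A) φ f)
      (t⁻¹ • primaryCalculus ((t : ℂ) • A) φ g) t := by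
  have h1 := h.family.hasDerivAt_extCalc_dilate h.lt_contour h.contour_lt h.lt_pi hf hg hfg
    (Real.log t)
  have h2 := HasDerivAt.scomp t h1 (Real.hasDerivAt_log ht.ne')
  rw [Real.exp_log ht, ← h.calculus_eq ht] at h2
  refine h2.congr_of_eventuallyEq ?_
  filter_upwards [eventually_gt_nhds ht] with s hs
  rw [h.calculus_eq hs, Function.comp_apply, Real.exp_log hs]

end HasCalculus

end SectorialOperators

/-! ### Tails of integrals along rays -/

section RadialIntegrals

variable {φ C : ℝ} {G : ℂ → ℂ}

/-- The tail `∫_1^∞ G(sz) ds/s` of the integral of `G` along the ray through `z`. -/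
def radialTail (G : ℂ → ℂ) (z : ℂ) : ℂ :=
  ∫ x in Set.Ioi (0 : ℝ), G (Real.exp x * z)

/-- `G` is holomorphic on the sector, with quadratic decay at the vertex and at infinity. -/
structure QuadraticDecay (φ C : ℝ) (G : ℂ → ℂ) : Prop where
  pos : 0 < φ
  le_pi : φ ≤ Real.pi
  nonneg : 0 ≤ C
  diff : DifferentiableOn ℂ G (sector φ)
  zero : ∀ z ∈ sector φ, ‖G z‖ ≤ C * ‖z‖ ^ 2
  infty : ∀ z ∈ sector φ, ‖G z‖ ≤ C * (‖z‖ ^ 2)⁻¹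

theorem norm_ofReal_exp_mul (x : ℝ) (z : ℂ) :
    ‖(Real.exp x : ℂ) * z‖ = Real.exp x * ‖z‖ := by
  rw [norm_mul, Complex.norm_real, Real.norm_of_nonneg (Real.exp_pos x).le]

namespace QuadraticDecay

theorem norm_le_zero (h : QuadraticDecay φ C G) {z : ℂ} (hz : z ∈ sector φ) (x : ℝ) :
    ‖G (Real.exp x * z)‖ ≤ C * ‖z‖ ^ 2 * Real.exp (2 * x) := by
  refine (h.zero _ (smul_mem_sector (Real.exp_pos x) hz)).trans (le_of_eq ?_)
  rw [norm_ofReal_exp_mul, mul_pow, ← Real.exp_nat_mul]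
  push_cast
  ring

theorem norm_le_infty (h : QuadraticDecay φ C G) {z : ℂ} (hz : z ∈ sector φ) (x : ℝ) :
    ‖G (Real.exp x * z)‖ ≤ C * (‖z‖ ^ 2)⁻¹ * Real.exp (-2 * x) := by
  refine (h.infty _ (smul_mem_sector (Real.exp_pos x) hz)).trans (le_of_eq ?_)
  rw [norm_ofReal_exp_mul, mul_pow, ← Real.exp_nat_mul, mul_inv, ← Real.exp_neg]
  push_cast
  ring_nf

theorem continuous_radial (h : QuadraticDecay φ C G) {z : ℂ} (hz : z ∈ sector φ) :
    Continuous fun x : ℝ => G (Real.exp x * z) :=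
  h.diff.continuousOn.comp_continuous (by fun_prop)
    fun x => smul_mem_sector (Real.exp_pos x) hz

theorem integrable_radial (h : QuadraticDecay φ C G) {z : ℂ} (hz : z ∈ sector φ) :
    Integrable fun x : ℝ => G (Real.exp x * z) := by
  refine integrable_of_continuous_of_exp_decay (C := C * max (‖z‖ ^ 2) (‖z‖ ^ 2)⁻¹) (s := 2)
    (c := 0) (h.continuous_radial hz) two_pos fun x _ => ?_
  rw [sub_zero]
  have hC := h.nonneg
  rcases le_total 0 x with hx | hx
  · rw [abs_of_nonneg hx]
    refine (h.norm_le_infty hz x).trans ?_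
    gcongr
    exact le_max_right _ _
  · rw [abs_of_nonpos hx, show -2 * -x = 2 * x by ring]
    refine (h.norm_le_zero hz x).trans ?_
    gcongr
    exact le_max_left _ _

theorem radialTail_add (h : QuadraticDecay φ C G) {z : ℂ} (hz : z ∈ sector φ) :
    (∫ x in Set.Iic (0 : ℝ), G (Real.exp x * z)) + radialTail G z =
      ∫ x : ℝ, G (Real.exp x * z) := by
  have hi := h.integrable_radial hz
  rw [radialTail, ← setIntegral_union (Set.Iic_disjoint_Ioi le_rfl) measurableSet_Ioi
    hi.integrableOn hi.integrableOn, Set.Iic_union_Ioi, setIntegral_univ]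

/-- The integral over a ray does not depend on the ray. -/
theorem integral_radial_eq (h : QuadraticDecay φ C G) {z : ℂ} (hz : z ∈ sector φ) :
    ∫ x : ℝ, G (Real.exp x * z) = ∫ x : ℝ, G (Real.exp x) := by
  obtain ⟨v, rfl, hv, -, -⟩ := exists_exp_of_mem_sector hz
  have hmem : ∀ w : ℂ, |w.im| ≤ |v.im| → Complex.exp w ∈ sector φ := fun w hw =>
    exp_mem_sector h.pos h.le_pi (cos_lt_cos_of_abs_lt (hw.trans_lt hv) h.le_pi)
  have hd : ∀ w : ℂ, |w.im| ≤ |v.im| →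
      DifferentiableAt ℂ (fun w => G (Complex.exp w)) w := fun w hw =>
    ((h.diff _ (hmem w hw)).differentiableAt
      ((isOpen_sector h.pos h.le_pi).mem_nhds (hmem w hw))).comp w
      Complex.differentiable_exp.differentiableAt
  have hdec : ∀ w : ℂ, |w.im| ≤ |v.im| →
      ‖G (Complex.exp w)‖ ≤ C * Real.exp (-2 * |w.re|) := by
    intro w hw
    have hsq : ‖Complex.exp w‖ ^ 2 = Real.exp (2 * w.re) := by
      rw [Complex.norm_exp, ← Real.exp_nat_mul]; push_cast; rfl
    rcases le_total 0 w.re with hr | hr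
    · rw [abs_of_nonneg hr]
      refine (h.infty _ (hmem w hw)).trans (le_of_eq ?_)
      rw [hsq, ← Real.exp_neg]; ring_nf
    · rw [abs_of_nonpos hr]
      refine (h.zero _ (hmem w hw)).trans (le_of_eq ?_)
      rw [hsq]; ring_nf
  -- The argument of the ray is removed by Cauchy's theorem on a strip, the modulus of `z` by a real
  -- translation.
  have e0 : lineInt (fun w => G (Complex.exp w)) v.im =
      lineInt (fun w => G (Complex.exp w)) 0 := by
    rcases le_total 0 v.im with hv0 | hv0
    · refine (strip_shift hv0 (fun w h1 h2 => hd w ?_) two_pos (fun w h1 h2 => hdec w ?_)).symm <;>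
        rwa [abs_of_nonneg h1, abs_of_nonneg hv0]
    · refine strip_shift hv0 (fun w h1 h2 => hd w ?_) two_pos (fun w h1 h2 => hdec w ?_) <;>
        rw [abs_of_nonpos h2, abs_of_nonpos hv0] <;> linarith
  have e1 := lineInt_comp_add (fun w => G (Complex.exp w)) v.im v.re
  calc ∫ x : ℝ, G (Real.exp x * Complex.exp v)
      = lineInt (fun w => G (Complex.exp (w + v.re))) v.im := by
        refine integral_congr_ae (ae_of_all _ fun x => ?_)
        simp only
        rw [Complex.ofReal_exp, ← Complex.exp_add]
        congr 2
        conv_lhs => rw [← Complex.re_add_im v]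
        ring
    _ = ∫ x : ℝ, G (Real.exp x) := by
        rw [e1, e0]
        refine integral_congr_ae (ae_of_all _ fun x => ?_)
        simp

/-- For total integral `1` the second bound concerns `1 - radialTail G z`: quadratic smallness at
the vertex leaves room for a division by `z`. -/
theorem exists_norm_radialTail_le (h : QuadraticDecay φ C G) :
    ∃ B : ℝ, 0 ≤ B ∧ (∀ z ∈ sector φ, ‖radialTail G z‖ ≤ B * (‖z‖ ^ 2)⁻¹) ∧
      ∀ z ∈ sector φ, ‖∫ x in Set.Iic (0 : ℝ), G (Real.exp x * z)‖ ≤ B * ‖z‖ ^ 2 := by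
  refine ⟨C * ∫ x : ℝ, Real.exp (-2 * |x|), mul_nonneg h.nonneg
    (integral_nonneg fun x => (Real.exp_pos _).le), fun z hz => ?_, fun z hz => ?_⟩
  · have hC := h.nonneg
    have hi := (integrable_exp_neg_mul_abs two_pos).const_mul (C * (‖z‖ ^ 2)⁻¹)
    have : ‖radialTail G z‖ ≤ ∫ x in Set.Ioi (0 : ℝ),
        C * (‖z‖ ^ 2)⁻¹ * Real.exp (-2 * |x|) := by
      refine norm_integral_le_of_norm_le hi.integrableOn ?_
      filter_upwards [ae_restrict_mem measurableSet_Ioi] with x hx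
      rw [abs_of_pos (Set.mem_Ioi.1 hx)]
      exact h.norm_le_infty hz x
    refine (this.trans (setIntegral_le_integral hi (ae_of_all _ fun x => ?_))).trans
      (le_of_eq ?_)
    · simp only [Pi.zero_apply]; positivity
    · rw [integral_const_mul]; ring
  · have hC := h.nonneg
    have hi := (integrable_exp_neg_mul_abs two_pos).const_mul (C * ‖z‖ ^ 2)
    have : ‖∫ x in Set.Iic (0 : ℝ), G (Real.exp x * z)‖ ≤ ∫ x in Set.Iic (0 : ℝ),
        C * ‖z‖ ^ 2 * Real.exp (-2 * |x|) := by
      refine norm_integral_le_of_norm_le hi.integrableOn ?_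
      filter_upwards [ae_restrict_mem measurableSet_Iic] with x hx
      rw [abs_of_nonpos (Set.mem_Iic.1 hx), show -2 * -x = 2 * x by ring]
      exact h.norm_le_zero hz x
    refine (this.trans (setIntegral_le_integral hi (ae_of_all _ fun x => ?_))).trans
      (le_of_eq ?_)
    · simp only [Pi.zero_apply]; positivity
    · rw [integral_const_mul]; ring

theorem differentiableOn_radialTail (h : QuadraticDecay φ C G) :
    DifferentiableOn ℂ (radialTail G) (sector φ) := by
  intro z₀ hz₀
  have hopen := isOpen_sector h.pos h.le_pi
  have hC := h.nonneg
  obtain ⟨ε, hε, hball⟩ := Metric.isOpen_iff.1 hopen z₀ hz₀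
  have hn : 0 < ‖z₀‖ := norm_pos_iff.2 hz₀.1
  -- The derivative of the integrand is dominated by Cauchy estimates. Circles of radius `r` about
  -- points of the `r`-ball stay within `2r` of `z₀`, hence in the sector and at modulus at least
  -- `‖z₀‖ / 4`.
  set r : ℝ := min (ε / 4) (‖z₀‖ / 4) with hr
  have hr0 : 0 < r := by positivity
  have hrε : 4 * r ≤ ε := by have := min_le_left (ε / 4) (‖z₀‖ / 4); linarith
  have hrn : 4 * r ≤ ‖z₀‖ := by have := min_le_right (ε / 4) (‖z₀‖ / 4); linarith
  have hsub : ∀ w, ‖w - z₀‖ < 3 * r → w ∈ sector φ ∧ ‖z₀‖ / 4 ≤ ‖w‖ := by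
    intro w hw
    refine ⟨hball (by rw [Metric.mem_ball, dist_eq_norm]; linarith), ?_⟩
    have := norm_sub_norm_le z₀ w
    rw [norm_sub_rev] at this
    linarith
  have hdiff : ∀ x : ℝ, DifferentiableOn ℂ (fun z => G (Real.exp x * z)) (sector φ) :=
    fun x => h.diff.comp (by fun_prop) fun z hz => smul_mem_sector (Real.exp_pos x) hz
  have hbound : ∀ (x : ℝ) (w : ℂ), ‖w - z₀‖ < 3 * r →
      ‖G (Real.exp x * w)‖ ≤ C * ((‖z₀‖ / 4) ^ 2)⁻¹ * Real.exp (-2 * x) := by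
    intro x w hw
    obtain ⟨h1, h2⟩ := hsub w hw
    refine (h.norm_le_infty h1 x).trans ?_
    gcongr
  have hint : IntegrableOn (fun x : ℝ => C * ((‖z₀‖ / 4) ^ 2)⁻¹ / r * Real.exp (-2 * x))
      (Set.Ioi 0) := (exp_neg_integrableOn_Ioi 0 two_pos).const_mul _
  have main := hasDerivAt_integral_of_dominated_loc_of_deriv_le (𝕜 := ℂ)
    (μ := volume.restrict (Set.Ioi (0 : ℝ)))
    (F := fun (z : ℂ) (x : ℝ) => G (Real.exp x * z))
    (F' := fun (z : ℂ) (x : ℝ) => deriv (fun z => G (Real.exp x * z)) z)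
    (bound := fun x : ℝ => C * ((‖z₀‖ / 4) ^ 2)⁻¹ / r * Real.exp (-2 * x))
    (Metric.ball_mem_nhds z₀ hr0) ?_ (h.integrable_radial hz₀).integrableOn ?_ ?_ hint ?_
  · exact main.2.differentiableAt.differentiableWithinAt
  · filter_upwards [hopen.mem_nhds hz₀] with z hz
    exact (h.continuous_radial hz).aestronglyMeasurable
  · have e : ∀ x : ℝ, deriv (fun z => G (Real.exp x * z)) z₀ =
        Real.exp x * deriv G (Real.exp x * z₀) := by
      intro x
      have := deriv_comp_mul_left (Real.exp x : ℂ) G z₀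
      simpa using this
    simp only [e]
    have c : Continuous fun x : ℝ => deriv G (Real.exp x * z₀) :=
      (h.diff.deriv hopen).continuousOn.comp_continuous (by fun_prop)
        fun x => smul_mem_sector (Real.exp_pos x) hz₀
    exact (Continuous.mul (by fun_prop) c).aestronglyMeasurable
  · refine ae_of_all _ fun x z hz => ?_
    rw [Metric.mem_ball, dist_eq_norm] at hz
    have := Complex.norm_deriv_le_of_forall_mem_sphere_norm_le (c := z) (R := r)
      (C := C * ((‖z₀‖ / 4) ^ 2)⁻¹ * Real.exp (-2 * x)) (f := fun z => G (Real.exp x * z)) hr0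
      ((hdiff x).mono (fun w hw => (hsub w ?_).1) |>.diffContOnCl) (fun w hw => hbound x w ?_)
    · refine this.trans (le_of_eq ?_)
      ring
    · have hw := Metric.closure_ball_subset_closedBall hw
      rw [Metric.mem_closedBall, dist_eq_norm] at hw
      have := norm_add_le (w - z) (z - z₀)
      rw [sub_add_sub_cancel] at this
      linarith
    · rw [Metric.mem_sphere, dist_eq_norm] at hw
      have := norm_add_le (w - z) (z - z₀)
      rw [sub_add_sub_cancel] at this
      linarith
  · refine ae_of_all _ fun x z hz => ?_
    rw [Metric.mem_ball, dist_eq_norm] at hz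
    have hz' := (hsub z (by linarith)).1
    exact ((hdiff x z hz').differentiableAt (hopen.mem_nhds hz')).hasDerivAt

/-- Dilating by `exp τ` moves the lower end of the tail from `0` to `τ`; the rest is the fundamental
theorem of calculus. -/
theorem hasDerivAt_radialTail (h : QuadraticDecay φ C G) {z : ℂ} (hz : z ∈ sector φ) (τ : ℝ) :
    HasDerivAt (fun τ : ℝ => radialTail G (Real.exp τ * z)) (-G (Real.exp τ * z)) τ := by
  have hi := h.integrable_radial hz
  have hc := h.continuous_radial hz
  have e : (fun τ : ℝ => radialTail G (Real.exp τ * z)) = fun τ : ℝ =>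
      radialTail G z - ∫ x in (0 : ℝ)..τ, G (Real.exp x * z) := by
    ext τ
    rw [eq_sub_iff_add_eq, radialTail, radialTail,
      ← intervalIntegral.integral_interval_add_Ioi hi.integrableOn hi.integrableOn (b := τ),
      add_comm]
    congr 1
    have := (measurePreserving_add_right volume τ).setIntegral_preimage_emb
      (measurableEmbedding_addRight τ) (fun x : ℝ => G (Real.exp x * z)) (Set.Ioi τ)
    rw [Set.preimage_add_const_Ioi, sub_self] at this
    rw [← this]
    refine integral_congr_ae (ae_of_all _ fun x => ?_)
    simp only [Real.exp_add, Complex.ofReal_mul, mul_assoc]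
  rw [e]
  exact (intervalIntegral.integral_hasDerivAt_right (hc.intervalIntegrable _ _)
    (hc.stronglyMeasurableAtFilter _ _) hc.continuousAt).const_sub _

end QuadraticDecay

end RadialIntegrals

/-! ### The Calderón formula and its auxiliary functions -/

section ReproducingFunctions

variable {φ : ℝ}

/-- The threshold `r` is free because `z⁻¹ψ(z)` is bounded below only near the vertex. The factor
`r⁻²` pays for comparing the powers of `‖z‖` where the bounds must be exchanged. -/
theorem MemHInftyZero.of_split_bounds {f : ℂ → ℂ} {a r C : ℝ}
    (hf : DifferentiableOn ℂ f (sector φ)) (ha : 0 < a) (ha1 : a ≤ 1) (hr : 0 < r) (hr1 : r ≤ 1)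
    (hC : 0 ≤ C) (h1 : ∀ z ∈ sector φ, ‖z‖ ≤ r → ‖f z‖ ≤ C * ‖z‖ ^ a)
    (h2 : ∀ z ∈ sector φ, r ≤ ‖z‖ → ‖f z‖ ≤ C * ‖z‖⁻¹) : MemHInftyZero φ f := by
  have hr2 : 1 ≤ r⁻¹ := (one_le_inv₀ hr).2 hr1
  have hr3 : (1 : ℝ) ≤ r⁻¹ * r⁻¹ := one_le_mul_of_one_le_of_one_le hr2 hr2
  have key : ∀ z ∈ sector φ, ∀ u v : ℝ, ‖f z‖ ≤ C * u → 0 ≤ u → u ≤ r⁻¹ * r⁻¹ * v →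
      ‖f z‖ ≤ C * (r⁻¹ * r⁻¹) * v := fun z _ u v h _ huv => by
    rw [mul_assoc]
    exact h.trans (mul_le_mul_of_nonneg_left huv hC)
  refine MemHInftyZero.of_bounds (C := C * (r⁻¹ * r⁻¹)) hf ha (fun z hz => ?_) fun z hz => ?_ <;>
    have hz0 : 0 < ‖z‖ := norm_pos_iff.2 hz.1 <;> rcases le_total ‖z‖ r with hzr | hzr
  · exact key z hz _ _ (h1 z hz hzr) (by positivity)
      (le_mul_of_one_le_left (by positivity) hr3)
  · refine key z hz _ _ (h2 z hz hzr) (by positivity) ?_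
    rcases le_total ‖z‖ 1 with h | h
    · have : r ≤ ‖z‖ ^ a := by
        refine hzr.trans ?_
        simpa using Real.rpow_le_rpow_of_exponent_ge hz0 h ha1
      calc ‖z‖⁻¹ ≤ r⁻¹ := inv_anti₀ hr hzr
        _ = r⁻¹ * r⁻¹ * r := by field_simp
        _ ≤ _ := by gcongr
    · calc ‖z‖⁻¹ ≤ 1 := inv_le_one_of_one_le₀ h
        _ ≤ r⁻¹ * r⁻¹ * 1 := by linarith
        _ ≤ _ := by gcongr; exact Real.one_le_rpow h ha.le
  · refine key z hz _ _ (h1 z hz hzr) (by positivity) ?_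
    have h := hzr.trans hr1
    calc ‖z‖ ^ a ≤ 1 := Real.rpow_le_one hz0.le h ha.le
      _ ≤ r⁻¹ * r⁻¹ * 1 := by linarith
      _ ≤ _ := by gcongr; exact Real.one_le_rpow_of_pos_of_le_one_of_nonpos hz0 h (by linarith)
  · refine key z hz _ _ (h2 z hz hzr) (by positivity) ?_
    rcases le_total ‖z‖ 1 with h | h
    · calc ‖z‖⁻¹ ≤ r⁻¹ * 1 := by rw [mul_one]; exact inv_anti₀ hr hzr
        _ ≤ r⁻¹ * r⁻¹ * 1 := by gcongr; exact le_mul_of_one_le_left (by positivity) hr2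
        _ ≤ _ := by gcongr; exact Real.one_le_rpow_of_pos_of_le_one_of_nonpos hz0 h (by linarith)
    · calc ‖z‖⁻¹ = 1 * ‖z‖ ^ (-1 : ℝ) := by rw [one_mul, Real.rpow_neg_one]
        _ ≤ r⁻¹ * r⁻¹ * ‖z‖ ^ (-a) := by gcongr

theorem conj_mem_sector (h0 : 0 < φ) (hπ : φ ≤ Real.pi) {z : ℂ} (hz : z ∈ sector φ) :
    (starRingEnd ℂ) z ∈ sector φ := by
  rw [mem_sector_iff h0 hπ] at hz ⊢
  simpa using hz

theorem differentiableOn_conj_conj (h0 : 0 < φ) (hπ : φ ≤ Real.pi) {f : ℂ → ℂ}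
    (hf : DifferentiableOn ℂ f (sector φ)) :
    DifferentiableOn ℂ (fun z => (starRingEnd ℂ) (f ((starRingEnd ℂ) z))) (sector φ) := by
  intro z hz
  have hz' := conj_mem_sector h0 hπ hz
  have := ((hf _ hz').differentiableAt ((isOpen_sector h0 hπ).mem_nhds hz')).conj_conj
  simp only [Complex.conj_conj] at this
  exact this.differentiableWithinAt

namespace QuadraticDecay

variable {C : ℝ} {G : ℂ → ℂ}

theorem memHInftyZero (h : QuadraticDecay φ C G) : MemHInftyZero φ G := by
  refine MemHInftyZero.of_bounds (C := C) (a := 2) h.diff two_pos (fun z hz => ?_) fun z hz => ?_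
  · rw [Real.rpow_two]
    exact h.zero z hz
  · rw [Real.rpow_neg (norm_nonneg z), Real.rpow_two]
    exact h.infty z hz

theorem const_mul (h : QuadraticDecay φ C G) (c : ℂ) :
    QuadraticDecay φ (‖c‖ * C) fun z => c * G z where
  pos := h.pos
  le_pi := h.le_pi
  nonneg := mul_nonneg (norm_nonneg c) h.nonneg
  diff := h.diff.const_mul c
  zero z hz := by
    rw [norm_mul, mul_assoc]
    exact mul_le_mul_of_nonneg_left (h.zero z hz) (norm_nonneg c)
  infty z hz := by
    rw [norm_mul, mul_assoc]
    exact mul_le_mul_of_nonneg_left (h.infty z hz) (norm_nonneg c)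

theorem one_sub_radialTail (h : QuadraticDecay φ C G) (h1 : ∫ x : ℝ, G (Real.exp x) = 1) {z : ℂ}
    (hz : z ∈ sector φ) :
    1 - radialTail G z = ∫ x in Set.Iic (0 : ℝ), G (Real.exp x * z) := by
  rw [← h1, ← h.integral_radial_eq hz, ← h.radialTail_add hz, add_sub_cancel_right]

/-- The tail tends to `1` at the vertex and to `0` at infinity, as `(1 + z)⁻¹` does; their
difference decays at both ends. -/
theorem memE_radialTail (h : QuadraticDecay φ C G) (hπ : φ < Real.pi)
    (h1 : ∫ x : ℝ, G (Real.exp x) = 1) : MemE φ (radialTail G) := by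
  obtain ⟨B, hB0, hB1, hB2⟩ := h.exists_norm_radialTail_le
  obtain ⟨K, hK0, hK⟩ := exists_norm_inv_one_add_le h.pos hπ
  refine ⟨(fun z => radialTail G z - (1 + z)⁻¹, 1, 0), ?_, fun z hz => by simp⟩
  refine MemHInftyZero.of_split_bounds (a := 1) (r := 1) (C := B + K)
    (h.differentiableOn_radialTail.sub (differentiableOn_inv_one_add h.pos hπ)) one_pos le_rfl
    one_pos le_rfl (by positivity) (fun z hz hz1 => ?_) fun z hz hz1 => ?_
  · have e : radialTail G z - (1 + z)⁻¹ = z * (1 + z)⁻¹ - (1 - radialTail G z) := by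
      have := (hK z hz).1
      field_simp
      ring
    change ‖radialTail G z - (1 + z)⁻¹‖ ≤ _
    rw [e, Real.rpow_one]
    refine (norm_sub_le _ _).trans ?_
    rw [h.one_sub_radialTail h1 hz, norm_mul]
    have b1 := mul_le_mul_of_nonneg_left (hK z hz).2.1 (norm_nonneg z)
    have b2 : B * ‖z‖ ^ 2 ≤ B * ‖z‖ := by
      gcongr
      rw [pow_two]
      exact mul_le_of_le_one_left (norm_nonneg z) hz1
    linarith [hB2 z hz]
  · refine (norm_sub_le _ _).trans ?_
    have hz0 : 0 < ‖z‖ := norm_pos_iff.2 hz.1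
    have b1 : B * (‖z‖ ^ 2)⁻¹ ≤ B * ‖z‖⁻¹ := by
      gcongr
      rw [pow_two]
      exact le_mul_of_one_le_left hz0.le hz1
    have b2 : ‖(1 + z)⁻¹‖ ≤ K * ‖z‖⁻¹ := by
      rw [← div_eq_mul_inv, le_div_iff₀ hz0, mul_comm]
      exact (hK z hz).2.2
    linarith [hB1 z hz]

theorem memHInftyZero_inv_mul_one_sub (h : QuadraticDecay φ C G)
    (h1 : ∫ x : ℝ, G (Real.exp x) = 1) :
    MemHInftyZero φ fun z => z⁻¹ * (1 - radialTail G z) := by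
  obtain ⟨B, hB0, hB1, hB2⟩ := h.exists_norm_radialTail_le
  refine MemHInftyZero.of_split_bounds (a := 1) (r := 1) (C := B + 1)
    ((differentiableOn_id.inv fun z hz => hz.1).mul
      ((differentiableOn_const 1).sub h.differentiableOn_radialTail)) one_pos le_rfl
    one_pos le_rfl (by positivity) (fun z hz hz1 => ?_) fun z hz hz1 => ?_ <;>
    have hz0 : 0 < ‖z‖ := norm_pos_iff.2 hz.1 <;> rw [norm_mul, norm_inv]
  · rw [h.one_sub_radialTail h1 hz, Real.rpow_one]
    calc ‖z‖⁻¹ * _ ≤ ‖z‖⁻¹ * (B * ‖z‖ ^ 2) := by gcongr; exact hB2 z hz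
      _ = B * ‖z‖ := by field_simp
      _ ≤ _ := by gcongr; linarith
  · rw [mul_comm]
    gcongr
    refine (norm_sub_le _ _).trans ?_
    rw [norm_one]
    have : B * (‖z‖ ^ 2)⁻¹ ≤ B * 1 := by
      gcongr
      exact inv_le_one_of_one_le₀ (one_le_pow₀ hz1)
    linarith [hB1 z hz]

end QuadraticDecay

variable {ψ : ℂ → ℂ}

/-- Calderón reproducing formula for a nonvanishing function `ψ`. -/
theorem exists_reproducing (h0 : 0 < φ) (hπ : φ < Real.pi)
    (hψ : DifferentiableOn ℂ ψ (sector φ)) (hne : ∀ z ∈ sector φ, ψ z ≠ 0) {B : ℝ}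
    (hB : ∀ z ∈ sector φ, ‖ψ z‖ ≤ B) (hB' : ∀ z ∈ sector φ, ‖ψ z‖ ≤ B * ‖z‖) :
    ∃ (g : ℂ → ℂ) (C D : ℝ), MemHInftyZero φ g ∧ QuadraticDecay φ C (fun z => g z * ψ z) ∧
      0 ≤ D ∧ (∀ z ∈ sector φ, ‖g z‖ ≤ D * (‖z‖ ^ 2)⁻¹) ∧
      ∫ x : ℝ, g (Real.exp x) * ψ (Real.exp x) = 1 := by
  obtain ⟨K, hK0, hK⟩ := exists_norm_inv_one_add_le h0 hπ
  have hB0 : 0 ≤ B := (norm_nonneg _).trans (hB _ (ofReal_mem_sector h0 one_pos))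
  -- Reflection makes `gψ = |ψ|²(1 + r)⁻²` on the half-line, so its integral `γ` is positive and can
  -- be normalised. The factor `(1 + z)⁻²` supplies the decay at infinity, where `ψ` is merely
  -- bounded.
  set g : ℂ → ℂ := fun z => (starRingEnd ℂ) (ψ ((starRingEnd ℂ) z)) * (1 + z)⁻¹ * (1 + z)⁻¹
    with hg
  have dinv := differentiableOn_inv_one_add h0 hπ
  have dg : DifferentiableOn ℂ g (sector φ) :=
    ((differentiableOn_conj_conj h0 hπ.le hψ).mul dinv).mul dinv
  have ng : ∀ z ∈ sector φ, ‖g z‖ =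
      ‖ψ ((starRingEnd ℂ) z)‖ * ‖(1 + z)⁻¹‖ * ‖(1 + z)⁻¹‖ := fun z _ => by
    rw [hg]
    simp only [norm_mul, RCLike.norm_conj]
  have g1 : ∀ z ∈ sector φ, ‖g z‖ ≤ B * K ^ 2 * ‖z‖ := fun z hz => by
    have hb := hB' _ (conj_mem_sector h0 hπ.le hz)
    rw [RCLike.norm_conj] at hb
    have k1 := (hK z hz).2.1
    rw [ng z hz]
    calc _ ≤ B * ‖z‖ * K * K := by gcongr
      _ = _ := by ring
  have kz : ∀ z ∈ sector φ, ‖(1 + z)⁻¹‖ ≤ K * ‖z‖⁻¹ := fun z hz => by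
    rw [← div_eq_mul_inv, le_div_iff₀ (norm_pos_iff.2 hz.1), mul_comm]
    exact (hK z hz).2.2
  have g2 : ∀ z ∈ sector φ, ‖g z‖ ≤ B * K ^ 2 * ‖z‖⁻¹ := fun z hz => by
    have hb := hB _ (conj_mem_sector h0 hπ.le hz)
    rw [ng z hz]
    calc _ ≤ B * K * (K * ‖z‖⁻¹) := by gcongr; exacts [(hK z hz).2.1, kz z hz]
      _ = _ := by ring
  have g3 : ∀ z ∈ sector φ, ‖g z‖ ≤ B * K ^ 2 * (‖z‖ ^ 2)⁻¹ := fun z hz => by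
    have hb := hB _ (conj_mem_sector h0 hπ.le hz)
    rw [ng z hz]
    calc _ ≤ B * (K * ‖z‖⁻¹) * (K * ‖z‖⁻¹) := by gcongr; exacts [kz z hz, kz z hz]
      _ = _ := by rw [← inv_pow]; ring
  have hgE : MemHInftyZero φ g := by
    refine MemHInftyZero.of_bounds (C := B * K ^ 2) (a := 1) dg one_pos (fun z hz => ?_)
      fun z hz => ?_
    · rw [Real.rpow_one]; exact g1 z hz
    · rw [Real.rpow_neg_one]; exact g2 z hz
  have hQ : QuadraticDecay φ (B * K ^ 2 * B) fun z => g z * ψ z :=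
    { pos := h0
      le_pi := hπ.le
      nonneg := by positivity
      diff := dg.mul hψ
      zero := fun z hz => by
        rw [norm_mul]
        calc _ ≤ B * K ^ 2 * ‖z‖ * (B * ‖z‖) := by gcongr; exacts [g1 z hz, hB' z hz]
          _ = _ := by ring
      infty := fun z hz => by
        rw [norm_mul]
        calc _ ≤ B * K ^ 2 * (‖z‖ ^ 2)⁻¹ * B := by gcongr; exacts [g3 z hz, hB z hz]
          _ = _ := by ring }
  set γ : ℂ := ∫ x : ℝ, g (Real.exp x) * ψ (Real.exp x) with hγ
  have hγ0 : γ ≠ 0 := by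
    have e : ∀ x : ℝ, g (Real.exp x) * ψ (Real.exp x) =
        ((‖ψ (Real.exp x)‖ ^ 2 * ((1 + Real.exp x)⁻¹) ^ 2 : ℝ) : ℂ) := fun x => by
      simp only [hg, Complex.conj_ofReal]
      push_cast
      rw [← Complex.conj_mul']
      ring
    have hi := hQ.integrable_radial (ofReal_mem_sector h0 one_pos)
    simp only [Complex.ofReal_one, mul_one, e] at hi
    rw [hγ]
    simp only [e]
    rw [integral_complex_ofReal]
    have hpos : ∀ x : ℝ, 0 < ‖ψ (Real.exp x)‖ ^ 2 * ((1 + Real.exp x)⁻¹) ^ 2 := fun x => by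
      have := norm_pos_iff.2 (hne _ (ofReal_mem_sector h0 (Real.exp_pos x)))
      positivity
    have := (integral_pos_iff_support_of_nonneg (fun x => (hpos x).le) hi.re).2 (by
      rw [Function.support_eq_univ fun x => (hpos x).ne']
      simp)
    exact_mod_cast this.ne'
  have hQ' := hQ.const_mul γ⁻¹
  simp only [← mul_assoc] at hQ'
  refine ⟨fun z => γ⁻¹ * g z, _, ‖γ⁻¹‖ * (B * K ^ 2), hgE.const_mul _, hQ', by positivity,
    fun z hz => ?_, ?_⟩
  · rw [norm_mul, mul_assoc]
    gcongr
    exact g3 z hz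
  · simp only [mul_assoc]
    rw [integral_const_mul, ← hγ, inv_mul_cancel₀ hγ0]

/-- The growth condition enters here: `|ψ(sz)| ≤ M s |ψ(z)|` takes `ψ(z)` out of the integral, and
against `|g(sz)| ≤ D(s|z|)⁻²` there remains `∫_1^∞ s⁻² ds = 1`. -/
theorem norm_radialTail_mul_le {g : ℂ → ℂ} {D M : ℝ}
    (hM : ∀ z ∈ sector φ, ∀ s : ℝ, 1 ≤ s → ‖ψ (s * z) / (s * ψ z)‖ ≤ M)
    (hne : ∀ z ∈ sector φ, ψ z ≠ 0) (hD0 : 0 ≤ D)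
    (hD : ∀ z ∈ sector φ, ‖g z‖ ≤ D * (‖z‖ ^ 2)⁻¹) {z : ℂ} (hz : z ∈ sector φ) :
    ‖radialTail (fun z => g z * ψ z) z‖ ≤ D * M * (‖z‖ ^ 2)⁻¹ * ‖ψ z‖ := by
  have hψz := norm_pos_iff.2 (hne z hz)
  have hM0 : 0 ≤ M := (norm_nonneg _).trans (hM z hz 1 le_rfl)
  have hi : IntegrableOn (fun x : ℝ => D * M * (‖z‖ ^ 2)⁻¹ * ‖ψ z‖ * Real.exp (-x))
      (Set.Ioi 0) := by
    have : IntegrableOn (fun x : ℝ => Real.exp (-x)) (Set.Ioi 0) := by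
      simpa using exp_neg_integrableOn_Ioi 0 one_pos
    exact this.const_mul _
  have := norm_integral_le_of_norm_le
    (f := fun x : ℝ => g (Real.exp x * z) * ψ (Real.exp x * z)) hi ?_
  · rwa [integral_const_mul, integral_exp_neg_Ioi_zero, mul_one] at this
  filter_upwards [ae_restrict_mem measurableSet_Ioi] with x hx
  have hx' : 1 ≤ Real.exp x := Real.one_le_exp (le_of_lt hx)
  have b1 := hD _ (smul_mem_sector (Real.exp_pos x) hz)
  have b2 := hM z hz _ hx'
  rw [norm_div, norm_mul, Complex.norm_real, Real.norm_of_nonneg (Real.exp_pos x).le,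
    div_le_iff₀ (by positivity)] at b2
  rw [norm_ofReal_exp_mul] at b1
  rw [norm_mul]
  calc _ ≤ D * ((Real.exp x * ‖z‖) ^ 2)⁻¹ * (M * (Real.exp x * ‖ψ z‖)) := by gcongr
    _ = _ := by rw [Real.exp_neg]; field_simp

/-- Membership in `𝓔` upgrades convergence at the vertex to a power rate: the limit along the
half-line gives `c = l + m`, so `η(z) - c = f₀(z) - l z(1 + z)⁻¹`. -/
theorem norm_sub_le_of_isDecomposition (h0 : 0 < φ) (hπ : φ < Real.pi) {η : ℂ → ℂ} {c : ℂ}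
    (hη : MemE φ η) (hlim : Tendsto η (𝓝[sector φ] 0) (𝓝 c)) :
    ∃ a C : ℝ, 0 < a ∧ a ≤ 1 ∧ 0 < C ∧
      ∀ z ∈ sector φ, ‖z‖ ≤ 1 → ‖η z - c‖ ≤ C * ‖z‖ ^ a := by
  obtain ⟨⟨f, l, m⟩, hf, hd⟩ := hη
  simp only at hf hd
  obtain ⟨K, hK0, hK⟩ := exists_norm_inv_one_add_le h0 hπ
  have hc : c = l + m := by
    have h1 : Tendsto (fun r : ℝ => (1 + (r : ℂ))⁻¹) (𝓝[>] 0) (𝓝 1) := by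
      have : Tendsto (fun r : ℝ => (1 + (r : ℂ))⁻¹) (𝓝 0) (𝓝 (1 + ((0 : ℝ) : ℂ))⁻¹) := by
        apply Tendsto.inv₀
        · exact ((Complex.continuous_ofReal.tendsto 0)).const_add 1
        · simp
      simpa using this.mono_left nhdsWithin_le_nhds
    have h2 := ((hf.tendsto_zero h0).add (h1.const_mul l)).add_const m
    simp only [mul_one, zero_add] at h2
    have h3 : Tendsto (fun r : ℝ => (r : ℂ)) (𝓝[>] 0) (𝓝[sector φ] 0) := by
      refine tendsto_nhdsWithin_iff.2 ⟨?_, ?_⟩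
      · simpa using (Complex.continuous_ofReal.tendsto 0).mono_left nhdsWithin_le_nhds
      · filter_upwards [self_mem_nhdsWithin] with r hr using ofReal_mem_sector h0 hr
    refine tendsto_nhds_unique (hlim.comp h3) (h2.congr' ?_)
    filter_upwards [self_mem_nhdsWithin] with r hr
    exact (hd r (ofReal_mem_sector h0 hr)).symm
  obtain ⟨-, -, C, s, hC, hs, bf⟩ := hf
  refine ⟨min s 1, C + ‖l‖ * K, by positivity, min_le_right _ _, by positivity,
    fun z hz hz1 => ?_⟩
  have hz0 : 0 < ‖z‖ := norm_pos_iff.2 hz.1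
  have e : η z - c = f z - l * (z * (1 + z)⁻¹) := by
    rw [hd z hz, hc]
    have := (hK z hz).1
    field_simp
    ring
  rw [e]
  refine (norm_sub_le _ _).trans ?_
  rw [add_mul, norm_mul, norm_mul, mul_assoc]
  have p1 : ‖z‖ ^ s ≤ ‖z‖ ^ min s 1 :=
    Real.rpow_le_rpow_of_exponent_ge hz0 hz1 (min_le_left _ _)
  have p2 : ‖z‖ ≤ ‖z‖ ^ min s 1 := by
    simpa using Real.rpow_le_rpow_of_exponent_ge hz0 hz1 (min_le_right s 1)
  have p3 : ‖z‖ * ‖(1 + z)⁻¹‖ ≤ K * ‖z‖ ^ min s 1 := by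
    rw [mul_comm]
    gcongr
    exact (hK z hz).2.1
  have p4 : ‖f z‖ ≤ C * ‖z‖ ^ min s 1 :=
    (bf z hz).trans (by gcongr; exact (min_le_left _ _).trans p1)
  exact add_le_add p4 (mul_le_mul_of_nonneg_left p3 (norm_nonneg l))

/-- At the vertex `e → 1` and `ψ(z)/z → c ≠ 0`, both at a power rate, so the quotient tends to
`c⁻¹`; at infinity it is `O(|z|⁻¹)`. Subtracting `c⁻¹(1 + z)⁻¹` leaves an `H^∞_0` function. -/
theorem memE_mul_div (h0 : 0 < φ) (hπ : φ < Real.pi) {e : ℂ → ℂ} {c : ℂ} {D B : ℝ}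
    (hψ : DifferentiableOn ℂ ψ (sector φ)) (hne : ∀ z ∈ sector φ, ψ z ≠ 0)
    (hη : MemE φ fun z => z⁻¹ * ψ z) (hc : c ≠ 0)
    (hlim : Tendsto (fun z => z⁻¹ * ψ z) (𝓝[sector φ] 0) (𝓝 c))
    (he : DifferentiableOn ℂ e (sector φ)) (hD0 : 0 ≤ D) (hB0 : 0 ≤ B)
    (hD : ∀ z ∈ sector φ, ‖e z‖ ≤ D * (‖z‖ ^ 2)⁻¹ * ‖ψ z‖)
    (hB : ∀ z ∈ sector φ, ‖1 - e z‖ ≤ B * ‖z‖ ^ 2) :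
    MemE φ fun z => z * e z / ψ z := by
  obtain ⟨K, hK0, hK⟩ := exists_norm_inv_one_add_le h0 hπ
  obtain ⟨a, C, ha, ha1, hC, hηc⟩ := norm_sub_le_of_isDecomposition h0 hπ hη hlim
  have hcn := norm_pos_iff.2 hc
  obtain ⟨r, hr, hr1, hrη⟩ : ∃ r : ℝ, 0 < r ∧ r ≤ 1 ∧ ∀ z ∈ sector φ, ‖z‖ ≤ r →
      ‖c‖ / 2 ≤ ‖z⁻¹ * ψ z‖ := by
    have := hlim.norm.eventually (lt_mem_nhds (half_lt_self hcn))
    obtain ⟨r, hr, hball⟩ := Metric.mem_nhdsWithin_iff.1 this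
    refine ⟨min (r / 2) 1, by positivity, min_le_right _ _, fun z hz hzr => ?_⟩
    refine le_of_lt (hball ⟨?_, hz⟩)
    rw [mem_ball_zero_iff]
    linarith [hzr.trans (min_le_left _ _)]
  refine ⟨(fun z => z * e z / ψ z - c⁻¹ * (1 + z)⁻¹, c⁻¹, 0), ?_, fun z hz => by simp⟩
  set N : ℝ := (C / ‖c‖ + B) / (‖c‖ / 2) + ‖c⁻¹‖ * K + D with hN
  have hdiff : DifferentiableOn ℂ (fun z => z * e z / ψ z - c⁻¹ * (1 + z)⁻¹) (sector φ) :=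
    ((differentiableOn_id.mul he).div hψ hne).sub
      ((differentiableOn_inv_one_add h0 hπ).const_mul _)
  refine MemHInftyZero.of_split_bounds (a := a) (r := r) (C := N) hdiff ha ha1 hr hr1
    (by positivity) (fun z hz hzr => ?_) fun z hz hzr => ?_ <;>
    have hz0 : 0 < ‖z‖ := norm_pos_iff.2 hz.1 <;> have hψz := norm_pos_iff.2 (hne z hz) <;>
    have hz1 := hz.1 <;> have hψ1 := hne z hz <;> have hk1 := (hK z hz).1
  · have hle1 := hzr.trans hr1
    have e1 : z * e z / ψ z - c⁻¹ * (1 + z)⁻¹ =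
        (-((z⁻¹ * ψ z - c) / c) - (1 - e z)) / (z⁻¹ * ψ z) + c⁻¹ * (z * (1 + z)⁻¹) := by
      field_simp
      ring
    have p1 : ‖z‖ ≤ ‖z‖ ^ a := by
      simpa using Real.rpow_le_rpow_of_exponent_ge hz0 hle1 ha1
    have p2 : ‖z‖ ^ 2 ≤ ‖z‖ ^ a := by
      refine le_trans ?_ p1
      rw [pow_two]
      exact mul_le_of_le_one_left hz0.le hle1
    have b1 : ‖-((z⁻¹ * ψ z - c) / c) - (1 - e z)‖ ≤ (C / ‖c‖ + B) * ‖z‖ ^ a := by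
      refine (norm_sub_le _ _).trans ?_
      rw [norm_neg, norm_div, add_mul]
      gcongr
      · rw [div_mul_eq_mul_div]
        gcongr
        exact hηc z hz hle1
      · exact (hB z hz).trans (by gcongr)
    have b2 : ‖z * (1 + z)⁻¹‖ ≤ K * ‖z‖ ^ a := by
      rw [norm_mul, mul_comm]
      gcongr
      exact (hK z hz).2.1
    change ‖z * e z / ψ z - c⁻¹ * (1 + z)⁻¹‖ ≤ _
    rw [e1]
    refine (norm_add_le _ _).trans ?_
    rw [norm_div, norm_mul c⁻¹]
    calc _ ≤ (C / ‖c‖ + B) * ‖z‖ ^ a / (‖c‖ / 2) + ‖c⁻¹‖ * (K * ‖z‖ ^ a) := by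
          gcongr
          exact hrη z hz hzr
      _ = ((C / ‖c‖ + B) / (‖c‖ / 2) + ‖c⁻¹‖ * K) * ‖z‖ ^ a := by ring
      _ ≤ _ := by gcongr; rw [hN]; linarith
  · refine (norm_sub_le _ _).trans ?_
    have b1 : ‖z * e z / ψ z‖ ≤ D * ‖z‖⁻¹ := by
      rw [norm_div, norm_mul, div_le_iff₀ hψz]
      calc _ ≤ ‖z‖ * (D * (‖z‖ ^ 2)⁻¹ * ‖ψ z‖) := by gcongr; exact hD z hz
        _ = _ := by field_simp
    have b2 : ‖c⁻¹ * (1 + z)⁻¹‖ ≤ ‖c⁻¹‖ * K * ‖z‖⁻¹ := by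
      rw [norm_mul, mul_assoc]
      gcongr
      rw [← div_eq_mul_inv, le_div_iff₀ hz0, mul_comm]
      exact (hK z hz).2.2
    calc _ ≤ (‖c⁻¹‖ * K + D) * ‖z‖⁻¹ := by linarith
      _ ≤ _ := by
        gcongr
        rw [hN]
        have : 0 ≤ (C / ‖c‖ + B) / (‖c‖ / 2) := by positivity
        linarith

/-- The auxiliary functions attached to `ψ`: with `e(z) = -∫_1^∞ g(sz) ψ(sz) ds/s` one has
`z e(z) = k(z) ψ(z)` and `1 - e(z) = z d(z)`. -/
theorem exists_auxiliary_functions (h0 : 0 < φ) (hπ : φ < Real.pi)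
    (hψ : DifferentiableOn ℂ ψ (sector φ))
    (hψE : MemE φ ψ) (hψE' : MemE φ (fun z => z⁻¹ * ψ z))
    (hlim : ∃ c : ℂ, c ≠ 0 ∧ Tendsto (fun z => z⁻¹ * ψ z) (𝓝[sector φ] 0) (𝓝 c))
    (hne : ∀ z ∈ sector φ, ψ z ≠ 0)
    (hsup : ∃ M : ℝ, ∀ z ∈ sector φ, ∀ s : ℝ, 1 ≤ s → ‖ψ (s * z) / (s * ψ z)‖ ≤ M) :
    ∃ g e d k : ℂ → ℂ, MemE φ g ∧ MemHInftyZero φ (fun z => g z * ψ z) ∧ MemE φ e ∧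
      MemE φ d ∧ MemE φ k ∧
      (∀ z ∈ sector φ, ∀ τ : ℝ, HasDerivAt (fun τ : ℝ => e (Real.exp τ * z))
        (g (Real.exp τ * z) * ψ (Real.exp τ * z)) τ) ∧
      (∀ z ∈ sector φ, 1 - e z = z * d z) ∧ ∀ z ∈ sector φ, z * e z = k z * ψ z := by
  obtain ⟨B₁, hB₁⟩ := hψE.bounded h0 hπ
  obtain ⟨B₂, hB₂⟩ := hψE'.bounded h0 hπ
  obtain ⟨M, hM⟩ := hsup
  obtain ⟨c, hc, hlim⟩ := hlim
  have hM0 : 0 ≤ M := (norm_nonneg _).trans (hM _ (ofReal_mem_sector h0 one_pos) 1 le_rfl)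
  obtain ⟨g, C, D, hg, hQ, hD0, hD, h1⟩ := exists_reproducing (B := max B₁ B₂) h0 hπ hψ hne
    (fun z hz => (hB₁ z hz).trans (le_max_left _ _)) fun z hz => by
      have hz0 : 0 < ‖z‖ := norm_pos_iff.2 hz.1
      have := hB₂ z hz
      rw [norm_mul, norm_inv, inv_mul_eq_div, div_le_iff₀ hz0] at this
      exact this.trans (by gcongr; exact le_max_right _ _)
  obtain ⟨B, hB0, hB1, hB2⟩ := hQ.exists_norm_radialTail_le
  -- The logarithmic derivative of the tail is `-gψ`, so the sign is absorbed into `g`.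
  refine ⟨fun z => -1 * g z, radialTail fun z => g z * ψ z,
    fun z => z⁻¹ * (1 - radialTail (fun z => g z * ψ z) z),
    fun z => z * radialTail (fun z => g z * ψ z) z / ψ z, (hg.const_mul _).memE, ?_,
    hQ.memE_radialTail hπ h1, (hQ.memHInftyZero_inv_mul_one_sub h1).memE,
    memE_mul_div h0 hπ hψ hne hψE' hc hlim hQ.differentiableOn_radialTail (mul_nonneg hD0 hM0)
      hB0 (fun z hz => norm_radialTail_mul_le hM hne hD0 hD hz) fun z hz => ?_,
    fun z hz τ => ?_, fun z hz => ?_, fun z hz => ?_⟩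
  · exact (hQ.memHInftyZero.const_mul (-1)).congr fun z _ => by ring
  · rw [hQ.one_sub_radialTail h1 hz]
    exact hB2 z hz
  · simp only [neg_mul, one_mul]
    exact hQ.hasDerivAt_radialTail hz τ
  · rw [mul_inv_cancel_left₀ hz.1]
  · rw [div_mul_cancel₀ _ (hne z hz)]

end ReproducingFunctions

/-! ### Elementary bounds for the `K`-functional -/

section KFunctional

variable {X : Type*} [NormedAddCommGroup X] [NormedSpace ℂ X] {A : X →ₗ.[ℂ] X} {t : ℝ} {x : X}

theorem graphNorm_nonneg (b : A.domain) : 0 ≤ graphNorm A b :=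
  add_nonneg (norm_nonneg _) (norm_nonneg _)

theorem kFunctional_le (ht : 0 ≤ t) (x : X) (b : A.domain) :
    kFunctional A.domain (graphNorm A) t x ≤ ‖x - b‖ + t * graphNorm A b := by
  refine csInf_le ⟨0, ?_⟩ ⟨x - b, b, sub_add_cancel _ _, rfl⟩
  rintro _ ⟨a, b, -, rfl⟩
  exact add_nonneg (norm_nonneg _) (mul_nonneg ht (graphNorm_nonneg b))

theorem le_kFunctional {m : ℝ} (h : ∀ b : A.domain, m ≤ ‖x - b‖ + t * graphNorm A b) :
    m ≤ kFunctional A.domain (graphNorm A) t x := by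
  refine le_csInf ⟨_, x, 0, by simp, rfl⟩ ?_
  rintro _ ⟨a, b, hab, rfl⟩
  rw [eq_sub_of_add_eq hab]
  exact h b

theorem kFunctional_nonneg (ht : 0 ≤ t) : 0 ≤ kFunctional A.domain (graphNorm A) t x :=
  le_kFunctional fun b => add_nonneg (norm_nonneg _) (mul_nonneg ht (graphNorm_nonneg b))

theorem kFunctional_le_norm (ht : 0 ≤ t) :
    kFunctional A.domain (graphNorm A) t x ≤ ‖x‖ := by
  simpa [graphNorm] using kFunctional_le ht x (0 : A.domain)

theorem kFunctional_mono {t' : ℝ} (ht : 0 ≤ t) (h : t ≤ t') :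
    kFunctional A.domain (graphNorm A) t x ≤ kFunctional A.domain (graphNorm A) t' x :=
  le_kFunctional fun b => (kFunctional_le ht x b).trans
    (by gcongr; exact graphNorm_nonneg b)

/-- The graph norm dominates the norm of `X`. This bound later recovers `‖x‖` from the interpolation
norm. -/
theorem min_mul_norm_le_kFunctional (ht : 0 ≤ t) :
    min 1 t * ‖x‖ ≤ kFunctional A.domain (graphNorm A) t x := by
  refine le_kFunctional fun b => ?_
  have h1 : ‖x‖ ≤ ‖x - b‖ + ‖(b : X)‖ := by simpa using norm_add_le (x - b) (b : X)
  have h2 : ‖(b : X)‖ ≤ graphNorm A b := le_add_of_nonneg_right (norm_nonneg _)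
  calc min 1 t * ‖x‖ ≤ min 1 t * (‖x - b‖ + ‖(b : X)‖) := by gcongr
    _ = min 1 t * ‖x - b‖ + min 1 t * ‖(b : X)‖ := mul_add _ _ _
    _ ≤ 1 * ‖x - b‖ + t * graphNorm A b := by
      gcongr
      · exact min_le_left _ _
      · exact min_le_right _ _
    _ = _ := by rw [one_mul]

end KFunctional

/-! ### Comparison of `K(t, x)` with `ψ(tA)x` -/

section Approximation

variable {X : Type*} [NormedAddCommGroup X] [NormedSpace ℂ X] [CompleteSpace X]
  {A : X →ₗ.[ℂ] X} {θ M ω φ : ℝ} {ψ g e d k : ℂ → ℂ}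

namespace HasCalculus

/-- On `x - b` the uniform bound of `ψ(tA)` is used; on `b` one factor `z` of `ψ` passes to the
operator, which gives `t‖A b‖`. -/
theorem exists_norm_calculus_le_kFunctional (h : HasCalculus A θ M ω φ) (hψ : MemE φ ψ)
    (hψ' : MemE φ fun z => z⁻¹ * ψ z) : ∃ C : ℝ, 0 < C ∧ ∀ t : ℝ, 0 < t → ∀ x : X,
      ‖primaryCalculus ((t : ℂ) • A) φ ψ x‖ ≤ C * kFunctional A.domain (graphNorm A) t x := by
  obtain ⟨C₁, hC₁, h₁⟩ := h.exists_norm_calculus_le ψ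
  obtain ⟨C₂, hC₂, h₂⟩ := h.exists_norm_calculus_le fun z => z⁻¹ * ψ z
  refine ⟨max C₁ C₂, by positivity, fun t ht x => ?_⟩
  rw [← inv_mul_le_iff₀ (by positivity)]
  refine le_kFunctional fun b => ?_
  rw [inv_mul_le_iff₀ (by positivity)]
  set T := primaryCalculus ((t : ℂ) • A) φ ψ with hT
  have e : T x = T (x - b) + T b := by rw [← map_add, sub_add_cancel]
  have hb : ‖T b‖ ≤ C₂ * (t * graphNorm A b) := by
    rw [hT, h.calculus_apply_domain ht hψ' hψ (fun z hz => (mul_inv_cancel_left₀ hz.1 _).symm) b,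
      norm_smul, Complex.norm_real, Real.norm_of_nonneg ht.le]
    calc _ ≤ t * (C₂ * ‖A b‖) := by
          gcongr
          exact ContinuousLinearMap.le_of_opNorm_le _ (h₂ t ht) _
      _ = C₂ * (t * ‖A b‖) := by ring
      _ ≤ _ := by
          gcongr
          exact le_add_of_nonneg_left (norm_nonneg _)
  calc ‖T x‖ ≤ ‖T (x - b)‖ + ‖T b‖ := by rw [e]; exact norm_add_le _ _
    _ ≤ C₁ * ‖x - b‖ + C₂ * (t * graphNorm A b) :=
      add_le_add (ContinuousLinearMap.le_of_opNorm_le _ (h₁ t ht) _) hb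
    _ ≤ max C₁ C₂ * ‖x - b‖ + max C₁ C₂ * (t * graphNorm A b) := by
      have := graphNorm_nonneg b
      gcongr
      · exact le_max_left _ _
      · exact le_max_right _ _
    _ = _ := (mul_add _ _ _).symm

/-- If `1 - e(z) = z d(z)`, then `e(sA)` tends to the identity on the domain as `s → 0`. -/
theorem tendsto_calculus_domain (h : HasCalculus A θ M ω φ) (he : MemE φ e) (hd : MemE φ d)
    (hed : ∀ z ∈ sector φ, 1 - e z = z * d z) (b : A.domain) :
    Tendsto (fun s : ℝ => primaryCalculus ((s : ℂ) • A) φ e b) (𝓝[>] 0) (𝓝 (b : X)) := by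
  obtain ⟨C, hC, hCd⟩ := h.exists_norm_calculus_le d
  have hc1 : MemE φ fun _ => (-1 : ℂ) := ⟨_, isDecomposition_const _⟩
  have hc2 : MemE φ fun _ => (1 : ℂ) := ⟨_, isDecomposition_const _⟩
  have h1 : MemE φ fun z => 1 + -1 * e z := hc2.add (hc1.mul h.angle_pos h.lt_pi he)
  have key : ∀ s : ℝ, 0 < s → ‖primaryCalculus ((s : ℂ) • A) φ e b - b‖ ≤ s * (C * ‖A b‖) := by
    intro s hs
    have e1 := h.calculus_add hs h1 he
    rw [h.calculus_congr hs hc2 (g := fun z => 1 + -1 * e z + e z) fun z _ => by ring,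
      h.calculus_const hs] at e1
    have e2 := h.calculus_apply_domain hs hd h1 (fun z hz => by rw [← hed z hz]; ring) b
    have e3 := congrArg (fun T : X →L[ℂ] X => T b) e1
    simp only [one_smul, ContinuousLinearMap.id_apply, add_apply, e2] at e3
    have e4 : primaryCalculus ((s : ℂ) • A) φ e b - b =
        -((s : ℂ) • primaryCalculus ((s : ℂ) • A) φ d (A b)) := by
      rw [sub_eq_iff_eq_add, neg_add_eq_sub, eq_sub_iff_add_eq', ← e3]
    rw [e4, norm_neg, norm_smul, Complex.norm_real, Real.norm_of_nonneg hs.le]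
    gcongr
    exact ContinuousLinearMap.le_of_opNorm_le _ (hCd s hs) _
  rw [tendsto_iff_norm_sub_tendsto_zero]
  have hlim : Tendsto (fun s : ℝ => s * (C * ‖A b‖)) (𝓝[>] 0) (𝓝 0) := by
    have := (tendsto_id (α := ℝ) (x := 𝓝 0)).mul_const (C * ‖A b‖)
    rw [zero_mul] at this
    exact this.mono_left nhdsWithin_le_nhds
  exact squeeze_zero' (Eventually.of_forall fun s => norm_nonneg _)
    (eventually_mem_nhdsWithin.mono fun s hs => key s hs) hlim

theorem continuousOn_calculus_apply (h : HasCalculus A θ M ω φ) (hψ : MemE φ ψ) (x : X) :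
    ContinuousOn (fun s : ℝ => primaryCalculus ((s : ℂ) • A) φ ψ x) (Set.Ioi 0) :=
  (h.continuousOn_calculus hψ).clm_apply continuousOn_const

/-- The reproducing formula `e(tA)x - x = ∫_0^t g(sA) ψ(sA) x ds/s`. -/
theorem calculus_sub_eq_integral (h : HasCalculus A θ M ω φ) (hψ : MemE φ ψ) (hg : MemE φ g)
    (hgψ : MemHInftyZero φ fun z => g z * ψ z) (he : MemE φ e) (hd : MemE φ d)
    (hder : ∀ z ∈ sector φ, ∀ τ : ℝ, HasDerivAt (fun τ : ℝ => e (Real.exp τ * z))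
      (g (Real.exp τ * z) * ψ (Real.exp τ * z)) τ)
    (hed : ∀ z ∈ sector φ, 1 - e z = z * d z) {t : ℝ} (ht : 0 < t) {x : X}
    (hi : IntegrableOn (fun s : ℝ => s⁻¹ • primaryCalculus ((s : ℂ) • A) φ g
      (primaryCalculus ((s : ℂ) • A) φ ψ x)) (Set.Ioc 0 t)) :
    primaryCalculus ((t : ℂ) • A) φ e x - x = ∫ s in Set.Ioc 0 t,
      s⁻¹ • primaryCalculus ((s : ℂ) • A) φ g (primaryCalculus ((s : ℂ) • A) φ ψ x) := by
  -- Convergence of `e(sA)y` to `y` as `s → 0` is known only for `y` in the domain. Hence the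
  -- identity is proved after applying `S`, which commutes with the calculus and is injective.
  set S := resolventOf A (-1) with hS
  have hmem := isResolventAt_resolventOf (h.res _
    (neg_one_mem_outerSector h.family.pos h.family.lt_pi))
  have hinj : ∀ y : X, S y = 0 → y = 0 := fun y hy => by
    refine h.resolvent_injective one_pos ?_
    rw [dilate]
    simpa using hy
  obtain ⟨hdom, -⟩ := hmem.1 x
  set b : A.domain := ⟨S x, hdom⟩ with hb
  have hcomm : ∀ s : ℝ, 0 < s → S (s⁻¹ • primaryCalculus ((s : ℂ) • A) φ g
      (primaryCalculus ((s : ℂ) • A) φ ψ x)) = s⁻¹ • primaryCalculus ((s : ℂ) • A) φ g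
      (primaryCalculus ((s : ℂ) • A) φ ψ b) := fun s hs => by
    rw [← Complex.coe_smul, map_smul, Complex.coe_smul, h.calculus_comm_resolvent hs hg,
      h.calculus_comm_resolvent hs hψ]
  rw [← sub_eq_zero]
  refine hinj _ ?_
  rw [map_sub, map_sub, h.calculus_comm_resolvent ht he, ← S.integral_comp_comm hi, sub_eq_zero,
    setIntegral_congr_fun measurableSet_Ioc fun s hs => hcomm s hs.1,
    ← intervalIntegral.integral_of_le ht.le]
  symm
  have hderiv : ∀ s : ℝ, 0 < s → HasDerivAt (fun s : ℝ => primaryCalculus ((s : ℂ) • A) φ e b)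
      (s⁻¹ • primaryCalculus ((s : ℂ) • A) φ g (primaryCalculus ((s : ℂ) • A) φ ψ b)) s := by
    intro s hs
    have := h.hasDerivAt_calculus he hgψ hder hs
    rw [h.calculus_mul hs hg hψ] at this
    exact ((ContinuousLinearMap.apply ℂ X (b : X)).restrictScalars ℝ).hasFDerivAt.comp_hasDerivAt
      s this
  refine intervalIntegral.integral_eq_sub_of_hasDerivAt_of_tendsto ht
    (fun s hs => hderiv s hs.1) ?_ (h.tendsto_calculus_domain he hd hed b)
    ((hderiv t ht).continuousAt.tendsto.mono_left nhdsWithin_le_nhds)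
  rw [intervalIntegrable_iff_integrableOn_Ioc_of_le ht.le]
  exact (S.integrable_comp hi).congr ((ae_restrict_mem measurableSet_Ioc).mono
    fun s hs => hcomm s hs.1)

/-- Approximation of `x` by elements `e(tA)x` of the domain, controlled by `ψ(sA)x`. -/
theorem exists_approximation (h : HasCalculus A θ M ω φ)
    (hψ : DifferentiableOn ℂ ψ (sector φ))
    (hψE : MemE φ ψ) (hψE' : MemE φ (fun z => z⁻¹ * ψ z))
    (hlim : ∃ c : ℂ, c ≠ 0 ∧ Tendsto (fun z => z⁻¹ * ψ z) (𝓝[sector φ] 0) (𝓝 c))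
    (hne : ∀ z ∈ sector φ, ψ z ≠ 0)
    (hsup : ∃ M : ℝ, ∀ z ∈ sector φ, ∀ s : ℝ, 1 ≤ s → ‖ψ (s * z) / (s * ψ z)‖ ≤ M) :
    ∃ C : ℝ, 0 < C ∧ ∀ t : ℝ, 0 < t → ∀ x : X,
      IntegrableOn (fun s : ℝ => s⁻¹ * ‖primaryCalculus ((s : ℂ) • A) φ ψ x‖) (Set.Ioc 0 t) →
      ∃ b : A.domain, ‖(b : X)‖ ≤ C * ‖x‖ ∧
        t * ‖A b‖ ≤ C * ‖primaryCalculus ((t : ℂ) • A) φ ψ x‖ ∧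
        ‖x - b‖ ≤ C * ∫ s in Set.Ioc 0 t, s⁻¹ * ‖primaryCalculus ((s : ℂ) • A) φ ψ x‖ := by
  obtain ⟨g, e, d, k, hg, hgψ, he, hd, hk, hder, hed, hek⟩ :=
    exists_auxiliary_functions h.angle_pos h.lt_pi hψ hψE hψE' hlim hne hsup
  obtain ⟨Cg, hCg, bg⟩ := h.exists_norm_calculus_le g
  obtain ⟨Ce, hCe, be⟩ := h.exists_norm_calculus_le e
  obtain ⟨Ck, hCk, bk⟩ := h.exists_norm_calculus_le k
  refine ⟨max Cg (max Ce Ck), by positivity, fun t ht x hi => ?_⟩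
  -- The approximant is `e(tA)x`; `z e(z) = k(z)ψ(z)` places it in the domain and identifies `tA
  -- e(tA)x`.
  obtain ⟨hdom, hA⟩ := h.calculus_mem_domain ht he (hk.mul h.angle_pos h.lt_pi hψE)
    (fun z hz => (hek z hz).symm) x
  refine ⟨⟨_, hdom⟩, ?_, ?_, ?_⟩
  · exact ContinuousLinearMap.le_of_opNorm_le _ ((be t ht).trans (by simp)) _
  · have := congrArg norm hA
    rw [norm_smul, Complex.norm_real, Real.norm_of_nonneg ht.le, h.calculus_mul ht hk hψE] at this
    rw [this]
    exact ContinuousLinearMap.le_of_opNorm_le _ ((bk t ht).trans (by simp)) _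
  · have hb : ∀ s ∈ Set.Ioc (0 : ℝ) t, ‖s⁻¹ • primaryCalculus ((s : ℂ) • A) φ g
        (primaryCalculus ((s : ℂ) • A) φ ψ x)‖ ≤
          Cg * (s⁻¹ * ‖primaryCalculus ((s : ℂ) • A) φ ψ x‖) := by
      intro s hs
      have hs0 : 0 < s := hs.1
      rw [norm_smul, Real.norm_of_nonneg (inv_nonneg.2 hs0.le), mul_left_comm]
      gcongr
      exact ContinuousLinearMap.le_of_opNorm_le _ (bg s hs0) _
    have hae : ∀ᵐ s : ℝ ∂volume.restrict (Set.Ioc 0 t), ‖s⁻¹ • primaryCalculus ((s : ℂ) • A) φ g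
        (primaryCalculus ((s : ℂ) • A) φ ψ x)‖ ≤
          Cg * (s⁻¹ * ‖primaryCalculus ((s : ℂ) • A) φ ψ x‖) :=
      (ae_restrict_mem measurableSet_Ioc).mono hb
    have hint : IntegrableOn (fun s : ℝ => s⁻¹ • primaryCalculus ((s : ℂ) • A) φ g
        (primaryCalculus ((s : ℂ) • A) φ ψ x)) (Set.Ioc 0 t) := by
      refine (hi.const_mul Cg).mono' (ContinuousOn.aestronglyMeasurable ?_ measurableSet_Ioc) hae
      refine ContinuousOn.mono ?_ (Set.Ioc_subset_Ioi_self : Set.Ioc (0 : ℝ) t ⊆ Set.Ioi 0)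
      exact (continuousOn_id.inv₀ fun s (hs : s ∈ Set.Ioi (0 : ℝ)) => ne_of_gt hs).smul
        ((h.continuousOn_calculus hg).clm_apply (h.continuousOn_calculus_apply hψE x))
    rw [norm_sub_rev]
    change ‖primaryCalculus ((t : ℂ) • A) φ e x - x‖ ≤ _
    rw [h.calculus_sub_eq_integral hψE hg hgψ he hd hder hed ht hint]
    refine (norm_integral_le_of_norm_le (hi.const_mul Cg) hae).trans ?_
    rw [integral_const_mul]
    gcongr
    · exact setIntegral_nonneg measurableSet_Ioc fun s (hs : s ∈ Set.Ioc (0 : ℝ) t) =>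
        mul_nonneg (inv_nonneg.2 hs.1.le) (norm_nonneg _)
    · exact le_max_left _ _

end HasCalculus

end Approximation

/-! ### Banach function spaces in terms of functions -/

section FunctionSpaceLemmas

namespace BanachFunctionSpace

variable {Φ : BanachFunctionSpace} {u v : ℝ → ℂ}

theorem nrm_eq (h : Φ.Mem u) : Φ.nrm u = Φ.normF ⟨AEEqFun.mk u h.choose, h.choose_spec⟩ := by
  rw [nrm, dif_pos h]

theorem nrm_nonneg (u : ℝ → ℂ) : 0 ≤ Φ.nrm u := by
  rw [nrm]
  split_ifs
  · exact apply_nonneg _ _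
  · exact le_rfl

theorem Mem.of_le (hu : AEStronglyMeasurable u halfLine) (hv : Φ.Mem v)
    (h : ∀ᵐ t ∂halfLine, ‖u t‖ ≤ ‖v t‖) : Φ.Mem u ∧ Φ.nrm u ≤ Φ.nrm v := by
  have hae : ∀ (hu : AEStronglyMeasurable u halfLine) (hv : AEStronglyMeasurable v halfLine),
      ∀ᵐ t ∂halfLine, ‖AEEqFun.mk u hu t‖ ≤ ‖AEEqFun.mk v hv t‖ := fun hu hv => by
    filter_upwards [h, AEEqFun.coeFn_mk u hu, AEEqFun.coeFn_mk v hv] with t h1 h2 h3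
    rwa [h2, h3]
  have hm : Φ.Mem u := ⟨hu, Φ.ideal _ _ (hae hu hv.choose) hv.choose_spec⟩
  refine ⟨hm, ?_⟩
  rw [nrm_eq hm, nrm_eq hv]
  exact Φ.normF_mono _ _ (hae _ _)

theorem Mem.add (hu : Φ.Mem u) (hv : Φ.Mem v) :
    Φ.Mem (fun t => u t + v t) ∧ Φ.nrm (fun t => u t + v t) ≤ Φ.nrm u + Φ.nrm v := by
  have hm : Φ.Mem (fun t => u t + v t) :=
    ⟨hu.choose.add hv.choose, Φ.carrier.add_mem hu.choose_spec hv.choose_spec⟩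
  refine ⟨hm, ?_⟩
  rw [nrm_eq hm, nrm_eq hu, nrm_eq hv]
  exact map_add_le_add Φ.normF ⟨AEEqFun.mk u hu.choose, hu.choose_spec⟩
    ⟨AEEqFun.mk v hv.choose, hv.choose_spec⟩

theorem Mem.const_mul (c : ℂ) (hu : Φ.Mem u) :
    Φ.Mem (fun t => c * u t) ∧ Φ.nrm (fun t => c * u t) = ‖c‖ * Φ.nrm u := by
  have hm : Φ.Mem (fun t => c * u t) :=
    ⟨hu.choose.const_mul c, Φ.carrier.smul_mem c hu.choose_spec⟩
  refine ⟨hm, ?_⟩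
  rw [nrm_eq hm, nrm_eq hu]
  exact map_smul_eq_mul Φ.normF c ⟨AEEqFun.mk u hu.choose, hu.choose_spec⟩

theorem Mem.norm (hu : Φ.Mem u) :
    Φ.Mem (fun t => (‖u t‖ : ℂ)) ∧ Φ.nrm (fun t => (‖u t‖ : ℂ)) ≤ Φ.nrm u :=
  Mem.of_le (Complex.continuous_ofReal.comp_aestronglyMeasurable hu.choose.norm) hu
    (ae_of_all _ fun t => by simp)

theorem Mem.of_le_const_mul (hu : AEStronglyMeasurable u halfLine) {a : ℝ} (ha : 0 ≤ a)
    (hv : Φ.Mem v) (h : ∀ t : ℝ, 0 < t → ‖u t‖ ≤ a * ‖v t‖) :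
    Φ.Mem u ∧ Φ.nrm u ≤ a * Φ.nrm v := by
  obtain ⟨h1, h2⟩ := hv.const_mul (a : ℂ)
  obtain ⟨h3, h4⟩ := Mem.of_le hu h1 ((ae_restrict_mem measurableSet_Ioi).mono fun t ht => by
    rw [norm_mul, Complex.norm_real, Real.norm_of_nonneg ha]
    exact h t ht)
  rw [h2, Complex.norm_real, Real.norm_of_nonneg ha] at h4
  exact ⟨h3, h4⟩

theorem Mem.of_le_add {w : ℝ → ℂ} (hu : AEStronglyMeasurable u halfLine) {a b : ℝ} (ha : 0 ≤ a)
    (hb : 0 ≤ b) (hv : Φ.Mem v) (hw : Φ.Mem w)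
    (h : ∀ t : ℝ, 0 < t → ‖u t‖ ≤ a * ‖v t‖ + b * ‖w t‖) :
    Φ.Mem u ∧ Φ.nrm u ≤ a * Φ.nrm v + b * Φ.nrm w := by
  obtain ⟨v1, v2⟩ := hv.norm
  obtain ⟨w1, w2⟩ := hw.norm
  obtain ⟨v3, v4⟩ := v1.const_mul (a : ℂ)
  obtain ⟨w3, w4⟩ := w1.const_mul (b : ℂ)
  rw [Complex.norm_real, Real.norm_of_nonneg ha] at v4
  rw [Complex.norm_real, Real.norm_of_nonneg hb] at w4
  obtain ⟨s1, s2⟩ := v3.add w3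
  obtain ⟨r1, r2⟩ := Mem.of_le hu s1 ((ae_restrict_mem measurableSet_Ioi).mono fun t ht => by
    rw [← Complex.ofReal_mul, ← Complex.ofReal_mul, ← Complex.ofReal_add, Complex.norm_real]
    exact (h t ht).trans (le_abs_self _))
  refine ⟨r1, r2.trans (s2.trans ?_)⟩
  rw [v4, w4]
  gcongr

/-- Permits division by the norm of `min(1, 1/t)`. -/
theorem nrm_pos_of_ne_zero (hu : Φ.Mem u) (h : ∀ t : ℝ, 0 < t → u t ≠ 0) : 0 < Φ.nrm u := by
  refine lt_of_le_of_ne (nrm_nonneg u) fun h0 => ?_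
  rw [nrm_eq hu] at h0
  have h1 := congrArg Subtype.val (Φ.eq_zero_of_normF _ h0.symm)
  have h2 : u =ᵐ[halfLine] 0 := by
    refine (AEEqFun.coeFn_mk u hu.choose).symm.trans ?_
    change AEEqFun.mk u hu.choose = 0 at h1
    rw [h1]
    exact AEEqFun.coeFn_zero
  have h3 : ∀ᵐ t ∂halfLine, False := by
    filter_upwards [h2, ae_restrict_mem measurableSet_Ioi] with t h4 ht
    exact h t ht h4
  rw [ae_iff] at h3
  simp [halfLine] at h3

end BanachFunctionSpace

end FunctionSpaceLemmas

/-! ### Pointwise estimates for `t⁻¹K(t, x)` -/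

section Equivalence

variable {X : Type*} [NormedAddCommGroup X] [NormedSpace ℂ X] {A : X →ₗ.[ℂ] X} {x : X}

theorem norm_kFunction {t : ℝ} (ht : 0 < t) :
    ‖kFunction A x t‖ = t⁻¹ * kFunctional A.domain (graphNorm A) t x := by
  rw [kFunction, Complex.norm_real, Real.norm_of_nonneg
    (mul_nonneg (inv_nonneg.2 ht.le) (kFunctional_nonneg ht.le))]

theorem norm_calculusFunction {φ : ℝ} {ψ : ℂ → ℂ} {t : ℝ} (ht : 0 < t) :
    ‖calculusFunction A φ ψ x t‖ = t⁻¹ * ‖primaryCalculus ((t : ℂ) • A) φ ψ x‖ := by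
  rw [calculusFunction, Complex.norm_real, Real.norm_of_nonneg
    (mul_nonneg (inv_nonneg.2 ht.le) (norm_nonneg _))]

theorem norm_hardy_calculusFunction {φ : ℝ} {ψ : ℂ → ℂ} {t : ℝ} (ht : 0 < t) :
    ‖hardy (calculusFunction A φ ψ x) t‖ =
      t⁻¹ * ∫ s in Set.Ioc 0 t, s⁻¹ * ‖primaryCalculus ((s : ℂ) • A) φ ψ x‖ := by
  have : 0 ≤ ∫ s in Set.Ioc 0 t, s⁻¹ * ‖primaryCalculus ((s : ℂ) • A) φ ψ x‖ :=
    setIntegral_nonneg measurableSet_Ioc fun s hs =>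
      mul_nonneg (inv_nonneg.2 hs.1.le) (norm_nonneg _)
  simp only [hardy, calculusFunction]
  rw [integral_complex_ofReal, norm_mul, norm_inv, Complex.norm_real, Complex.norm_real,
    Real.norm_of_nonneg ht.le, Real.norm_of_nonneg this]

/-- `K(·, x)` is monotone on the half-line, hence measurable. -/
theorem aestronglyMeasurable_kFunction (A : X →ₗ.[ℂ] X) (x : X) :
    AEStronglyMeasurable (kFunction A x) halfLine := by
  have h1 : AEMeasurable (fun t => kFunctional A.domain (graphNorm A) t x) halfLine :=
    aemeasurable_restrict_of_monotoneOn measurableSet_Ioi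
      fun s hs t _ hst => kFunctional_mono (le_of_lt hs) hst
  exact Complex.continuous_ofReal.comp_aestronglyMeasurable
    (measurable_inv.aemeasurable.mul h1).aestronglyMeasurable

variable [CompleteSpace X] {θ M ω φ : ℝ} {ψ : ℂ → ℂ}

theorem HasCalculus.aestronglyMeasurable_calculusFunction (h : HasCalculus A θ M ω φ)
    (hψ : MemE φ ψ) (x : X) : AEStronglyMeasurable (calculusFunction A φ ψ x) halfLine := by
  refine ContinuousOn.aestronglyMeasurable ?_ measurableSet_Ioi
  exact Complex.continuous_ofReal.comp_continuousOn
    ((continuousOn_id.inv₀ fun s (hs : s ∈ Set.Ioi (0 : ℝ)) => ne_of_gt hs).mul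
      (h.continuousOn_calculus_apply hψ x).norm)

/-- The graph norm of the approximant contains `‖b‖`, which is bounded by `C‖x‖` in general and by
`D‖A b‖` in the invertible case; this accounts for the two estimates. -/
theorem HasCalculus.exists_norm_kFunction_le (h : HasCalculus A θ M ω φ)
    (hψ : DifferentiableOn ℂ ψ (sector φ))
    (hψE : MemE φ ψ) (hψE' : MemE φ (fun z => z⁻¹ * ψ z))
    (hlim : ∃ c : ℂ, c ≠ 0 ∧ Tendsto (fun z => z⁻¹ * ψ z) (𝓝[sector φ] 0) (𝓝 c))
    (hne : ∀ z ∈ sector φ, ψ z ≠ 0)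
    (hsup : ∃ M : ℝ, ∀ z ∈ sector φ, ∀ s : ℝ, 1 ≤ s → ‖ψ (s * z) / (s * ψ z)‖ ≤ M) :
    ∃ C : ℝ, 0 < C ∧ ∀ x : X,
      (∀ t > 0, IntegrableOn (calculusFunction A φ ψ x) (Set.Ioc 0 t)) →
      (∀ t : ℝ, 0 < t → ‖kFunction A x t‖ ≤
        C * (‖hardy (calculusFunction A φ ψ x) t‖ + ‖calculusFunction A φ ψ x t‖) +
          C * ‖x‖ * min 1 (1 / t)) ∧
      ∀ D : ℝ, 0 ≤ D → (∀ b : A.domain, ‖(b : X)‖ ≤ D * ‖A b‖) →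
        ∀ t : ℝ, 0 < t → ‖kFunction A x t‖ ≤
          (D + 1) * C * (‖hardy (calculusFunction A φ ψ x) t‖ + ‖calculusFunction A φ ψ x t‖) := by
  obtain ⟨C, hC, happ⟩ := h.exists_approximation hψ hψE hψE' hlim hne hsup
  -- `C` serves `t ≤ 1`, where the approximation is used; the extra `1` serves `t ≥ 1`, where `K(t,
  -- x) ≤ ‖x‖` suffices.
  refine ⟨C + 1, by positivity, fun x hi => ?_⟩
  have happ' : ∀ t : ℝ, 0 < t → ∃ b : A.domain, ‖(b : X)‖ ≤ C * ‖x‖ ∧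
      ‖A b‖ ≤ C * ‖calculusFunction A φ ψ x t‖ ∧
      t⁻¹ * ‖x - b‖ ≤ C * ‖hardy (calculusFunction A φ ψ x) t‖ := by
    intro t ht
    obtain ⟨b, h1, h2, h3⟩ := happ t ht x (hi t ht).re
    refine ⟨b, h1, ?_, ?_⟩
    · rw [norm_calculusFunction ht, mul_left_comm, inv_mul_eq_div, le_div_iff₀ ht, mul_comm]
      exact h2
    · rw [norm_hardy_calculusFunction ht, mul_left_comm]
      gcongr
  have hk : ∀ (t : ℝ), 0 < t → ∀ b : A.domain,
      ‖kFunction A x t‖ ≤ t⁻¹ * ‖x - b‖ + (‖(b : X)‖ + ‖A b‖) := by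
    intro t ht b
    rw [norm_kFunction ht, inv_mul_le_iff₀ ht]
    refine (kFunctional_le ht.le x b).trans (le_of_eq ?_)
    rw [graphNorm]
    field_simp
  constructor
  · intro t ht
    rcases le_total t 1 with ht1 | ht1
    · rw [min_eq_left ((one_le_div ht).2 ht1)]
      obtain ⟨b, h1, h2, h3⟩ := happ' t ht
      have n1 := norm_nonneg (hardy (calculusFunction A φ ψ x) t)
      have n2 := norm_nonneg (calculusFunction A φ ψ x t)
      linarith [hk t ht b, norm_nonneg x]
    · rw [min_eq_right ((div_le_one ht).2 ht1), norm_kFunction ht, one_div]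
      have n1 : 0 ≤ (C + 1) * (‖hardy (calculusFunction A φ ψ x) t‖ +
        ‖calculusFunction A φ ψ x t‖) := by positivity
      have n2 : 0 ≤ C * ‖x‖ * t⁻¹ := by positivity
      have n3 : t⁻¹ * kFunctional A.domain (graphNorm A) t x ≤ t⁻¹ * ‖x‖ := by
        gcongr
        exact kFunctional_le_norm ht.le
      linarith
  · intro D hD0 hD t ht
    obtain ⟨b, h1, h2, h3⟩ := happ' t ht
    have b1 : D * ‖A b‖ ≤ D * (C * ‖calculusFunction A φ ψ x t‖) := by gcongr
    have n1 : 0 ≤ (D + 1) * ‖hardy (calculusFunction A φ ψ x) t‖ := by positivity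
    have n2 : 0 ≤ (D + 1) * ‖calculusFunction A φ ψ x t‖ := by positivity
    have n3 : 0 ≤ D * (C * ‖hardy (calculusFunction A φ ψ x) t‖) := by positivity
    linarith [hk t ht b, hD b]

theorem IsInvertible.exists_norm_le {A : X →ₗ.[ℂ] X} (hA : IsInvertible A) :
    ∃ D : ℝ, 0 ≤ D ∧ ∀ b : A.domain, ‖(b : X)‖ ≤ D * ‖A b‖ := by
  obtain ⟨R, -, hR⟩ := hA
  refine ⟨‖R‖, norm_nonneg R, fun b => ?_⟩
  have := R.le_opNorm ((0 : ℂ) • (b : X) - A b)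
  rwa [hR b, zero_smul, zero_sub, norm_neg] at this

end Equivalence

end GenInterp

end

/-! ### The equivalence of norms -/

theorem theorem3p1 {X : Type*} [NormedAddCommGroup X] [NormedSpace ℂ X] [CompleteSpace X]
    (A : X →ₗ.[ℂ] X) (hA : IsSectorial A)
    (φ : ℝ) (hφA : sectorialityAngle A < φ) (hφ : φ < Real.pi)
    (ψ : ℂ → ℂ) (hψ : DifferentiableOn ℂ ψ (sector φ))
    (hψE : MemE φ ψ) (hψE' : MemE φ (fun z => z⁻¹ * ψ z))
    (hlim : ∃ c : ℂ, c ≠ 0 ∧ Tendsto (fun z => z⁻¹ * ψ z) (𝓝[sector φ] 0) (𝓝 c))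
    (hne : ∀ z ∈ sector φ, ψ z ≠ 0)
    (hsup : ∃ M : ℝ, ∀ z ∈ sector φ, ∀ s : ℝ, 1 ≤ s → ‖ψ (s * z) / (s * ψ z)‖ ≤ M)
    (Φ : BanachFunctionSpace) (hΦ : HardyBounded Φ)
    (hmin : Φ.Mem (fun t : ℝ => ((min 1 (1 / t) : ℝ) : ℂ))) :
    interpolationSpace A Φ = {x : X | Φ.Mem (calculusFunction A φ ψ x)} ∧
    (∃ c C : ℝ, 0 < c ∧ 0 < C ∧ ∀ x ∈ interpolationSpace A Φ,
      c * (‖x‖ + Φ.nrm (calculusFunction A φ ψ x)) ≤ interpolationNorm A Φ x ∧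
      interpolationNorm A Φ x ≤ C * (‖x‖ + Φ.nrm (calculusFunction A φ ψ x))) ∧
    (IsInvertible A → ∃ c C : ℝ, 0 < c ∧ 0 < C ∧ ∀ x ∈ interpolationSpace A Φ,
      c * Φ.nrm (calculusFunction A φ ψ x) ≤ interpolationNorm A Φ x ∧
      interpolationNorm A Φ x ≤ C * Φ.nrm (calculusFunction A φ ψ x)) := by
  obtain ⟨θ, M, ω, h⟩ := hA.exists_hasCalculus hφA hφ
  obtain ⟨C₁, hC₁, up⟩ := h.exists_norm_calculus_le_kFunctional hψE hψE'
  obtain ⟨C₂, hC₂, low⟩ := h.exists_norm_kFunction_le hψ hψE hψE' hlim hne hsup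
  obtain ⟨H, hH⟩ := hΦ
  set m : ℝ → ℂ := fun t : ℝ => ((min 1 (1 / t) : ℝ) : ℂ) with hm
  have norm_m : ∀ t : ℝ, 0 < t → ‖m t‖ = min 1 (1 / t) := fun t ht => by
    rw [hm, Complex.norm_real, Real.norm_of_nonneg (by positivity)]
  have m_pos : 0 < Φ.nrm m := BanachFunctionSpace.nrm_pos_of_ne_zero hmin fun t ht => by
    rw [← norm_pos_iff, norm_m t ht]
    positivity
  have mem_of_K : ∀ x ∈ interpolationSpace A Φ, Φ.Mem (calculusFunction A φ ψ x) ∧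
      Φ.nrm (calculusFunction A φ ψ x) ≤ C₁ * interpolationNorm A Φ x := fun x hx =>
    BanachFunctionSpace.Mem.of_le_const_mul (h.aestronglyMeasurable_calculusFunction hψE x)
      hC₁.le hx fun t ht => by
        rw [norm_calculusFunction ht, norm_kFunction ht, mul_left_comm]
        gcongr
        exact up t ht x
  -- Pointwise this is `min(1, t)‖x‖ ≤ K(t, x)` divided by `t`.
  have norm_le_K : ∀ x ∈ interpolationSpace A Φ, ‖x‖ * Φ.nrm m ≤ interpolationNorm A Φ x := by
    intro x hx
    obtain ⟨h1, h2⟩ := hmin.const_mul (‖x‖ : ℂ)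
    rw [Complex.norm_real, norm_norm] at h2
    rw [← h2]
    refine (BanachFunctionSpace.Mem.of_le h1.choose hx
      ((ae_restrict_mem measurableSet_Ioi).mono fun t ht => ?_)).2
    have ht : 0 < t := ht
    rw [norm_mul, Complex.norm_real, norm_norm, norm_m t ht, norm_kFunction ht,
      le_inv_mul_iff₀ ht]
    refine le_trans (le_of_eq ?_) (min_mul_norm_le_kFunctional ht.le)
    rw [mul_left_comm, mul_min_of_nonneg _ _ ht.le, mul_one, mul_one_div_cancel ht.ne',
      min_comm, mul_comm]
  -- The Hardy constant `H` comes without a sign; `|H| + 1` bounds the Hardy average together with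
  -- the function itself and is positive.
  have hardy_le : ∀ x, Φ.Mem (calculusFunction A φ ψ x) →
      Φ.Mem (fun t => (‖hardy (calculusFunction A φ ψ x) t‖ : ℂ) +
        (‖calculusFunction A φ ψ x t‖ : ℂ)) ∧
      Φ.nrm (fun t => (‖hardy (calculusFunction A φ ψ x) t‖ : ℂ) +
        (‖calculusFunction A φ ψ x t‖ : ℂ)) ≤
          (|H| + 1) * Φ.nrm (calculusFunction A φ ψ x) := by
    intro x hx
    obtain ⟨-, h1, h2⟩ := hH _ hx
    obtain ⟨h3, h4⟩ := h1.norm.1.add hx.norm.1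
    refine ⟨h3, ?_⟩
    have h5 := mul_le_mul_of_nonneg_right (le_abs_self H)
      (BanachFunctionSpace.nrm_nonneg (Φ := Φ) (calculusFunction A φ ψ x))
    linarith [h1.norm.2, hx.norm.2]
  have norm_hardy_add : ∀ x t, ‖(‖hardy (calculusFunction A φ ψ x) t‖ : ℂ) +
      (‖calculusFunction A φ ψ x t‖ : ℂ)‖ =
        ‖hardy (calculusFunction A φ ψ x) t‖ + ‖calculusFunction A φ ψ x t‖ := fun x t => by
    rw [← Complex.ofReal_add, Complex.norm_real, Real.norm_of_nonneg (by positivity)]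
  have K_of_mem : ∀ x, Φ.Mem (calculusFunction A φ ψ x) → x ∈ interpolationSpace A Φ ∧
      interpolationNorm A Φ x ≤ C₂ * ((|H| + 1) * Φ.nrm (calculusFunction A φ ψ x)) +
        C₂ * ‖x‖ * Φ.nrm m := by
    intro x hx
    obtain ⟨h1, h2⟩ := hardy_le x hx
    obtain ⟨h3, h4⟩ := BanachFunctionSpace.Mem.of_le_add (aestronglyMeasurable_kFunction A x)
      hC₂.le (mul_nonneg hC₂.le (norm_nonneg x)) h1 hmin fun t ht => by
        rw [norm_hardy_add, norm_m t ht]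
        exact (low x (hH _ hx).1).1 t ht
    exact ⟨h3, h4.trans (by gcongr)⟩
  refine ⟨Set.ext fun x => ⟨fun hx => (mem_of_K x hx).1, fun hx => (K_of_mem x hx).1⟩,
    -- In the lower constant `C₁` accounts for `ψ(tA)x` and `(Φ.nrm m)⁻¹` for `‖x‖`; the upper one
    -- dominates both coefficients in `K_of_mem`.
    ⟨(C₁ + (Φ.nrm m)⁻¹)⁻¹, C₂ * (|H| + 1 + Φ.nrm m), by positivity, by positivity,
      fun x hx => ⟨?_, ?_⟩⟩, fun hinv => ?_⟩
  · have h1 := (mem_of_K x hx).2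
    have h2 := norm_le_K x hx
    rw [← le_div_iff₀ m_pos, div_eq_inv_mul] at h2
    rw [inv_mul_le_iff₀ (by positivity)]
    linarith
  · refine (K_of_mem x (mem_of_K x hx).1).2.trans ?_
    have h1 := BanachFunctionSpace.nrm_nonneg (Φ := Φ) (calculusFunction A φ ψ x)
    have h2 : 0 ≤ C₂ * ((|H| + 1) * ‖x‖) := by positivity
    have h3 : 0 ≤ C₂ * (Φ.nrm m * Φ.nrm (calculusFunction A φ ψ x)) := by positivity
    linarith
  · obtain ⟨D, hD0, hD⟩ := hinv.exists_norm_le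
    refine ⟨C₁⁻¹, (D + 1) * C₂ * (|H| + 1), by positivity, by positivity, fun x hx => ⟨?_, ?_⟩⟩
    · rw [inv_mul_le_iff₀ hC₁]
      exact (mem_of_K x hx).2
    · have hu := (mem_of_K x hx).1
      obtain ⟨h1, h2⟩ := hardy_le x hu
      have h3 := (BanachFunctionSpace.Mem.of_le_const_mul (aestronglyMeasurable_kFunction A x)
        (by positivity : 0 ≤ (D + 1) * C₂) h1 fun t ht => by
          rw [norm_hardy_add]
          exact (low x (hH _ hu).1).2 D hD0 hD t ht).2
      refine h3.trans ?_
      rw [mul_assoc _ (|H| + 1)]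
      gcongr
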